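/- Let $d\in\mathbb N$, let $B=\frac12\sum_{j,k}B_{jk}\,dx_j\wedge dx_k$ be a magnetic field on $\mathbb R^d$, i.e. a closed $2$-form with $B_{jk}=-B_{kj}$ smooth, real and bounded together with all derivatives, and let $A=\sum_jA_j\,dx_j$ be a vector potential, $dA=B$, whose real coefficients are smooth with all derivatives of at most polynomial growth. Put $\langle\xi\rangle=(1+|\xi|^2)^{1/2}$, $D_x=-i\partial_x$ and $$\omega^A(x,y)=\exp\Big(-i\int_{[x,y]}A\Big)=\exp\Big(i\Big\langle x-y,\int_0^1A\big((1-s)x+sy\big)\,ds\Big\rangle\Big).$$ For $m\in\mathbb R$ let $S^m$ be the set of $f\in C^\infty(\mathbb R^d\times\mathbb R^d;\mathbb C)$ such that $\sup_{x,\xi}\langle\xi\rangle^{|\beta|-m}|\partial_x^\alpha\partial_\xi^\beta f(x,\xi)|<\infty$ for all $\alpha,\beta\in\mathbb N^d$. For $a,b\in S^m$ let $\mathfrak{Op}^A(a)$ and $b^A(x,D)$ be the continuous linear maps $\mathcal S(\mathbb R^d)\to\mathcal S(\mathbb R^d)$ given by the oscillating integrals $$[\mathfrak{Op}^A(a)u](x)=(2\pi)^{-d}\int\!\!\int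 e^{i\langle x-y,\eta\rangle}\,\omega^A(x,y)\,a\big(\tfrac{x+y}2,\eta\big)\,u(y)\,dy\,d\eta,$$ $$[b^A(x,D)u](x)=(2\pi)^{-d}\int\!\!\int e^{i\langle x-y,\eta\rangle}\,\omega^A(x,y)\,b(x,\eta)\,u(y)\,dy\,d\eta.$$ Here an oscillating integral $\int\!\!\int f(y,\eta)\,dy\,d\eta$ means $\lim_{\varepsilon\to0+}\int\!\!\int\chi(\varepsilon y,\varepsilon\eta)f(y,\eta)\,dy\,d\eta$, the limit existing and being the same for every $\chi\in\mathcal S(\mathbb R^d\times\mathbb R^d)$ with $\chi(0)=1$. 1. For every $a\in S^m$ there is $b\in S^m$ with $\mathfrak{Op}^A(a)=b^A(x,D)$ and $$b\sim\sum_{\alpha\in\mathbb N^d}\frac1{\alpha!}\Big(\frac12\Big)^{|\alpha|}D_x^\alpha\partial_\eta^\alpha a .$$ 2. Conversely, for every $b\in S^m$ there is $a\in S^m$ with $b^A(x,D)=\mathfrak{Op}^A(a)$ and $$a\sim\sum_{\alpha\in\mathbb N^d}\frac1{\alpha!}\Big(-\frac12\Big)^{|\alpha|}D_x^\alpha\partial_\eta^\alpha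 b .$$ Here $f\sim\sum_\alpha f_\alpha$, with $\sum_{|\alpha|=j}f_\alpha\in S^{m-j}$ for every $j\ge0$, means that $f-\sum_{|\alpha|<k}f_\alpha\in S^{m-k}$ for every $k\ge1$. -/

import Mathlib

open scoped SchwartzMap ContDiff

noncomputable section

namespace MagneticPsiDO

/-- The configuration space `ℝ^d` with its Euclidean scalar product. -/
abbrev Conf (d : ℕ) : Type := EuclideanSpace ℝ (Fin d)

/-- The phase space `ℝ^d × ℝ^d`, with points `(x, ξ)`. -/
abbrev Phase (d : ℕ) : Type := Conf d × Conf d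

/-- The Japanese bracket `<ξ> = √(1 + |ξ|²)`. -/
def bracket {d : ℕ} (ξ : Conf d) : ℝ := Real.sqrt (1 + ‖ξ‖ ^ 2)

/-! ### Partial derivatives and symbols -/

/-- The partial derivative `∂_{x_j} f` of a function on phase space. -/
def partialX {d : ℕ} (j : Fin d) (f : Phase d → ℂ) : Phase d → ℂ :=
  fun p => fderiv ℝ f p (EuclideanSpace.single j 1, 0)

/-- The partial derivative `∂_{ξ_j} f` of a function on phase space. -/
def partialXi {d : ℕ} (j : Fin d) (f : Phase d → ℂ) : Phase d → ℂ :=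
  fun p => fderiv ℝ f p (0, EuclideanSpace.single j 1)

/-- `D_{x_j} = -i ∂_{x_j}`. -/
def dX {d : ℕ} (j : Fin d) (f : Phase d → ℂ) : Phase d → ℂ :=
  fun p => -Complex.I * partialX j f p

/-- `P^α = P_1^{α_1} ⋯ P_d^{α_d}` for operators `P_1, …, P_d` and a multi-index `α ∈ ℕ^d`. -/
def multiPow {d : ℕ} {F : Type} (P : Fin d → F → F) (α : Fin d → ℕ) (f : F) : F :=
  (List.finRange d).foldr (fun j g => (P j)^[α j] g) f

/-- The length `|α|` of a multi-index. -/
def len {d : ℕ} (α : Fin d → ℕ) : ℕ := ∑ j, α j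

/-- `α! = α_1! ⋯ α_d!`. -/
def multiFactorial {d : ℕ} (α : Fin d → ℕ) : ℕ := ∏ j, (α j).factorial

/-- The symbol class `S^m(ℝ^d)`: smooth `f` on phase space such that every
`<ξ>^{|β| - m} |∂_x^α ∂_ξ^β f(x, ξ)|` is bounded. -/
def IsSymbol {d : ℕ} (m : ℝ) (f : Phase d → ℂ) : Prop :=
  ContDiff ℝ ∞ f ∧
    ∀ α β : Fin d → ℕ, ∃ C : ℝ, ∀ x ξ : Conf d,
      bracket ξ ^ ((len β : ℝ) - m) *
        ‖multiPow partialX α (multiPow partialXi β f) (x, ξ)‖ ≤ C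

/-- `f ∼ ∑_j f_j` with `f_j ∈ S^{μ_j}` and `μ_j ↘ -∞`. -/
def IsAsymptoticSum {d : ℕ} (μ : ℕ → ℝ) (fs : ℕ → Phase d → ℂ) (f : Phase d → ℂ) : Prop :=
  Antitone μ ∧ Filter.Tendsto μ Filter.atTop Filter.atBot ∧
    (∀ j, IsSymbol (μ j) (fs j)) ∧ IsSymbol (μ 0) f ∧
    ∀ k : ℕ, 1 ≤ k → IsSymbol (μ k) (fun p => f p - ∑ j ∈ Finset.range k, fs j p)

/-- The term of degree `j` of the series `∑_α (1/α!) c^{|α|} D_x^α ∂_ξ^α f`,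
that is, the sum over all multi-indices with `|α| = j`. -/
def seriesTerm {d : ℕ} (c : ℝ) (f : Phase d → ℂ) (j : ℕ) : Phase d → ℂ :=
  fun p => ∑ α ∈ Finset.piAntidiag (Finset.univ : Finset (Fin d)) j,
    (1 / (multiFactorial α : ℂ)) * (c : ℂ) ^ len α *
      multiPow dX α (multiPow partialXi α f) p

/-! ### Magnetic fields and vector potentials -/

/-- `BC^∞(ℝ^d)`: smooth functions that are bounded together with all their derivatives. -/
def IsBCInfty {d : ℕ} (f : Conf d → ℝ) : Prop :=
  ContDiff ℝ ∞ f ∧ ∀ n : ℕ, ∃ C : ℝ, ∀ x, ‖iteratedFDeriv ℝ n f x‖ ≤ C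

/-- The partial derivative `∂_j f` on configuration space. -/
def partialConf {d : ℕ} (j : Fin d) (f : Conf d → ℝ) : Conf d → ℝ :=
  fun x => fderiv ℝ f x (EuclideanSpace.single j 1)

/-- The matrix `(B_{jk})` of coefficients of a magnetic field: a closed two-form
`½ ∑ B_{jk} dx_j ∧ dx_k` with antisymmetric coefficients in `BC^∞`. -/
structure IsMagneticField {d : ℕ} (B : Fin d → Fin d → Conf d → ℝ) : Prop where
  bcInfty : ∀ j k, IsBCInfty (B j k)
  antisymm : ∀ j k x, B j k x = -B k j x
  closed : ∀ i j k x,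
    partialConf i (B j k) x + partialConf j (B k i) x + partialConf k (B i j) x = 0

/-- `A = ∑ A_j dx_j` is a vector potential for `B`: its coefficients are smooth with
polynomially bounded derivatives of all orders, and `dA = B`. -/
structure IsVectorPotential {d : ℕ} (A : Conf d → Conf d)
    (B : Fin d → Fin d → Conf d → ℝ) : Prop where
  temperate : Function.HasTemperateGrowth A
  dA_eq : ∀ j k x,
    partialConf j (fun y => A y k) x - partialConf k (fun y => A y j) x = B j k x

/-- `Γ^A(x, y) = ∫_0^1 A((1 - s)x + sy) ds`. -/
def gammaA {d : ℕ} (A : Conf d → Conf d) (x y : Conf d) : Conf d :=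
  ∫ s in (0 : ℝ)..1, A ((1 - s) • x + s • y)

/-- The circulation `∫_{[x,y]} A = -<x - y, Γ^A(x, y)>` of `A` along the segment from `x` to `y`. -/
def circulation {d : ℕ} (A : Conf d → Conf d) (x y : Conf d) : ℝ :=
  -inner ℝ (x - y) (gammaA A x y)

/-- `ω^A(x, y) = exp(-i ∫_{[x,y]} A)`. -/
def omegaA {d : ℕ} (A : Conf d → Conf d) (x y : Conf d) : ℂ :=
  Complex.exp (-Complex.I * (circulation A x y : ℂ))

/-! ### Oscillating integrals and the two quantizations -/

/-- `I` is the oscillating integral `∫∫ f(y, η) dy dη`: for every Schwartz cut-off `χ` with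
`χ(0) = 1` the functions `χ(εy, εη) f(y, η)` are integrable and their integrals tend to `I`
as `ε → 0+`. -/
def HasOscIntegral {d : ℕ} (f : Phase d → ℂ) (I : ℂ) : Prop :=
  ∀ χ : 𝓢(Phase d, ℂ), χ 0 = 1 →
    (∀ ε : ℝ, 0 < ε → MeasureTheory.Integrable (fun p => χ (ε • p) * f p)) ∧
    Filter.Tendsto (fun ε : ℝ => ∫ p, χ (ε • p) * f p)
      (nhdsWithin 0 (Set.Ioi 0)) (nhds I)

/-- `T` is the operator
`(Tu)(x) = ∫∫ e^{i<x-y,η>} ω^A(x,y) c(x,y,η) u(y) dy (2π)^{-d} dη` on the Schwartz space,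
with an oscillating integral. -/
def HasAmplitude {d : ℕ} (A : Conf d → Conf d) (c : Conf d → Conf d → Conf d → ℂ)
    (T : 𝓢(Conf d, ℂ) →L[ℂ] 𝓢(Conf d, ℂ)) : Prop :=
  ∀ (u : 𝓢(Conf d, ℂ)) (x : Conf d),
    HasOscIntegral (fun p : Phase d =>
      (((2 * Real.pi) ^ d)⁻¹ : ℝ) *
        (Complex.exp (Complex.I * (inner ℝ (x - p.1) p.2 : ℝ)) *
          omegaA A x p.1 * c x p.1 p.2 * u p.1)) (T u x)

/-- `T = Op^A(a)`, the magnetic Weyl quantization of `a`. -/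
def IsMagneticWeyl {d : ℕ} (A : Conf d → Conf d) (a : Phase d → ℂ)
    (T : 𝓢(Conf d, ℂ) →L[ℂ] 𝓢(Conf d, ℂ)) : Prop :=
  HasAmplitude A (fun x y η => a ((1 / 2 : ℝ) • (x + y), η)) T

/-- `T = b^A(x, D)`, the magnetic left quantization of `b`. -/
def IsMagneticLeft {d : ℕ} (A : Conf d → Conf d) (b : Phase d → ℂ)
    (T : 𝓢(Conf d, ℂ) →L[ℂ] 𝓢(Conf d, ℂ)) : Prop :=
  HasAmplitude A (fun x _ η => b (x, η)) T

end MagneticPsiDO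

end

/-!
In the variable `w = (y - x, η)` the `τ`-quantization of `a` is the oscillating integral with phase
`exp (-i ⟨w₁, w₂⟩)` and amplitude `a (x + τ w₁, w₂) ω^A(x, x + w₁) u(x + w₁)`. Since the magnetic
factor depends on neither `η` nor `τ`, it is absorbed in the Schwartz function `u`, and passing from
`τ` to `τ'` is the same problem as without a magnetic field.

The new symbol is the *shear* `exp (-i c ∑_j ∂_{x_j} ∂_{ξ_j}) a` with `c = τ - τ'`, given by the
oscillating integral `(2π)^{-d} ∬ exp (-i ⟨w₁, w₂⟩) a (x + c w₁, ξ + w₂) dw`. It solves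
`∂_c a_c = -i ∑_j ∂_{x_j} ∂_{ξ_j} a_c`. Integration by parts in `η` shows that the quantization of
`a_c` with parameter `τ - c` has derivative zero in `c`, and Taylor's formula in `c` gives the
asymptotic expansion, the remainder being again an oscillating integral controlled by finitely many
symbol estimates.
-/

noncomputable section

namespace MagneticPsiDO

open MeasureTheory Filter Topology
/-! ### Derivative bounds -/

section DerivBound

variable {E E' V W X : Type*} [NormedAddCommGroup E] [NormedSpace ℝ E]
  [NormedAddCommGroup E'] [NormedSpace ℝ E'] [NormedAddCommGroup V] [NormedSpace ℝ V]
  [NormedAddCommGroup W] [NormedSpace ℝ W] [NormedAddCommGroup X] [NormedSpace ℝ X]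
  {N p q : ℕ} {C C' : ℝ} {ρ ρ' : E → ℝ}

/-- `F` is smooth and its derivatives of order at most `N` are bounded by the weight `ρ`. Keeping
track of `N` and `ρ` makes bounds that are uniform in a parameter expressible. -/
def DerivBound (N : ℕ) (ρ : E → ℝ) (F : E → V) : Prop :=
  ContDiff ℝ ∞ F ∧ ∀ n ≤ N, ∀ w, ‖iteratedFDeriv ℝ n F w‖ ≤ ρ w

namespace DerivBound

variable {F : E → V}

lemma norm_le (h : DerivBound N ρ F) (w : E) : ‖F w‖ ≤ ρ w := by
  simpa only [norm_iteratedFDeriv_zero] using h.2 0 N.zero_le w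

lemma nonneg (h : DerivBound N ρ F) (w : E) : 0 ≤ ρ w :=
  (norm_nonneg _).trans (h.norm_le w)

lemma mono (h : DerivBound N ρ F) (hρ : ∀ w, ρ w ≤ ρ' w) : DerivBound N ρ' F :=
  ⟨h.1, fun n hn w => (h.2 n hn w).trans (hρ w)⟩

lemma mono_order {N' : ℕ} (h : DerivBound N ρ F) (hN : N' ≤ N) : DerivBound N' ρ F :=
  ⟨h.1, fun n hn => h.2 n (hn.trans hN)⟩

lemma add {G : E → V} (h : DerivBound N ρ F) (h' : DerivBound N ρ' G) :
    DerivBound N (fun w => ρ w + ρ' w) (fun w => F w + G w) := by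
  refine ⟨h.1.add h'.1, fun n hn w => ?_⟩
  rw [fun_iteratedFDeriv_add_apply (h.1.of_le (mod_cast le_top)).contDiffAt
    (h'.1.of_le (mod_cast le_top)).contDiffAt]
  exact (norm_add_le _ _).trans (add_le_add (h.2 n hn w) (h'.2 n hn w))

lemma sum {ι : Type*} (s : Finset ι) {ρ : ι → E → ℝ} {F : ι → E → V}
    (h : ∀ i ∈ s, DerivBound N (ρ i) (F i)) :
    DerivBound N (fun w => ∑ i ∈ s, ρ i w) (fun w => ∑ i ∈ s, F i w) := by
  refine ⟨ContDiff.sum fun i hi => (h i hi).1, fun n hn w => ?_⟩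
  rw [iteratedFDeriv_fun_sum_apply fun i hi => ((h i hi).1.of_le (mod_cast le_top)).contDiffAt]
  exact norm_sum_le_of_le s fun i hi => (h i hi).2 n hn w

lemma bilin {G : E → W} (B : V →L[ℝ] W →L[ℝ] X) (h : DerivBound N ρ F)
    (h' : DerivBound N ρ' G) :
    DerivBound N (fun w => ‖B‖ * (2 ^ N * (ρ w * ρ' w))) (fun w => B (F w) (G w)) := by
  refine ⟨B.isBoundedBilinearMap.contDiff.comp (h.1.prodMk h'.1), fun n hn w => ?_⟩
  have hρ : 0 ≤ ρ w * ρ' w := mul_nonneg (h.nonneg w) (h'.nonneg w)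
  refine (B.norm_iteratedFDeriv_le_of_bilinear h.1 h'.1 w (mod_cast le_top)).trans ?_
  refine mul_le_mul_of_nonneg_left ?_ (norm_nonneg B)
  calc ∑ i ∈ Finset.range (n + 1),
        n.choose i * ‖iteratedFDeriv ℝ i F w‖ * ‖iteratedFDeriv ℝ (n - i) G w‖
      ≤ ∑ i ∈ Finset.range (n + 1), (n.choose i : ℝ) * (ρ w * ρ' w) := by
        refine Finset.sum_le_sum fun i hi => ?_
        rw [mul_assoc]
        gcongr
        · exact h.nonneg w
        · exact h.2 i (by grind) w
        · exact h'.2 _ (by omega) w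
    _ = 2 ^ n * (ρ w * ρ' w) := by
        rw [← Finset.sum_mul, ← Nat.cast_sum, Nat.sum_range_choose, Nat.cast_pow, Nat.cast_ofNat]
    _ ≤ 2 ^ N * (ρ w * ρ' w) := by gcongr; norm_num

lemma clm (L : V →L[ℝ] W) (h : DerivBound N ρ F) :
    DerivBound N (fun w => ‖L‖ * ρ w) (fun w => L (F w)) := by
  refine ⟨L.contDiff.comp h.1, fun n hn w => ?_⟩
  refine (L.norm_iteratedFDeriv_comp_left h.1.contDiffAt (mod_cast le_top)).trans ?_
  exact mul_le_mul_of_nonneg_left (h.2 n hn w) (norm_nonneg L)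

lemma comp_affine (h : DerivBound N ρ F) (p : E) (L : E' →L[ℝ] E) {K : ℝ} (hK : 1 ≤ K)
    (hL : ‖L‖ ≤ K) : DerivBound N (fun w => K ^ N * ρ (p + L w)) (fun w => F (p + L w)) := by
  have hs : ContDiff ℝ ∞ fun y => F (p + y) := h.1.comp (contDiff_const.add contDiff_id)
  refine ⟨hs.comp L.contDiff, fun n hn w => ?_⟩
  change ‖iteratedFDeriv ℝ n ((fun y => F (p + y)) ∘ L) w‖ ≤ K ^ N * ρ (p + L w)
  rw [L.iteratedFDeriv_comp_right hs w (mod_cast le_top), iteratedFDeriv_comp_add_left, mul_comm]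
  calc _ ≤ ‖iteratedFDeriv ℝ n F (p + L w)‖ * ∏ _i : Fin n, ‖L‖ :=
        ContinuousMultilinearMap.norm_compContinuousLinearMap_le _ _
    _ ≤ ρ (p + L w) * K ^ N := by
        rw [Finset.prod_const, Finset.card_univ, Fintype.card_fin]
        refine mul_le_mul (h.2 n hn _) ?_ (by positivity) (h.nonneg _)
        exact (pow_le_pow_left₀ (norm_nonneg L) hL n).trans (pow_le_pow_right₀ hK hn)

lemma fderiv (h : DerivBound (N + 1) ρ F) : DerivBound N ρ (fderiv ℝ F) := by
  refine ⟨h.1.fderiv_right (by simp), fun n hn w => ?_⟩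
  rw [norm_iteratedFDeriv_fderiv]
  exact h.2 _ (by omega) w

end DerivBound

lemma derivBound_const (N : ℕ) (c : V) : DerivBound N (fun _ : E => ‖c‖) (fun _ => c) := by
  refine ⟨contDiff_const, fun n _ w => ?_⟩
  rcases n with _ | n
  · rw [norm_iteratedFDeriv_zero]
  · simp [iteratedFDeriv_const_of_ne]

lemma derivBound_clm (N : ℕ) (L : E →L[ℝ] V) :
    DerivBound N (fun w => ‖L‖ * (1 + ‖w‖)) L := by
  refine ⟨L.contDiff, fun n _ w => ?_⟩
  rcases n with _ | n
  · rw [norm_iteratedFDeriv_zero]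
    exact L.le_opNorm_of_le (by linarith)
  · rw [← norm_iteratedFDeriv_fderiv, show fderiv ℝ L = fun _ => L from funext fun _ => L.fderiv]
    exact ((derivBound_const n L).2 n le_rfl w).trans
      (le_mul_of_one_le_right (norm_nonneg _) (by linarith [norm_nonneg w]))

lemma derivBound_schwartz (k N : ℕ) (u : 𝓢(E, V)) :
    DerivBound N (fun y => (2 ^ k * (Finset.Iic (k, N)).sup
      (fun m => SchwartzMap.seminorm ℝ m.1 m.2) u) * ((1 + ‖y‖) ^ k)⁻¹) u := by
  refine ⟨u.smooth ⊤, fun n hn y => ?_⟩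
  beta_reduce
  rw [← div_eq_mul_inv, le_div_iff₀ (by positivity), mul_comm]
  exact SchwartzMap.one_add_le_sup_seminorm_apply (𝕜 := ℝ) (m := (k, N)) le_rfl hn u y

/-! ### Amplitudes of polynomial growth -/

/-- The weight `C (1 + ‖w‖) ^ p`. -/
def growth (p : ℕ) (C : ℝ) (w : E) : ℝ := C * (1 + ‖w‖) ^ p

lemma DerivBound.const_nonneg {F : E → V} (h : DerivBound N (growth p C) F) : 0 ≤ C := by
  simpa [growth] using h.nonneg 0

namespace DerivBound

variable {F : E → V}

lemma growth_mono (h : DerivBound N (growth p C) F) (hpq : p ≤ q) :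
    DerivBound N (growth q C) F := h.mono fun w => by
  unfold growth
  gcongr
  · exact h.const_nonneg
  · linarith [norm_nonneg w]

lemma growth_add {G : E → V} (h : DerivBound N (growth p C) F)
    (h' : DerivBound N (growth p C') G) :
    DerivBound N (growth p (C + C')) (fun w => F w + G w) :=
  (h.add h').mono fun _ => (add_mul C C' _).ge

lemma growth_sum {ι : Type*} (s : Finset ι) {C : ι → ℝ} {F : ι → E → V}
    (h : ∀ i ∈ s, DerivBound N (growth p (C i)) (F i)) :
    DerivBound N (growth p (∑ i ∈ s, C i)) (fun w => ∑ i ∈ s, F i w) :=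
  (sum s h).mono fun _ => (Finset.sum_mul s C _).ge

lemma growth_clm (L : V →L[ℝ] W) (h : DerivBound N (growth p C) F) :
    DerivBound N (growth p (‖L‖ * C)) (fun w => L (F w)) :=
  (h.clm L).mono fun _ => (mul_assoc ‖L‖ C _).ge

lemma growth_bilin {G : E → W} (B : V →L[ℝ] W →L[ℝ] X)
    (h : DerivBound N (growth p C) F) (h' : DerivBound N (growth q C') G) :
    DerivBound N (growth (p + q) (‖B‖ * (2 ^ N * (C * C')))) (fun w => B (F w) (G w)) :=
  (h.bilin B h').mono fun w => le_of_eq (by simp only [growth]; ring)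

end DerivBound

/-- The amplitudes of order `p`: smooth functions all of whose derivatives are `O((1 + ‖w‖) ^ p)`.
In contrast to `Function.HasTemperateGrowth`, the exponent does not depend on the derivative. -/
def IsAmplitude (p : ℕ) (F : E → V) : Prop := ∀ N, ∃ C, DerivBound N (growth p C) F

namespace IsAmplitude

variable {F : E → V}

lemma contDiff (h : IsAmplitude p F) : ContDiff ℝ ∞ F :=
  let ⟨_, hC⟩ := h 0; hC.1

lemma hasTemperateGrowth (h : IsAmplitude p F) : F.HasTemperateGrowth :=
  ⟨h.contDiff, fun n => let ⟨C, hC⟩ := h n; ⟨p, C, hC.2 n le_rfl⟩⟩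

lemma mono (h : IsAmplitude p F) (hpq : p ≤ q) : IsAmplitude q F :=
  fun N => let ⟨C, hC⟩ := h N; ⟨C, hC.growth_mono hpq⟩

lemma add {G : E → V} (h : IsAmplitude p F) (h' : IsAmplitude p G) :
    IsAmplitude p (fun w => F w + G w) :=
  fun N => let ⟨_, hC⟩ := h N; let ⟨_, hC'⟩ := h' N; ⟨_, hC.growth_add hC'⟩

lemma sum {ι : Type*} (s : Finset ι) {F : ι → E → V} (h : ∀ i ∈ s, IsAmplitude p (F i)) :
    IsAmplitude p (fun w => ∑ i ∈ s, F i w) := fun N => by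
  choose! C hC using fun i hi => h i hi N
  exact ⟨_, DerivBound.growth_sum s hC⟩

lemma clm (h : IsAmplitude p F) (L : V →L[ℝ] W) : IsAmplitude p (fun w => L (F w)) :=
  fun N => let ⟨_, hC⟩ := h N; ⟨_, hC.growth_clm L⟩

lemma const_smul {V : Type*} [NormedAddCommGroup V] [NormedSpace ℂ V] {F : E → V}
    (h : IsAmplitude p F) (c : ℂ) : IsAmplitude p (fun w => c • F w) :=
  h.clm (c • ContinuousLinearMap.id ℝ V)

lemma bilin {G : E → W} (B : V →L[ℝ] W →L[ℝ] X) (h : IsAmplitude p F) (h' : IsAmplitude q G) :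
    IsAmplitude (p + q) (fun w => B (F w) (G w)) :=
  fun N => let ⟨_, hC⟩ := h N; let ⟨_, hC'⟩ := h' N; ⟨_, hC.growth_bilin B hC'⟩

lemma smul {V : Type*} [NormedAddCommGroup V] [NormedSpace ℂ V] {f : E → ℂ} {F : E → V}
    (h : IsAmplitude p f) (h' : IsAmplitude q F) : IsAmplitude (p + q) (fun w => f w • F w) :=
  h.bilin (ContinuousLinearMap.lsmul ℝ ℂ) h'

lemma fderiv (h : IsAmplitude p F) : IsAmplitude p (fderiv ℝ F) :=
  fun N => let ⟨C, hC⟩ := h (N + 1); ⟨C, hC.fderiv⟩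

lemma fderiv_apply (h : IsAmplitude p F) (v : E) :
    IsAmplitude p (fun w => _root_.fderiv ℝ F w v) :=
  h.fderiv.clm (ContinuousLinearMap.apply ℝ V v)

end IsAmplitude

lemma isAmplitude_const (c : V) : IsAmplitude 0 (fun _ : E => c) := fun N =>
  ⟨‖c‖, (derivBound_const N c).mono fun w => by simp [growth]⟩

lemma isAmplitude_clm (L : E →L[ℝ] V) : IsAmplitude 1 L := fun N =>
  ⟨‖L‖, (derivBound_clm N L).mono fun w => by simp [growth]⟩

end DerivBound

lemma one_add_norm_add_le {E : Type*} [SeminormedAddCommGroup E] (x y : E) :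
    1 + ‖x + y‖ ≤ (1 + ‖x‖) * (1 + ‖y‖) := by
  nlinarith [norm_add_le x y, mul_nonneg (norm_nonneg x) (norm_nonneg y)]
/-! ### Oscillatory integrals with phase `-⟨z, ζ⟩` -/

section Osc

variable {d p N : ℕ} {C : ℝ} {V W : Type*} [NormedAddCommGroup V] [NormedSpace ℂ V]
  [NormedAddCommGroup W] [NormedSpace ℂ W] {F G : Phase d → V}

/-- The oscillating factor `exp (-i ⟨z, ζ⟩)` at the point `(z, ζ)` of phase space. -/
def phase (w : Phase d) : ℂ := Complex.exp (-(Complex.I * (inner ℝ w.1 w.2 : ℝ)))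

lemma norm_phase (w : Phase d) : ‖phase w‖ = 1 := by
  simp [phase, Complex.norm_exp]

lemma phase_contDiff : ContDiff ℝ ∞ (phase : Phase d → ℂ) :=
  Complex.contDiff_exp.comp
    (contDiff_const.mul (Complex.ofRealCLM.contDiff.comp (contDiff_fst.inner ℝ contDiff_snd))).neg

/-- A bump function on phase space that is equal to one near the origin. -/
def bump (d : ℕ) : ContDiffBump (0 : Phase d) := ⟨1, 2, one_pos, one_lt_two⟩

/-- A nonnegative, smooth, compactly supported function on phase space of integral one. -/
def window (w : Phase d) : ℝ := (bump d).normed volume w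

lemma window_nonneg (w : Phase d) : 0 ≤ window w := (bump d).nonneg_normed w

lemma window_contDiff : ContDiff ℝ ∞ (window : Phase d → ℝ) := (bump d).contDiff_normed

lemma window_hasCompactSupport : HasCompactSupport (window : Phase d → ℝ) :=
  (bump d).hasCompactSupport_normed

/-- The convolution of `phase • F` with the window. The phase being quadratic, its value at `w` is
up to a unimodular factor a Fourier transform at `w` of a cut-off of `F` around `w`, so that it
decays in `w` when `F` is smooth. -/
def oscConv (F : Phase d → V) (w : Phase d) : V :=
  ∫ v, window v • (phase (w - v) • F (w - v))

/-- The oscillatory integral `∫∫ exp (-i ⟨z, ζ⟩) F (z, ζ) dz dζ`. It is defined as the integral of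
`oscConv F`, which is absolutely convergent for all amplitudes `F`, and which is the usual integral
when `F` is integrable because `window` has integral one. -/
def osc (F : Phase d → V) : V := ∫ w, oscConv F w

/-! ### Decay of the convolution with the window -/

/-- The Schwartz function `window • phase`. -/
def windowPhase (d : ℕ) : 𝓢(Phase d, ℂ) :=
  HasCompactSupport.toSchwartzMap (f := fun w : Phase d => window w • phase w)
    (window_hasCompactSupport.smul_right) (window_contDiff.smul phase_contDiff)

lemma windowPhase_apply (w : Phase d) : windowPhase d w = window w • phase w := rfl

/-- The bilinear form `-(2π)⁻¹ (⟨v₁, w₂⟩ + ⟨v₂, w₁⟩)`, normalised so that the phase at `w - v` is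
`exp (-2πi phaseForm d v w)` up to factors depending on only one of `v` and `w`. -/
def phaseForm (d : ℕ) : Phase d →L[ℝ] Phase d →L[ℝ] ℝ :=
  (-(2 * Real.pi)⁻¹ : ℝ) •
    ((innerSL ℝ).bilinearComp (ContinuousLinearMap.fst ℝ (Conf d) (Conf d))
        (ContinuousLinearMap.snd ℝ (Conf d) (Conf d)) +
      (innerSL ℝ).bilinearComp (ContinuousLinearMap.snd ℝ (Conf d) (Conf d))
        (ContinuousLinearMap.fst ℝ (Conf d) (Conf d)))

lemma phaseForm_apply (v w : Phase d) :
    phaseForm d v w = -(2 * Real.pi)⁻¹ * (inner ℝ v.1 w.2 + inner ℝ v.2 w.1) := by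
  simp only [phaseForm, smul_apply, add_apply,
    ContinuousLinearMap.bilinearComp_apply, innerSL_apply_apply, ContinuousLinearMap.coe_fst',
    ContinuousLinearMap.coe_snd', smul_eq_mul]

lemma phase_sub (w v : Phase d) :
    phase (w - v) = phase w * ((Real.fourierChar (-(phaseForm d v w)) : ℂ) * phase v) := by
  have hpi : (Real.pi : ℂ) ≠ 0 := mod_cast Real.pi_ne_zero
  rw [phase, phase, phase, Real.fourierChar_apply, phaseForm_apply, ← Complex.exp_add,
    ← Complex.exp_add]
  congr 1
  simp only [Prod.fst_sub, Prod.snd_sub, inner_sub_left, inner_sub_right]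
  rw [real_inner_comm w.1 v.2]
  push_cast
  field_simp
  ring

/-- The Fourier transform of a function on phase space with respect to `phaseForm`. -/
abbrev phaseFourier (F : Phase d → V) : Phase d → V :=
  VectorFourier.fourierIntegral Real.fourierChar volume (phaseForm d).toLinearMap₁₂ F

lemma oscConv_eq_phaseFourier (F : Phase d → V) (w : Phase d) :
    oscConv F w = phase w • phaseFourier (fun v => windowPhase d v • F (w - v)) w := by
  rw [phaseFourier, VectorFourier.fourierIntegral, ← integral_smul, oscConv]
  congr 1 with v
  rw [phase_sub, windowPhase_apply, Circle.smul_def, ← Complex.coe_smul (window v),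
    ← Complex.coe_smul (window v)]
  simp only [smul_smul, smul_eq_mul]
  congr 1
  change _ = phase w * ((Real.fourierChar (-(phaseForm d v w)) : ℂ) * (window v * phase v))
  ring

instance : (volume : Measure (Phase d)).IsAddHaarMeasure :=
  inferInstanceAs ((volume : Measure (Conf d)).prod (volume : Measure (Conf d))).IsAddHaarMeasure

/-- The weight `(1 + ‖w‖) ^ (-(2d + 1))`, integrable because phase space has dimension `2d`. -/
def decayWeight (w : Phase d) : ℝ := ((1 + ‖w‖) ^ (2 * d + 1))⁻¹

lemma integrable_decayWeight : Integrable (decayWeight : Phase d → ℝ) := by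
  have h := integrable_one_add_norm (E := Phase d) (μ := volume) (r := (2 * d + 1 : ℕ))
    (by simp [← two_mul])
  refine h.congr (Eventually.of_forall fun v => ?_)
  simp only [decayWeight, Real.rpow_neg (by positivity : 0 ≤ 1 + ‖v‖), Real.rpow_natCast]

/-- The constant in the bound for the derivatives of `windowPhase` by `(1 + ‖v‖) ^ (-k)`. -/
def windowConst (d k N : ℕ) : ℝ :=
  2 ^ k * (Finset.Iic (k, N)).sup (fun m => SchwartzMap.seminorm ℝ m.1 m.2) (windowPhase d)

lemma windowConst_nonneg (d k N : ℕ) : 0 ≤ windowConst d k N :=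
  mul_nonneg (by positivity) (apply_nonneg _ _)

lemma DerivBound.windowPhase_smul_shift (hF : DerivBound N (growth p C) F) (w : Phase d) :
    DerivBound N
      (fun v => 2 ^ N * windowConst d (p + (2 * d + 1)) N * growth p C w * decayWeight v)
      (fun v => windowPhase d v • F (w - v)) := by
  have hwin : DerivBound N (fun v => windowConst d (p + (2 * d + 1)) N *
      ((1 + ‖v‖) ^ (p + (2 * d + 1)))⁻¹) (windowPhase d) := derivBound_schwartz _ N _
  have hshift := hF.comp_affine w (-(ContinuousLinearMap.id ℝ (Phase d))) le_rfl
    (by rw [norm_neg]; exact ContinuousLinearMap.norm_id_le)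
  have hprod := hwin.bilin (ContinuousLinearMap.lsmul ℝ ℂ) hshift
  simp only [ContinuousLinearMap.lsmul_apply, neg_apply,
    ContinuousLinearMap.id_apply, ← sub_eq_add_neg, one_pow, one_mul] at hprod
  refine hprod.mono fun v => ?_
  have hpeetre : (1 + ‖w - v‖) ^ p ≤ (1 + ‖w‖) ^ p * (1 + ‖v‖) ^ p := by
    rw [← mul_pow, sub_eq_add_neg, ← norm_neg v]
    gcongr
    exact one_add_norm_add_le w (-v)
  have hS := windowConst_nonneg d (p + (2 * d + 1)) N
  have hC := hF.const_nonneg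
  simp only [growth, decayWeight]
  calc _ ≤ 1 * (2 ^ N * (windowConst d (p + (2 * d + 1)) N *
        ((1 + ‖v‖) ^ (p + (2 * d + 1)))⁻¹ * (C * ((1 + ‖w‖) ^ p * (1 + ‖v‖) ^ p)))) := by
        gcongr
        exact ContinuousLinearMap.opNorm_lsmul_le
    _ = _ := by
        rw [pow_add (1 + ‖v‖)]
        field_simp

lemma norm_sq_le_phaseForm (w : Phase d) :
    ‖w‖ ^ 2 * (2 * Real.pi)⁻¹ ≤ |phaseForm d (w.2, w.1) w| := by
  rw [phaseForm_apply, real_inner_self_eq_norm_sq, real_inner_self_eq_norm_sq, abs_mul, abs_neg,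
    abs_of_nonneg (by positivity), abs_of_nonneg (by positivity), mul_comm, Prod.norm_def]
  gcongr
  rcases max_cases ‖w.1‖ ‖w.2‖ with h | h <;> rw [h.1] <;>
    linarith [sq_nonneg ‖w.1‖, sq_nonneg ‖w.2‖]

lemma one_add_pow_le {x : ℝ} (hx : 0 ≤ x) (n : ℕ) : (1 + x) ^ n ≤ 2 ^ n * (1 + x ^ n) := by
  rcases le_total x 1 with h | h
  · calc (1 + x) ^ n ≤ 2 ^ n := by gcongr; linarith
      _ ≤ _ := le_mul_of_one_le_right (by positivity) (by linarith [pow_nonneg hx n])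
  · calc (1 + x) ^ n ≤ (2 * x) ^ n := by gcongr; linarith
      _ = 2 ^ n * x ^ n := mul_pow _ _ _
      _ ≤ _ := by gcongr; linarith

namespace DerivBound

variable {M : ℝ} {Φ : Phase d → V}

lemma integrable_iteratedFDeriv (hb : DerivBound N (fun v => M * decayWeight v) Φ)
    {n : ℕ} (hn : n ≤ N) : Integrable (fun v => ‖iteratedFDeriv ℝ n Φ v‖) := by
  refine (integrable_decayWeight.const_mul M).mono'
    (hb.1.continuous_iteratedFDeriv (m := n) (mod_cast le_top)).norm.aestronglyMeasurable
    (Eventually.of_forall fun v => ?_)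
  rw [norm_norm]
  exact hb.2 n hn v

lemma integral_iteratedFDeriv_le (hb : DerivBound N (fun v => M * decayWeight v) Φ)
    {n : ℕ} (hn : n ≤ N) :
    ∫ v, ‖iteratedFDeriv ℝ n Φ v‖ ≤ M * ∫ v : Phase d, decayWeight v := by
  rw [← integral_const_mul]
  exact integral_mono (hb.integrable_iteratedFDeriv hn) (integrable_decayWeight.const_mul M)
    fun v => hb.2 n hn v

lemma norm_phaseFourier_le (hb : DerivBound N (fun v => M * decayWeight v) Φ) (w : Phase d) :
    ‖phaseFourier Φ w‖ ≤ M * ∫ v : Phase d, decayWeight v := by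
  refine (VectorFourier.norm_fourierIntegral_le_integral_norm _ _ _ _ _).trans ?_
  simpa only [norm_iteratedFDeriv_zero] using hb.integral_iteratedFDeriv_le N.zero_le

lemma phaseForm_pow_mul_norm_phaseFourier_le
    (hb : DerivBound N (fun v => M * decayWeight v) Φ) (w : Phase d) :
    |phaseForm d (w.2, w.1) w| ^ N * ‖phaseFourier Φ w‖ ≤
      ‖w‖ ^ N * (2 ^ N * ((N + 1) * (M * ∫ v : Phase d, decayWeight v))) := by
  have key := VectorFourier.pow_mul_norm_iteratedFDeriv_fourierIntegral_le (phaseForm d)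
    (μ := volume) (f := Φ) (K := 0) (N := N) (k := 0) (n := N)
    (hb.1.of_le (mod_cast le_top)) (fun k n hk hn => by
      obtain rfl : k = 0 := by simpa using hk
      simpa only [pow_zero, one_mul] using hb.integrable_iteratedFDeriv (by exact_mod_cast hn))
    le_rfl le_rfl (w.2, w.1) w
  have hswap : ‖((w.2, w.1) : Phase d)‖ = ‖w‖ := by simp only [Prod.norm_def, max_comm]
  rw [norm_iteratedFDeriv_zero, hswap, pow_zero, mul_one, Nat.cast_zero, mul_zero, zero_add,
    mul_assoc] at key
  refine key.trans ?_
  gcongr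
  calc _ ≤ ∑ _q ∈ Finset.range (0 + 1) ×ˢ Finset.range (N + 1),
        M * ∫ v : Phase d, decayWeight v := by
        refine Finset.sum_le_sum fun _ hq => ?_
        simp only [Finset.mem_product, Finset.mem_range, Nat.lt_one_iff, zero_add] at hq
        simp only [hq.1, pow_zero, one_mul]
        exact hb.integral_iteratedFDeriv_le (by omega)
    _ = _ := by simp

lemma norm_pow_mul_norm_phaseFourier_le
    (hb : DerivBound N (fun v => M * decayWeight v) Φ) (w : Phase d) :
    ‖w‖ ^ N * ‖phaseFourier Φ w‖ ≤
      (2 * Real.pi) ^ N * (2 ^ N * ((N + 1) * (M * ∫ v : Phase d, decayWeight v))) := by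
  have key := hb.phaseForm_pow_mul_norm_phaseFourier_le w
  have hzero := hb.norm_phaseFourier_le w
  have ht := norm_nonneg (phaseFourier Φ w)
  generalize phaseFourier Φ w = t at key hzero ht ⊢
  generalize M * ∫ v : Phase d, decayWeight v = S at key hzero ⊢
  rcases eq_or_ne w 0 with rfl | hw
  · calc ‖(0 : Phase d)‖ ^ N * ‖t‖ ≤ 1 * (1 * (1 * S)) := by
          simp only [one_mul]
          exact (mul_le_of_le_one_left ht (pow_le_one₀ (norm_nonneg _) (by simp))).trans hzero
      _ ≤ (2 * Real.pi) ^ N * (2 ^ N * ((N + 1) * S)) := by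
          have hS : 0 ≤ S := ht.trans hzero
          gcongr ?_ * (?_ * (?_ * S))
          · exact one_le_pow₀ (by linarith [Real.two_le_pi])
          · exact one_le_pow₀ (by norm_num)
          · linarith [N.cast_nonneg (α := ℝ)]
  · have hw' : 0 < ‖w‖ := norm_pos_iff.2 hw
    refine le_of_mul_le_mul_left ?_ (pow_pos hw' N)
    calc ‖w‖ ^ N * (‖w‖ ^ N * ‖t‖)
        = (2 * Real.pi) ^ N * ((‖w‖ ^ 2 * (2 * Real.pi)⁻¹) ^ N * ‖t‖) := by
          rw [mul_pow (‖w‖ ^ 2), inv_pow, ← pow_mul, mul_comm 2 N, pow_mul]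
          field_simp
      _ ≤ (2 * Real.pi) ^ N * (|phaseForm d (w.2, w.1) w| ^ N * ‖t‖) := by
          gcongr
          exact norm_sq_le_phaseForm w
      _ ≤ (2 * Real.pi) ^ N * (‖w‖ ^ N * (2 ^ N * ((N + 1) * S))) := by gcongr
      _ = _ := by ring

lemma one_add_norm_pow_mul_norm_phaseFourier_le
    (hb : DerivBound N (fun v => M * decayWeight v) Φ) (w : Phase d) :
    (1 + ‖w‖) ^ N * ‖phaseFourier Φ w‖ ≤
      2 ^ N * (1 + (2 * Real.pi) ^ N * (2 ^ N * (N + 1))) *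
        (M * ∫ v : Phase d, decayWeight v) :=
  calc (1 + ‖w‖) ^ N * ‖phaseFourier Φ w‖
      ≤ 2 ^ N * (1 + ‖w‖ ^ N) * ‖phaseFourier Φ w‖ := by
        gcongr
        exact one_add_pow_le (norm_nonneg _) _
    _ = 2 ^ N * (‖phaseFourier Φ w‖ + ‖w‖ ^ N * ‖phaseFourier Φ w‖) := by ring
    _ ≤ 2 ^ N * (M * (∫ v : Phase d, decayWeight v) +
        (2 * Real.pi) ^ N * (2 ^ N * ((N + 1) * (M * ∫ v : Phase d, decayWeight v)))) := by
        gcongr 2 ^ N * (?_ + ?_)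
        · exact hb.norm_phaseFourier_le w
        · exact hb.norm_pow_mul_norm_phaseFourier_le w
    _ = _ := by ring

end DerivBound

/-- The number of derivatives that control the oscillatory integral of an amplitude of order
`p`. -/
def oscOrder (d p : ℕ) : ℕ := p + (2 * d + 1)

/-- The constant in the pointwise bound `norm_oscConv_le`. -/
def oscConvConst (d p : ℕ) : ℝ :=
  2 ^ oscOrder d p * (1 + (2 * Real.pi) ^ oscOrder d p * (2 ^ oscOrder d p * (oscOrder d p + 1))) *
    (2 ^ oscOrder d p * windowConst d (oscOrder d p) (oscOrder d p) *
      ∫ v : Phase d, decayWeight v)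

lemma norm_oscConv_le (hF : DerivBound (oscOrder d p) (growth p C) F) (w : Phase d) :
    ‖oscConv F w‖ ≤ oscConvConst d p * C * decayWeight w := by
  have h := (hF.windowPhase_smul_shift w).one_add_norm_pow_mul_norm_phaseFourier_le w
  rw [oscConv_eq_phaseFourier, norm_smul, norm_phase, one_mul, decayWeight, ← div_eq_mul_inv,
    le_div_iff₀ (by positivity)]
  refine le_of_mul_le_mul_left ?_ (pow_pos (by positivity : 0 < 1 + ‖w‖) p)
  calc (1 + ‖w‖) ^ p * (‖phaseFourier (fun v => windowPhase d v • F (w - v)) w‖ *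
        (1 + ‖w‖) ^ (2 * d + 1))
      = (1 + ‖w‖) ^ oscOrder d p * ‖phaseFourier (fun v => windowPhase d v • F (w - v)) w‖ := by
        rw [oscOrder, pow_add]
        ring
    _ ≤ _ := h
    _ = (1 + ‖w‖) ^ p * (oscConvConst d p * C) := by
        simp only [growth, oscConvConst, oscOrder]
        ring

/-! ### Linearity, limits and derivatives of oscillatory integrals -/

lemma integrable_oscConv_integrand (hF : Continuous F) (w : Phase d) :
    Integrable (fun v => window v • (phase (w - v) • F (w - v))) := by
  refine Continuous.integrable_of_hasCompactSupport ?_ window_hasCompactSupport.smul_right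
  have := window_contDiff (d := d).continuous
  have := phase_contDiff (d := d).continuous
  fun_prop

lemma norm_oscConv_integrand_le (hF : DerivBound N (growth p C) F) (w v : Phase d) :
    ‖window v • (phase (w - v) • F (w - v))‖ ≤ window v * growth p C (w - v) := by
  rw [norm_smul, norm_smul, norm_phase, one_mul, Real.norm_of_nonneg (window_nonneg v)]
  exact mul_le_mul_of_nonneg_left (hF.norm_le _) (window_nonneg v)

lemma integrable_window_mul_growth (p : ℕ) (C : ℝ) (w : Phase d) :
    Integrable (fun v => window v * growth p C (w - v)) := by
  refine Continuous.integrable_of_hasCompactSupport ?_ window_hasCompactSupport.mul_right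
  have := window_contDiff (d := d).continuous
  unfold growth
  fun_prop

lemma aestronglyMeasurable_oscConv (hF : Continuous F) :
    AEStronglyMeasurable (oscConv F) (volume : Measure (Phase d)) := by
  have hcont : Continuous (fun q : Phase d × Phase d =>
      window q.2 • (phase (q.1 - q.2) • F (q.1 - q.2))) := by
    have := window_contDiff (d := d).continuous
    have := phase_contDiff (d := d).continuous
    fun_prop
  exact (hcont.aestronglyMeasurable
    (μ := (volume : Measure (Phase d)).prod volume)).integral_prod_right'

lemma integrable_oscConv (hF : DerivBound (oscOrder d p) (growth p C) F) :
    Integrable (oscConv F) :=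
  (integrable_decayWeight.const_mul (oscConvConst d p * C)).mono'
    (aestronglyMeasurable_oscConv hF.1.continuous) (Eventually.of_forall (norm_oscConv_le hF))

lemma IsAmplitude.integrable_oscConv (h : IsAmplitude p F) : Integrable (oscConv F) :=
  let ⟨_, hC⟩ := h (oscOrder d p)
  MagneticPsiDO.integrable_oscConv hC

/-- The constant in the bound `norm_osc_le`. -/
def oscConst (d p : ℕ) : ℝ := oscConvConst d p * ∫ w : Phase d, decayWeight w

lemma norm_osc_le (hF : DerivBound (oscOrder d p) (growth p C) F) : ‖osc F‖ ≤ oscConst d p * C := by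
  refine (norm_integral_le_of_norm_le (integrable_decayWeight.const_mul (oscConvConst d p * C))
    (Eventually.of_forall (norm_oscConv_le hF))).trans_eq ?_
  rw [integral_const_mul, oscConst]
  ring

lemma osc_sum {ι : Type*} (s : Finset ι) {F : ι → Phase d → V}
    (h : ∀ i ∈ s, IsAmplitude p (F i)) : osc (fun w => ∑ i ∈ s, F i w) = ∑ i ∈ s, osc (F i) := by
  have hconv : oscConv (fun w => ∑ i ∈ s, F i w) = fun w => ∑ i ∈ s, oscConv (F i) w := by
    ext w
    simp only [oscConv, Finset.smul_sum]
    exact integral_finsetSum s fun i hi =>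
      integrable_oscConv_integrand (h i hi).contDiff.continuous w
  rw [osc, hconv]
  exact integral_finsetSum s fun i hi => (h i hi).integrable_oscConv

lemma osc_add (h : IsAmplitude p F) (h' : IsAmplitude p G) :
    osc (fun w => F w + G w) = osc F + osc G := by
  have hsum := osc_sum Finset.univ (F := ![F, G]) (p := p) (by simp [Fin.forall_fin_two, h, h'])
  simpa only [Fin.sum_univ_two, Matrix.cons_val_zero, Matrix.cons_val_one] using hsum

lemma osc_clm [CompleteSpace V] [CompleteSpace W] (L : V →L[ℂ] W) (h : IsAmplitude p F) :
    osc (fun w => L (F w)) = L (osc F) := by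
  have hconv : oscConv (fun w => L (F w)) = fun w => L (oscConv F w) := by
    ext w
    rw [oscConv, oscConv,
      ← L.integral_comp_comm (integrable_oscConv_integrand h.contDiff.continuous w)]
    congr 1 with v
    rw [← Complex.coe_smul, ← Complex.coe_smul, map_smul, map_smul]
  rw [osc, hconv, osc, L.integral_comp_comm h.integrable_oscConv]

lemma osc_smul [CompleteSpace V] (c : ℂ) (h : IsAmplitude p F) :
    osc (fun w => c • F w) = c • osc F :=
  osc_clm (c • ContinuousLinearMap.id ℂ V) h

lemma osc_eq_integral [CompleteSpace V] (hF : Integrable F) : osc F = ∫ w, phase w • F w := by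
  have hint : Integrable (fun w => phase w • F w) :=
    hF.bdd_smul 1 phase_contDiff.continuous.aestronglyMeasurable
      (Eventually.of_forall fun w => (norm_phase w).le)
  have hconv := integral_convolution (ContinuousLinearMap.lsmul ℝ ℝ)
    ((bump d).integrable_normed (μ := volume)) hint
  rwa [(bump d).integral_normed, ContinuousLinearMap.lsmul_apply, one_smul] at hconv

lemma tendsto_osc {ι : Type*} {l : Filter ι} [l.IsCountablyGenerated] {F : ι → Phase d → V}
    (hF : ∀ᶠ i in l, DerivBound (oscOrder d p) (growth p C) (F i))
    (hlim : ∀ w, Tendsto (fun i => F i w) l (𝓝 (G w))) :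
    Tendsto (fun i => osc (F i)) l (𝓝 (osc G)) := by
  refine tendsto_integral_filter_of_dominated_convergence
    (fun w => oscConvConst d p * C * decayWeight w) ?_ ?_ (integrable_decayWeight.const_mul _) ?_
  · filter_upwards [hF] with i hi using aestronglyMeasurable_oscConv hi.1.continuous
  · filter_upwards [hF] with i hi using Eventually.of_forall (norm_oscConv_le hi)
  · refine Eventually.of_forall fun w => tendsto_integral_filter_of_dominated_convergence
      (fun v => window v * growth p C (w - v)) ?_ ?_ (integrable_window_mul_growth p C w) ?_
    · filter_upwards [hF] with i hi
      exact (integrable_oscConv_integrand hi.1.continuous w).1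
    · filter_upwards [hF] with i hi
        using Eventually.of_forall (norm_oscConv_integrand_le hi w)
    · exact Eventually.of_forall fun v => ((hlim _).const_smul _).const_smul _

section Derivative

variable {H : Type*} [NormedAddCommGroup H] [NormedSpace ℝ H] {p' : ℕ} {C' : ℝ}
  {F : H → Phase d → V} {F' : H → Phase d → H →L[ℝ] V} {s : Set H} {θ : H}

lemma hasFDerivAt_oscConv (hs : IsOpen s) (hθ : θ ∈ s) (hF : ∀ t ∈ s, Continuous (F t))
    (hF' : ∀ t ∈ s, DerivBound N (growth p' C') (F' t))
    (hd : ∀ t ∈ s, ∀ w, HasFDerivAt (fun t => F t w) (F' t w) t) (w : Phase d) :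
    HasFDerivAt (fun t => oscConv (F t) w) (oscConv (F' θ) w) θ := by
  refine hasFDerivAt_integral_of_dominated_of_fderiv_le
    (F := fun t v => window v • (phase (w - v) • F t (w - v)))
    (F' := fun t v => window v • (phase (w - v) • F' t (w - v)))
    (hs.mem_nhds hθ) ?_ (integrable_oscConv_integrand (hF θ hθ) w)
    (integrable_oscConv_integrand (hF' θ hθ).1.continuous w).1 ?_
    (integrable_window_mul_growth p' C' w) ?_
  · filter_upwards [hs.mem_nhds hθ] with t ht
    exact (integrable_oscConv_integrand (hF t ht) w).1
  · exact Eventually.of_forall fun v t ht => norm_oscConv_integrand_le (hF' t ht) w v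
  · exact Eventually.of_forall fun v t ht => ((hd t ht _).const_smul _).const_smul _

lemma hasFDerivAt_osc (hs : IsOpen s) (hθ : θ ∈ s)
    (hF : ∀ t ∈ s, DerivBound (oscOrder d p) (growth p C) (F t))
    (hF' : ∀ t ∈ s, DerivBound (oscOrder d p') (growth p' C') (F' t))
    (hd : ∀ t ∈ s, ∀ w, HasFDerivAt (fun t => F t w) (F' t w) t) :
    HasFDerivAt (fun t => osc (F t)) (osc (F' θ)) θ := by
  refine hasFDerivAt_integral_of_dominated_of_fderiv_le
    (F := fun t => oscConv (F t)) (F' := fun t => oscConv (F' t))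
    (bound := fun w => oscConvConst d p' * C' * decayWeight w) (hs.mem_nhds hθ) ?_
    (integrable_oscConv (hF θ hθ)) (aestronglyMeasurable_oscConv (hF' θ hθ).1.continuous) ?_
    (integrable_decayWeight.const_mul _) ?_
  · filter_upwards [hs.mem_nhds hθ] with t ht
      using aestronglyMeasurable_oscConv (hF t ht).1.continuous
  · exact Eventually.of_forall fun w t ht => norm_oscConv_le (hF' t ht) w
  · exact Eventually.of_forall fun w t ht =>
      hasFDerivAt_oscConv hs ht (fun t ht => (hF t ht).1.continuous) hF' hd w

end Derivative

end Osc
/-! ### Regularisation by Schwartz cut-offs and integration by parts -/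

section Cutoff

variable {d p : ℕ} {V : Type*} [NormedAddCommGroup V] [NormedSpace ℂ V] {F : Phase d → V}
  {E E' : Type*} [NormedAddCommGroup E] [NormedSpace ℝ E] [NormedAddCommGroup E']
  [NormedSpace ℝ E']

lemma exists_schwartzMap_eq_cutoff_smul {F : E → V} (hF : F.HasTemperateGrowth) (χ : 𝓢(E, ℂ))
    {ε : ℝ} (hε : ε ≠ 0) (w₁ : E) :
    ∃ G : 𝓢(E, V), ∀ w, G w = χ (ε • (w + w₁)) • F w := by
  let dilation : E ≃L[ℝ] E := ContinuousLinearEquiv.smulLeft (Units.mk0 ε hε)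
  let ψ : 𝓢(E, ℂ) := SchwartzMap.compSubConstCLM ℝ (-w₁)
    (SchwartzMap.compCLMOfContinuousLinearEquiv ℝ dilation χ)
  refine ⟨SchwartzMap.bilinLeftCLM (ContinuousLinearMap.lsmul ℝ ℂ) hF ψ, fun w => ?_⟩
  change χ (ε • (w - -w₁)) • F w = _
  rw [sub_neg_eq_add]

lemma exists_derivBound_cutoff (χ : 𝓢(E, ℂ)) {L : E' →L[ℝ] E} (hL : ‖L‖ ≤ 1) (N : ℕ) :
    ∃ C, ∀ ε : ℝ, 0 ≤ ε → ε ≤ 1 →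
      ∀ w₁, DerivBound N (growth 0 C) (fun w => χ (ε • (L w + w₁))) := by
  have hχ := derivBound_schwartz 0 N χ
  simp only [pow_zero, one_mul, inv_one, mul_one] at hχ
  refine ⟨(Finset.Iic (0, N)).sup (fun m => SchwartzMap.seminorm ℝ m.1 m.2) χ,
    fun ε h0 h1 w₁ => ?_⟩
  have hdil : ‖ε • L‖ ≤ 1 := by
    rw [norm_smul, Real.norm_of_nonneg h0]
    exact mul_le_one₀ h1 (norm_nonneg _) hL
  have haffine := (hχ.comp_affine (ε • w₁) _ le_rfl hdil).mono (ρ' := growth 0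
    ((Finset.Iic (0, N)).sup (fun m => SchwartzMap.seminorm ℝ m.1 m.2) χ))
    fun w => by simp only [growth, pow_zero, one_pow, one_mul, mul_one, le_refl]
  refine (congrArg _ ?_).mp haffine
  ext w
  simp only [smul_apply, smul_add, add_comm]

lemma exists_derivBound_cutoff_smul {F : E' → V} (hF : IsAmplitude p F) (χ : 𝓢(E, ℂ))
    {L : E' →L[ℝ] E} (hL : ‖L‖ ≤ 1) (N : ℕ) : ∃ C, ∀ w₁, ∀ᶠ ε : ℝ in 𝓝[>] 0,
      DerivBound N (growth p C) (fun w => χ (ε • (L w + w₁)) • F w) := by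
  obtain ⟨C, hC⟩ := exists_derivBound_cutoff χ hL N
  obtain ⟨C', hC'⟩ := hF N
  refine ⟨‖(ContinuousLinearMap.lsmul ℝ ℂ : ℂ →L[ℝ] V →L[ℝ] V)‖ * (2 ^ N * (C * C')),
    fun w₁ => ?_⟩
  filter_upwards [Ioc_mem_nhdsGT (zero_lt_one (α := ℝ))] with ε hε
  have h := (hC ε hε.1.le hε.2 w₁).growth_bilin (ContinuousLinearMap.lsmul ℝ ℂ) hC'
  rwa [zero_add] at h

lemma tendsto_osc_cutoff_smul [CompleteSpace V] (hF : IsAmplitude p F) (χ : 𝓢(E, ℂ))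
    {L : Phase d →L[ℝ] E} (hL : ‖L‖ ≤ 1) (w₁ : E) :
    Tendsto (fun ε : ℝ => osc (fun w => χ (ε • (L w + w₁)) • F w)) (𝓝[>] 0)
      (𝓝 (χ 0 • osc F)) := by
  obtain ⟨C, hC⟩ := exists_derivBound_cutoff_smul hF χ hL (oscOrder d p)
  rw [← osc_smul _ hF]
  refine tendsto_osc (hC w₁) fun w => Tendsto.smul ?_ tendsto_const_nhds
  have hcont : Continuous fun ε : ℝ => χ (ε • (L w + w₁)) := χ.continuous.comp (by fun_prop)
  simpa only [zero_smul] using (hcont.tendsto 0).mono_left nhdsWithin_le_nhds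

lemma integrable_cutoff_smul_phase_smul (hF : IsAmplitude p F) (χ : 𝓢(Phase d, ℂ)) {ε : ℝ}
    (hε : 0 < ε) (w₁ : Phase d) :
    Integrable (fun w => χ (ε • (w + w₁)) • (phase w • F w)) := by
  obtain ⟨G, hG⟩ := exists_schwartzMap_eq_cutoff_smul hF.hasTemperateGrowth χ hε.ne' w₁
  simp only [smul_comm (χ _) (phase _), ← hG]
  exact G.integrable.bdd_smul 1 phase_contDiff.continuous.aestronglyMeasurable
    (Eventually.of_forall fun w => (norm_phase w).le)

lemma tendsto_integral_cutoff_smul [CompleteSpace V] (hF : IsAmplitude p F)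
    (χ : 𝓢(Phase d, ℂ)) (w₁ : Phase d) :
    Tendsto (fun ε : ℝ => ∫ w, χ (ε • (w + w₁)) • (phase w • F w)) (𝓝[>] 0)
      (𝓝 (χ 0 • osc F)) := by
  refine (tendsto_osc_cutoff_smul hF χ ContinuousLinearMap.norm_id_le w₁).congr' ?_
  filter_upwards [self_mem_nhdsWithin] with ε (hε : 0 < ε)
  obtain ⟨G, hG⟩ := exists_schwartzMap_eq_cutoff_smul hF.hasTemperateGrowth χ hε.ne' w₁
  simp only [ContinuousLinearMap.id_apply, smul_comm (χ _) (phase _), ← hG]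
  exact osc_eq_integral G.integrable

/-- The real-linear form `w ↦ i (⟨w₁, v₂⟩ + ⟨v₁, w₂⟩)`: minus the logarithmic derivative of `phase`
at `w` in the direction `v`. -/
def phaseDeriv (v : Phase d) : Phase d →L[ℝ] ℂ :=
  (Complex.I • Complex.ofRealCLM) ∘L
    (innerSL ℝ v.2 ∘L ContinuousLinearMap.fst ℝ (Conf d) (Conf d) +
      innerSL ℝ v.1 ∘L ContinuousLinearMap.snd ℝ (Conf d) (Conf d))

lemma phaseDeriv_apply (v w : Phase d) :
    phaseDeriv v w = Complex.I * ((inner ℝ v.2 w.1 + inner ℝ v.1 w.2 : ℝ) : ℂ) := rfl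

lemma fderiv_phase (w v : Phase d) : fderiv ℝ phase w v = -(phaseDeriv v w * phase w) := by
  have hinner : HasFDerivAt (fun w : Phase d => (inner ℝ w.1 w.2 : ℝ)) _ w :=
    (hasFDerivAt_fst (𝕜 := ℝ) (p := w)).inner ℝ (hasFDerivAt_snd (𝕜 := ℝ) (p := w))
  have hphase := ((Complex.ofRealCLM.hasFDerivAt.comp w hinner).const_mul Complex.I).neg.cexp
  refine (congrArg (fun L => L v) hphase.fderiv).trans ?_
  simp [phase, phaseDeriv_apply, mul_comm, real_inner_comm]

lemma osc_phaseDeriv_smul_schwartz [CompleteSpace V] (G : 𝓢(Phase d, V)) (v : Phase d) :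
    osc (fun w => phaseDeriv v w • G w) = osc (fun w => fderiv ℝ G w v) := by
  have hphase {H : Phase d → V} (hH : Integrable H) : Integrable fun w => phase w • H w :=
    hH.bdd_smul 1 phase_contDiff.continuous.aestronglyMeasurable
      (Eventually.of_forall fun w => (norm_phase w).le)
  have hmul : Integrable fun w => phaseDeriv v w • G w :=
    (SchwartzMap.smulLeftCLM V (phaseDeriv v) G).integrable.congr
      (Eventually.of_forall fun w => by
        rw [SchwartzMap.smulLeftCLM_apply_apply (by fun_prop)])
  have hderiv : Integrable fun w => fderiv ℝ G w v := (LineDeriv.lineDerivOp v G).integrable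
  have hparts := integral_smul_fderiv_eq_neg_fderiv_smul_of_integrable (𝕜 := ℂ) (μ := volume)
    (f := phase) (g := G) (v := v)
    ((hphase hmul).neg.congr (Eventually.of_forall fun w => by
      simp only [Pi.neg_apply, fderiv_phase, neg_smul, mul_smul, smul_comm (phase w)]))
    (hphase hderiv) (hphase G.integrable)
    (fun w _ => phase_contDiff.differentiable (by simp) w) (fun w _ => G.differentiableAt)
  rw [osc_eq_integral hmul, osc_eq_integral hderiv, hparts, ← integral_neg]
  simp only [fderiv_phase, neg_smul, mul_smul, neg_neg, smul_comm (phase _)]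

lemma tendsto_fderiv_cutoff_smul (χ : 𝓢(E, ℂ)) {F : E → V} {w : E}
    (hF : DifferentiableAt ℝ F w) (v : E) :
    Tendsto (fun ε : ℝ => fderiv ℝ (fun w => χ (ε • w) • F w) w v) (𝓝 0)
      (𝓝 (χ 0 • fderiv ℝ F w v)) := by
  have hχ (ε : ℝ) : HasFDerivAt (fun w => χ (ε • w)) (ε • fderiv ℝ χ (ε • w)) w := by
    refine ((χ.hasFDerivAt (ε • w)).comp w
      ((ε • ContinuousLinearMap.id ℝ E).hasFDerivAt (x := w))).congr_fderiv ?_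
    rw [ContinuousLinearMap.comp_smul, ContinuousLinearMap.comp_id]
  have hderiv (ε : ℝ) : fderiv ℝ (fun w => χ (ε • w) • F w) w v =
      χ (ε • w) • fderiv ℝ F w v + (ε • fderiv ℝ χ (ε • w) v) • F w :=
    congrArg (fun L => L v) ((hχ ε).smul hF.hasFDerivAt).fderiv
  have hχ' : Continuous (fderiv ℝ χ) := (χ.smooth 1).continuous_fderiv one_ne_zero
  have hcont : Continuous fun ε : ℝ =>
      χ (ε • w) • fderiv ℝ F w v + (ε • fderiv ℝ χ (ε • w) v) • F w := by
    have := χ.continuous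
    fun_prop
  simp only [hderiv]
  simpa only [zero_smul, add_zero] using hcont.tendsto 0

lemma exists_schwartzMap_zero_eq_one (E : Type*) [NormedAddCommGroup E] [NormedSpace ℝ E]
    [FiniteDimensional ℝ E] : ∃ χ : 𝓢(E, ℂ), χ 0 = 1 := by
  let β : ContDiffBump (0 : E) := ⟨1, 2, one_pos, one_lt_two⟩
  refine ⟨HasCompactSupport.toSchwartzMap (f := fun w => ((β w : ℝ) : ℂ))
    (β.hasCompactSupport.comp_left Complex.ofReal_zero)
    (Complex.ofRealCLM.contDiff.comp β.contDiff), ?_⟩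
  change ((β 0 : ℝ) : ℂ) = 1
  rw [β.one_of_mem_closedBall (Metric.mem_closedBall_self β.rIn_pos.le), Complex.ofReal_one]

lemma osc_phaseDeriv_smul [CompleteSpace V] (hF : IsAmplitude p F) (v : Phase d) :
    osc (fun w => phaseDeriv v w • F w) = osc (fun w => fderiv ℝ F w v) := by
  obtain ⟨χ, hχ⟩ := exists_schwartzMap_zero_eq_one (Phase d)
  have hmul : Tendsto (fun ε : ℝ => osc fun w => phaseDeriv v w • (χ (ε • w) • F w))
      (𝓝[>] 0) (𝓝 (osc fun w => phaseDeriv v w • F w)) := by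
    have h := tendsto_osc_cutoff_smul ((isAmplitude_clm (phaseDeriv v)).smul hF) χ
      ContinuousLinearMap.norm_id_le 0
    simpa only [ContinuousLinearMap.id_apply, add_zero, hχ, one_smul, smul_comm (χ _)] using h
  have hderiv : Tendsto (fun ε : ℝ => osc fun w => fderiv ℝ (fun w => χ (ε • w) • F w) w v)
      (𝓝[>] 0) (𝓝 (osc fun w => fderiv ℝ F w v)) := by
    obtain ⟨C, hC⟩ := exists_derivBound_cutoff_smul hF χ
      ContinuousLinearMap.norm_id_le (oscOrder d p + 1)
    refine tendsto_osc (p := p) (C := ‖ContinuousLinearMap.apply ℝ V v‖ * C) ?_ fun w => ?_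
    · filter_upwards [hC 0] with ε hε
      simp only [ContinuousLinearMap.id_apply, add_zero] at hε
      exact (hε.fderiv.clm (ContinuousLinearMap.apply ℝ V v)).mono fun w => (mul_assoc _ _ _).ge
    · have h := tendsto_fderiv_cutoff_smul χ
        (hF.contDiff.differentiable (by simp) w) v
      rw [hχ, one_smul] at h
      exact h.mono_left nhdsWithin_le_nhds
  refine tendsto_nhds_unique hmul (hderiv.congr' ?_)
  filter_upwards [self_mem_nhdsWithin] with ε (hε : 0 < ε)
  obtain ⟨G, hG⟩ := exists_schwartzMap_eq_cutoff_smul hF.hasTemperateGrowth χ hε.ne' 0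
  have hG' : (fun w => χ (ε • w) • F w) = G := by
    ext w
    rw [hG, add_zero]
  simp only [congrFun hG']
  exact (osc_phaseDeriv_smul_schwartz G v).symm

end Cutoff
/-! ### Amplitudes depending on one variable -/

section Inversion

open scoped FourierTransform

variable {d p : ℕ} {V : Type*} [NormedAddCommGroup V] [NormedSpace ℂ V]

lemma integral_phase_smul_schwartz (f : 𝓢(Conf d, V)) (z : Conf d) :
    ∫ ζ, phase (z, ζ) • f ζ = 𝓕 f ((2 * Real.pi)⁻¹ • z) := by
  rw [SchwartzMap.fourier_coe, Real.fourier_eq']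
  congr 1 with ζ
  congr 1
  rw [phase, real_inner_smul_right, real_inner_comm]
  congr 1
  push_cast
  field_simp [Real.pi_ne_zero]

lemma integral_fourier_comp_smul [CompleteSpace V] (f : 𝓢(Conf d, V)) :
    ∫ z, 𝓕 f ((2 * Real.pi)⁻¹ • z) = (2 * Real.pi : ℂ) ^ d • f 0 := by
  have hinv : ∫ z, 𝓕 f z = f 0 := by
    rw [← congrArg (fun g : 𝓢(Conf d, V) => g 0)
        (FourierTransform.fourierInv_fourier_eq (F := 𝓢(Conf d, V)) f),
      SchwartzMap.fourierInv_coe, Real.fourierInv_eq]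
    simp only [inner_zero_right, AddChar.map_zero_eq_one, one_smul]
  rw [Measure.integral_comp_smul volume (𝓕 f : 𝓢(Conf d, V)), hinv, finrank_euclideanSpace,
    Fintype.card_fin,
    inv_pow, inv_inv, abs_of_pos (by positivity), ← Complex.coe_smul]
  push_cast
  rfl

lemma osc_cutoff_smul_snd [CompleteSpace V] (f : 𝓢(Conf d, V)) (χ : 𝓢(Conf d, ℂ)) {δ : ℝ}
    (hδ : δ ≠ 0) :
    osc (fun w : Phase d => χ (δ • w.1) • f w.2) =
      ∫ z, χ (δ • z) • 𝓕 f ((2 * Real.pi)⁻¹ • z) := by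
  have hint : Integrable (fun w : Phase d => χ (δ • w.1) • f w.2) :=
    ((integrable_comp_smul_iff volume χ hδ).2 χ.integrable).smul_prod f.integrable
  rw [osc_eq_integral hint, Measure.volume_eq_prod, integral_prod]
  · simp only [smul_comm (phase _) (χ _), integral_smul, integral_phase_smul_schwartz]
  · exact hint.bdd_smul 1 phase_contDiff.continuous.aestronglyMeasurable
      (Eventually.of_forall fun w => (norm_phase w).le)

lemma isAmplitude_schwartz {E : Type*} [NormedAddCommGroup E] [NormedSpace ℝ E] (f : 𝓢(E, V)) :
    IsAmplitude 0 f := fun N =>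
  ⟨_, (derivBound_schwartz 0 N f).mono fun w => by
    rw [growth, pow_zero, pow_zero, inv_one]⟩

lemma IsAmplitude.comp_snd {f : Conf d → V} (hf : IsAmplitude p f) :
    IsAmplitude p (fun w : Phase d => f w.2) := fun N => by
  obtain ⟨C, hC⟩ := hf N
  have h := hC.comp_affine 0 (ContinuousLinearMap.snd ℝ (Conf d) (Conf d)) le_rfl
    (ContinuousLinearMap.norm_snd_le ..)
  simp only [zero_add, one_pow, one_mul, ContinuousLinearMap.coe_snd'] at h
  refine ⟨C, h.mono fun w => ?_⟩
  unfold growth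
  gcongr
  · exact hC.const_nonneg
  · exact norm_snd_le w

lemma osc_schwartz_snd [CompleteSpace V] (f : 𝓢(Conf d, V)) :
    osc (fun w : Phase d => f w.2) = (2 * Real.pi : ℂ) ^ d • f 0 := by
  obtain ⟨χ, hχ⟩ := exists_schwartzMap_zero_eq_one (Conf d)
  have hosc : Tendsto (fun δ : ℝ => osc fun w : Phase d => χ (δ • w.1) • f w.2) (𝓝[>] 0)
      (𝓝 (osc fun w : Phase d => f w.2)) := by
    have h := tendsto_osc_cutoff_smul (isAmplitude_schwartz f).comp_snd χ
      (ContinuousLinearMap.norm_fst_le ..) 0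
    simpa only [ContinuousLinearMap.coe_fst', add_zero, hχ, one_smul] using h
  obtain ⟨C, hC⟩ := exists_derivBound_cutoff χ ContinuousLinearMap.norm_id_le 0
  have hint : Integrable fun z => 𝓕 f ((2 * Real.pi)⁻¹ • z) :=
    (integrable_comp_smul_iff volume (𝓕 f : 𝓢(Conf d, V)) (by positivity)).2
      (𝓕 f).integrable
  have hlim : Tendsto (fun δ : ℝ => ∫ z, χ (δ • z) • 𝓕 f ((2 * Real.pi)⁻¹ • z)) (𝓝[>] 0)
      (𝓝 (∫ z, 𝓕 f ((2 * Real.pi)⁻¹ • z))) := by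
    refine tendsto_integral_filter_of_dominated_convergence
      (fun z => C * ‖𝓕 f ((2 * Real.pi)⁻¹ • z)‖) ?_ ?_ (hint.norm.const_mul C) ?_
    · refine Eventually.of_forall fun δ => Continuous.aestronglyMeasurable ?_
      have := χ.continuous
      have := (𝓕 f).continuous
      fun_prop
    · filter_upwards [Ioc_mem_nhdsGT (zero_lt_one (α := ℝ))] with δ hδ
      refine Eventually.of_forall fun z => ?_
      rw [norm_smul]
      gcongr
      simpa [growth] using (hC δ hδ.1.le hδ.2 0).norm_le z
    · refine Eventually.of_forall fun z => ?_
      have hcont : Continuous fun δ : ℝ => χ (δ • z) • 𝓕 f ((2 * Real.pi)⁻¹ • z) := by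
        have := χ.continuous
        fun_prop
      simpa only [zero_smul, hχ, one_smul] using
        (hcont.tendsto 0).mono_left nhdsWithin_le_nhds
  rw [integral_fourier_comp_smul] at hlim
  refine tendsto_nhds_unique hosc (hlim.congr' ?_)
  filter_upwards [self_mem_nhdsWithin] with δ (hδ : 0 < δ)
  exact (osc_cutoff_smul_snd f χ hδ.ne').symm

lemma osc_snd [CompleteSpace V] {f : Conf d → V} (hf : IsAmplitude p f) :
    osc (fun w : Phase d => f w.2) = (2 * Real.pi : ℂ) ^ d • f 0 := by
  obtain ⟨χ, hχ⟩ := exists_schwartzMap_zero_eq_one (Conf d)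
  have hosc := tendsto_osc_cutoff_smul hf.comp_snd χ
    (ContinuousLinearMap.norm_snd_le ..) 0
  rw [hχ, one_smul] at hosc
  refine tendsto_nhds_unique hosc (tendsto_const_nhds.congr' ?_)
  filter_upwards [self_mem_nhdsWithin] with ε (hε : 0 < ε)
  obtain ⟨G, hG⟩ := exists_schwartzMap_eq_cutoff_smul hf.hasTemperateGrowth χ hε.ne' 0
  have hG0 : G 0 = f 0 := by simp [hG, hχ]
  rw [← hG0, ← osc_schwartz_snd]
  simp only [hG, ContinuousLinearMap.coe_snd']

end Inversion
/-! ### Symbols and their translates -/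

section UnifSymbol

variable {d N : ℕ} {m C R : ℝ} {V W E : Type*} [NormedAddCommGroup V] [NormedSpace ℂ V]
  [NormedAddCommGroup W] [NormedSpace ℂ W] [NormedAddCommGroup E] [NormedSpace ℝ E]
  {a : Phase d → V}

lemma one_le_bracket (ξ : Conf d) : 1 ≤ bracket ξ := by
  rw [bracket, Real.one_le_sqrt]
  linarith [sq_nonneg ‖ξ‖]

lemma bracket_pos (ξ : Conf d) : 0 < bracket ξ := zero_lt_one.trans_le (one_le_bracket ξ)

lemma bracket_rpow_pos (m : ℝ) (ξ : Conf d) : 0 < bracket ξ ^ m :=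
  Real.rpow_pos_of_pos (bracket_pos ξ) m

lemma bracket_add_le (η ζ : Conf d) : bracket (η + ζ) ≤ bracket η * (1 + ‖ζ‖) := by
  have hη : ‖η‖ ≤ bracket η := Real.le_sqrt_of_sq_le (by linarith)
  have hsq : bracket η ^ 2 = 1 + ‖η‖ ^ 2 := Real.sq_sqrt (by positivity)
  have hadd : bracket (η + ζ) ≤ bracket η + ‖ζ‖ := by
    refine Real.sqrt_le_iff.mpr ⟨add_nonneg (bracket_pos η).le (norm_nonneg ζ), ?_⟩
    have htri : ‖η + ζ‖ ^ 2 ≤ (‖η‖ + ‖ζ‖) ^ 2 := by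
      gcongr
      exact norm_add_le η ζ
    nlinarith [mul_le_mul_of_nonneg_right hη (norm_nonneg ζ)]
  nlinarith [norm_nonneg ζ, one_le_bracket η]

/-- The exponent of `1 + ‖ζ‖` in Peetre's inequality for `⟨ξ⟩ ^ m`. -/
def peetreOrder (m : ℝ) : ℕ := ⌈|m|⌉₊

lemma bracket_add_rpow_le (m : ℝ) (η ζ : Conf d) :
    bracket (η + ζ) ^ m ≤ bracket η ^ m * (1 + ‖ζ‖) ^ peetreOrder m := by
  suffices h : bracket (η + ζ) ^ m ≤ bracket η ^ m * (1 + ‖ζ‖) ^ |m| by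
    refine h.trans (mul_le_mul_of_nonneg_left ?_ (bracket_rpow_pos m η).le)
    rw [← Real.rpow_natCast]
    exact Real.rpow_le_rpow_of_exponent_le (by linarith [norm_nonneg ζ]) (Nat.le_ceil _)
  rcases le_total 0 m with hm | hm
  · rw [abs_of_nonneg hm, ← Real.mul_rpow (bracket_pos η).le (by positivity)]
    exact Real.rpow_le_rpow (bracket_pos _).le (bracket_add_le η ζ) hm
  · have hη : bracket η ≤ bracket (η + ζ) * (1 + ‖ζ‖) := by
      simpa using bracket_add_le (η + ζ) (-ζ)
    have hpow := Real.rpow_le_rpow_of_nonpos (bracket_pos η) hη hm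
    rw [Real.mul_rpow (bracket_pos _).le (by positivity)] at hpow
    rwa [abs_of_nonpos hm, Real.rpow_neg (by positivity), ← div_eq_mul_inv,
      le_div_iff₀ (Real.rpow_pos_of_pos (by positivity) m)]

/-- The weight `C ⟨ξ⟩ ^ m` on phase space. -/
def symbolWeight (m C : ℝ) (p : Phase d) : ℝ := C * bracket p.2 ^ m

lemma symbolWeight_add_le (hC : 0 ≤ C) (p w : Phase d) :
    symbolWeight m C (p + w) ≤ symbolWeight m C p * (1 + ‖w‖) ^ peetreOrder m := by
  rw [symbolWeight, symbolWeight, mul_assoc]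
  refine mul_le_mul_of_nonneg_left ((bracket_add_rpow_le m p.2 w.2).trans ?_) hC
  have := (bracket_rpow_pos m p.2).le
  gcongr
  exact norm_snd_le w

lemma DerivBound.symbolWeight_const_nonneg (h : DerivBound N (symbolWeight m C) a) : 0 ≤ C :=
  nonneg_of_mul_nonneg_left (h.nonneg 0) (bracket_rpow_pos m _)

lemma DerivBound.comp_symbol (h : DerivBound N (symbolWeight m C) a) (p : Phase d)
    {L : E →L[ℝ] Phase d} (hR : 1 ≤ R) (hL : ‖L‖ ≤ R) :
    DerivBound N (growth (peetreOrder m) (R ^ (N + peetreOrder m) * symbolWeight m C p))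
      (fun w => a (p + L w)) := by
  refine (h.comp_affine p L hR hL).mono fun w => ?_
  have hw : 1 + ‖L w‖ ≤ R * (1 + ‖w‖) := by
    linarith [L.le_of_opNorm_le hL w]
  calc R ^ N * symbolWeight m C (p + L w)
      ≤ R ^ N * (symbolWeight m C p * (R * (1 + ‖w‖)) ^ peetreOrder m) := by
        gcongr
        refine (symbolWeight_add_le h.symbolWeight_const_nonneg p _).trans ?_
        have := h.nonneg p
        gcongr
    _ = growth (peetreOrder m) (R ^ (N + peetreOrder m) * symbolWeight m C p) w := by
        rw [growth, mul_pow, pow_add]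
        ring

/-- The functions all of whose derivatives are `O(⟨ξ⟩ ^ m)`. Unlike for the symbols of order `m`,
differentiation in `ξ` need not lower the order. -/
def IsUnifSymbol (m : ℝ) (a : Phase d → V) : Prop :=
  ∀ N, ∃ C, DerivBound N (symbolWeight m C) a

namespace IsUnifSymbol

lemma contDiff (h : IsUnifSymbol m a) : ContDiff ℝ ∞ a :=
  let ⟨_, hC⟩ := h 0; hC.1

lemma differentiable (h : IsUnifSymbol m a) : Differentiable ℝ a :=
  h.contDiff.differentiable (by simp)

lemma fderiv (h : IsUnifSymbol m a) : IsUnifSymbol m (fderiv ℝ a) :=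
  fun N => let ⟨C, hC⟩ := h (N + 1); ⟨C, hC.fderiv⟩

lemma clm (h : IsUnifSymbol m a) (L : V →L[ℝ] W) : IsUnifSymbol m (fun p => L (a p)) := fun N =>
  let ⟨C, hC⟩ := h N
  ⟨‖L‖ * C, (hC.clm L).mono fun _ => (mul_assoc ‖L‖ C _).ge⟩

lemma fderiv_apply (h : IsUnifSymbol m a) (v : Phase d) :
    IsUnifSymbol m (fun p => _root_.fderiv ℝ a p v) :=
  h.fderiv.clm (ContinuousLinearMap.apply ℝ V v)

lemma const_smul (h : IsUnifSymbol m a) (c : ℂ) : IsUnifSymbol m (fun p => c • a p) :=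
  h.clm (c • ContinuousLinearMap.id ℝ V)

lemma sum {ι : Type*} (s : Finset ι) {a : ι → Phase d → V} (h : ∀ i ∈ s, IsUnifSymbol m (a i)) :
    IsUnifSymbol m (fun p => ∑ i ∈ s, a i p) := fun N => by
  choose! C hC using fun i hi => h i hi N
  exact ⟨∑ i ∈ s, C i, (DerivBound.sum s hC).mono fun _ => (Finset.sum_mul s C _).ge⟩

lemma isAmplitude_comp (h : IsUnifSymbol m a) (p : Phase d) (L : E →L[ℝ] Phase d) :
    IsAmplitude (peetreOrder m) (fun w => a (p + L w)) := fun N =>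
  let ⟨_, hC⟩ := h N
  ⟨_, hC.comp_symbol p (le_max_left 1 ‖L‖) (le_max_right 1 ‖L‖)⟩

lemma exists_derivBound_comp (h : IsUnifSymbol m a) (N : ℕ) (hR : 1 ≤ R) (p : Phase d) :
    ∃ C, ∀ L : E →L[ℝ] Phase d, ‖L‖ ≤ R → ∀ q ∈ Metric.ball p 1,
      DerivBound N (growth (peetreOrder m) C) (fun w => a (q + L w)) := by
  obtain ⟨C, hC⟩ := h N
  refine ⟨R ^ (N + peetreOrder m) * (symbolWeight m C p * 2 ^ peetreOrder m),
    fun L hL q hq => (hC.comp_symbol q hR hL).mono fun w => ?_⟩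
  rw [mem_ball_iff_norm] at hq
  have hqp : symbolWeight m C q ≤ symbolWeight m C p * (1 + ‖q - p‖) ^ peetreOrder m := by
    simpa using symbolWeight_add_le hC.symbolWeight_const_nonneg p (q - p)
  have := hC.nonneg p
  unfold growth
  gcongr
  refine hqp.trans ?_
  gcongr
  linarith

end IsUnifSymbol

end UnifSymbol

/-! ### The operators `exp (s D_x · ∂_ξ)` -/

section Shear

universe u

variable {d N : ℕ} {m C R s : ℝ} {V : Type u} {W : Type*} [NormedAddCommGroup V] [NormedSpace ℂ V]
  [NormedAddCommGroup W] [NormedSpace ℂ W] {a : Phase d → V}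

/-- Evaluation of real linear maps at a vector, as a complex linear map. -/
def evalCLM {H : Type*} [NormedAddCommGroup H] [NormedSpace ℝ H] (V : Type*)
    [NormedAddCommGroup V] [NormedSpace ℂ V] (h : H) : (H →L[ℝ] V) →L[ℂ] V where
  toFun L := L h
  map_add' _ _ := rfl
  map_smul' _ _ := rfl

lemma evalCLM_apply {H : Type*} [NormedAddCommGroup H] [NormedSpace ℝ H] (h : H)
    (L : H →L[ℝ] V) : evalCLM V h L = L h := rfl

/-- The map `(z, ζ) ↦ (s z, ζ)` of phase space. -/
def dilate (s : ℝ) : Phase d →L[ℝ] Phase d :=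
  (s • ContinuousLinearMap.fst ℝ (Conf d) (Conf d)).prod
    (ContinuousLinearMap.snd ℝ (Conf d) (Conf d))

lemma dilate_apply (s : ℝ) (w : Phase d) : dilate s w = (s • w.1, w.2) := rfl

lemma norm_dilate_le (hR : 1 ≤ R) (hs : |s| ≤ R) :
    ‖(dilate s : Phase d →L[ℝ] Phase d)‖ ≤ R := by
  refine ContinuousLinearMap.opNorm_le_bound _ (zero_le_one.trans hR) fun w => ?_
  rw [dilate_apply, Prod.norm_def, norm_smul]
  exact max_le (mul_le_mul hs (norm_fst_le w) (norm_nonneg _) (zero_le_one.trans hR))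
    ((norm_snd_le w).trans (le_mul_of_one_le_left (norm_nonneg w) hR))

/-- The operator `exp (s D_x · ∂_ξ)`, as the oscillatory integral
`(2π)⁻ᵈ ∫∫ exp (-i ⟨z, ζ⟩) a (x + s z, ξ + ζ) dz dζ`. -/
def shear (s : ℝ) (a : Phase d → V) (p : Phase d) : V :=
  ((2 * Real.pi : ℂ) ^ d)⁻¹ • osc (fun w => a (p + dilate s w))

lemma shear_zero [CompleteSpace V] (ha : IsUnifSymbol m a) : shear 0 a = a := by
  ext p
  have hpi : (2 * Real.pi : ℂ) ^ d ≠ 0 :=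
    pow_ne_zero _ (mul_ne_zero two_ne_zero (mod_cast Real.pi_ne_zero))
  have hsnd (w : Phase d) : dilate 0 w = ContinuousLinearMap.inr ℝ (Conf d) (Conf d) w.2 := by
    rw [dilate_apply, zero_smul, ContinuousLinearMap.inr_apply]
  simp only [shear, hsnd]
  rw [osc_snd (ha.isAmplitude_comp p _), smul_smul, inv_mul_cancel₀ hpi, one_smul, map_zero,
    add_zero]

/-- A bound for the operator norm of `shear s`, `|s| ≤ R`, between spaces with weight `⟨ξ⟩ ^ m`. -/
def shearConst (d : ℕ) (m R : ℝ) : ℝ :=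
  ‖((2 * Real.pi : ℂ) ^ d)⁻¹‖ *
    (oscConst d (peetreOrder m) * R ^ (oscOrder d (peetreOrder m) + peetreOrder m))

lemma norm_shear_le (ha : DerivBound (oscOrder d (peetreOrder m)) (symbolWeight m C) a)
    (hR : 1 ≤ R) (hs : |s| ≤ R) (p : Phase d) :
    ‖shear s a p‖ ≤ symbolWeight m (shearConst d m R * C) p := by
  rw [shear, norm_smul, symbolWeight, shearConst, mul_assoc, mul_assoc, mul_assoc]
  gcongr
  exact norm_osc_le (ha.comp_symbol p hR (norm_dilate_le hR hs))

lemma hasFDerivAt_shear (ha : IsUnifSymbol m a) (s : ℝ) (p : Phase d) :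
    HasFDerivAt (shear s a) (shear s (fderiv ℝ a) p) p := by
  have hR : 1 ≤ max 1 |s| := le_max_left 1 |s|
  have hdil := norm_dilate_le (d := d) hR (le_max_right 1 |s|)
  obtain ⟨C, hC⟩ := ha.exists_derivBound_comp (E := Phase d) (oscOrder d (peetreOrder m)) hR p
  obtain ⟨C', hC'⟩ :=
    ha.fderiv.exists_derivBound_comp (E := Phase d) (oscOrder d (peetreOrder m)) hR p
  exact (hasFDerivAt_osc Metric.isOpen_ball (Metric.mem_ball_self one_pos) (hC _ hdil)
    (hC' _ hdil) fun q _ w => (hasFDerivAt_comp_add_right (dilate s w)).mpr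
      (ha.differentiable _).hasFDerivAt).const_smul _

lemma fderiv_shear (ha : IsUnifSymbol m a) (s : ℝ) :
    fderiv ℝ (shear s a) = shear s (fderiv ℝ a) :=
  funext fun p => (hasFDerivAt_shear ha s p).fderiv

lemma shear_clm [CompleteSpace V] [CompleteSpace W] (ha : IsUnifSymbol m a) (s : ℝ)
    (L : V →L[ℂ] W) (p : Phase d) : shear s (fun q => L (a q)) p = L (shear s a p) := by
  rw [shear, shear, map_smul, osc_clm L (ha.isAmplitude_comp p _)]

lemma fderiv_shear_apply [CompleteSpace V] (ha : IsUnifSymbol m a) (s : ℝ) (v p : Phase d) :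
    fderiv ℝ (shear s a) p v = shear s (fun q => fderiv ℝ a q v) p := by
  rw [fderiv_shear ha]
  exact (shear_clm ha.fderiv s (evalCLM V v) p).symm

lemma contDiff_shear (ha : IsUnifSymbol m a) (s : ℝ) : ContDiff ℝ ∞ (shear s a) := by
  refine contDiff_infty.mpr fun n => ?_
  induction n generalizing V with
  | zero =>
    rw [Nat.cast_zero, contDiff_zero, continuous_iff_continuousAt]
    exact fun p => (hasFDerivAt_shear ha s p).continuousAt
  | succ n ih =>
    rw [Nat.cast_succ, contDiff_succ_iff_fderiv, fderiv_shear ha]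
    exact ⟨fun p => (hasFDerivAt_shear ha s p).differentiableAt, by simp, ih ha.fderiv⟩

lemma norm_iteratedFDeriv_shear_le {n : ℕ} (ha : IsUnifSymbol m a)
    (hC : DerivBound (oscOrder d (peetreOrder m) + n) (symbolWeight m C) a)
    (hR : 1 ≤ R) (hs : |s| ≤ R) (p : Phase d) :
    ‖iteratedFDeriv ℝ n (shear s a) p‖ ≤ symbolWeight m (shearConst d m R * C) p := by
  induction n generalizing V with
  | zero =>
    rw [norm_iteratedFDeriv_zero]
    exact norm_shear_le hC hR hs p
  | succ n ih =>
    rw [← norm_iteratedFDeriv_fderiv, fderiv_shear ha]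
    exact ih ha.fderiv hC.fderiv

lemma DerivBound.shear (ha : IsUnifSymbol m a)
    (hC : DerivBound (oscOrder d (peetreOrder m) + N) (symbolWeight m C) a)
    (hR : 1 ≤ R) (hs : |s| ≤ R) :
    DerivBound N (symbolWeight m (shearConst d m R * C)) (shear s a) :=
  ⟨contDiff_shear ha s, fun _ hn =>
    norm_iteratedFDeriv_shear_le ha (hC.mono_order (by omega)) hR hs⟩

lemma IsUnifSymbol.shear (ha : IsUnifSymbol m a) (s : ℝ) : IsUnifSymbol m (shear s a) := fun _ =>
  let ⟨_, hC⟩ := ha _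
  ⟨_, hC.shear ha (le_max_left 1 |s|) (le_max_right 1 |s|)⟩

end Shear
/-! ### The flow equation and the Taylor remainder -/

section Flow

variable {d p : ℕ} {m : ℝ} {a F : Phase d → ℂ}

/-- The unit vector `e_j` in the position variable. -/
def dirX (j : Fin d) : Phase d := (EuclideanSpace.single j 1, 0)

/-- The unit vector `e_j` in the momentum variable. -/
def dirXi (j : Fin d) : Phase d := (0, EuclideanSpace.single j 1)

/-- The operator `D_x · ∂_ξ = ∑_j D_{x_j} ∂_{ξ_j}`. -/
def mixedOp (a : Phase d → ℂ) (q : Phase d) : ℂ :=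
  ∑ j, -Complex.I * partialXi j (partialX j a) q

namespace IsUnifSymbol

lemma partialX (h : IsUnifSymbol m a) (j : Fin d) : IsUnifSymbol m (partialX j a) :=
  h.fderiv_apply _

lemma partialXi (h : IsUnifSymbol m a) (j : Fin d) : IsUnifSymbol m (partialXi j a) :=
  h.fderiv_apply _

lemma mixedOp (h : IsUnifSymbol m a) : IsUnifSymbol m (mixedOp a) :=
  sum _ fun j _ => ((h.partialX j).partialXi j).const_smul (-Complex.I)

end IsUnifSymbol

lemma pair_zero_eq_sum (z : Conf d) : ((z, 0) : Phase d) = ∑ j, z j • dirX j := by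
  have hz : ∑ j, z j • EuclideanSpace.single j (1 : ℝ) = z := by
    simpa using (EuclideanSpace.basisFun (Fin d) ℝ).sum_repr z
  simpa [dirX, hz] using map_sum (ContinuousLinearMap.inl ℝ (Conf d) (Conf d))
    (fun j => z j • EuclideanSpace.single j (1 : ℝ)) Finset.univ

lemma fderiv_fst_eq_sum (a : Phase d → ℂ) (q : Phase d) (z : Conf d) :
    fderiv ℝ a q (z, 0) = ∑ j, ((z j : ℝ) : ℂ) * partialX j a q := by
  simp only [pair_zero_eq_sum, map_sum, map_smul, Complex.real_smul]
  rfl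

lemma isAmplitude_coord_mul (hF : IsAmplitude p F) (j : Fin d) :
    IsAmplitude (1 + p) (fun w => ((w.1 j : ℝ) : ℂ) * F w) :=
  (isAmplitude_clm (Complex.ofRealCLM ∘L EuclideanSpace.proj j ∘L
    ContinuousLinearMap.fst ℝ (Conf d) (Conf d))).smul hF

lemma osc_coord_mul (hF : IsAmplitude p F) (j : Fin d) :
    osc (fun w => ((w.1 j : ℝ) : ℂ) * F w) =
      osc (fun w => -Complex.I * fderiv ℝ F w (dirXi j)) := by
  have hphase (w : Phase d) :
      phaseDeriv (dirXi j) w • F w = Complex.I • (((w.1 j : ℝ) : ℂ) * F w) := by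
    simp [phaseDeriv_apply, dirXi, mul_assoc, EuclideanSpace.inner_single_left]
  have h := osc_phaseDeriv_smul hF (dirXi j)
  simp only [hphase] at h
  rw [osc_smul _ (isAmplitude_coord_mul hF j)] at h
  simp only [← smul_eq_mul (-Complex.I)]
  rw [osc_smul _ (hF.fderiv_apply _), ← h, smul_smul]
  simp

lemma fderiv_comp_dilate_dirXi (ha : Differentiable ℝ a) (s : ℝ) (q w : Phase d) (j : Fin d) :
    fderiv ℝ (fun w => a (q + dilate s w)) w (dirXi j) = partialXi j a (q + dilate s w) := by
  have h : HasFDerivAt (fun w => a (q + dilate s w)) (fderiv ℝ a (q + dilate s w) ∘L dilate s) w :=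
    (ha _).hasFDerivAt.comp w ((dilate s).hasFDerivAt.const_add q)
  rw [h.fderiv, ContinuousLinearMap.comp_apply, partialXi, dirXi, dilate_apply _ (0, _),
    smul_zero]

lemma isAmplitude_fderiv_fst (ha : IsUnifSymbol m a) (s : ℝ) (q : Phase d) :
    IsAmplitude (1 + peetreOrder m) (fun w => fderiv ℝ a (q + dilate s w) (w.1, 0)) := by
  simp only [fderiv_fst_eq_sum]
  exact IsAmplitude.sum _ fun j _ =>
    isAmplitude_coord_mul ((ha.partialX j).isAmplitude_comp q _) j

lemma osc_fderiv_fst (ha : IsUnifSymbol m a) (s : ℝ) (q : Phase d) :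
    osc (fun w => fderiv ℝ a (q + dilate s w) (w.1, 0)) =
      osc (fun w => mixedOp a (q + dilate s w)) := by
  have hX (j : Fin d) := (ha.partialX j).isAmplitude_comp q (dilate s)
  have hXXi (j : Fin d) :=
    (((ha.partialX j).partialXi j).const_smul (-Complex.I)).isAmplitude_comp q (dilate s)
  simp only [fderiv_fst_eq_sum, mixedOp]
  rw [osc_sum _ fun j _ => isAmplitude_coord_mul (hX j) j]
  refine (Finset.sum_congr rfl fun j _ => ?_).trans (osc_sum _ fun j _ => hXXi j).symm
  rw [osc_coord_mul (hX j) j]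
  simp only [fderiv_comp_dilate_dirXi (ha.partialX j).differentiable, smul_eq_mul]

/-- The derivative of `(s, q) ↦ q + dilate s w`. -/
def shearDir (w : Phase d) : ℝ × Phase d →L[ℝ] Phase d :=
  ContinuousLinearMap.snd ℝ ℝ (Phase d) +
    (ContinuousLinearMap.fst ℝ ℝ (Phase d)).smulRight ((w.1, 0) : Phase d)

lemma shearDir_apply (w : Phase d) (r : ℝ × Phase d) :
    shearDir w r = r.2 + r.1 • ((w.1, 0) : Phase d) := rfl

lemma hasFDerivAt_add_dilate (w : Phase d) (r : ℝ × Phase d) :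
    HasFDerivAt (fun r : ℝ × Phase d => r.2 + dilate r.1 w) (shearDir w) r := by
  have hdilate (t : ℝ) : dilate t w = t • ((w.1, 0) : Phase d) + (0, w.2) := by
    simp [dilate_apply]
  simp only [hdilate]
  exact hasFDerivAt_snd.add ((hasFDerivAt_fst.smul_const _).add_const _)

lemma isAmplitude_shearDir : IsAmplitude 1 (shearDir : Phase d → _) :=
  ((isAmplitude_const _).mono zero_le_one).add <| isAmplitude_clm <|
    (ContinuousLinearMap.smulRightL ℝ (ℝ × Phase d) (Phase d)
      (ContinuousLinearMap.fst ℝ ℝ (Phase d))) ∘L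
        ((ContinuousLinearMap.fst ℝ (Conf d) (Conf d)).prod 0)

lemma exists_derivBound_fderiv_comp_shearDir (ha : IsUnifSymbol m a) (N : ℕ) {R : ℝ}
    (hR : 1 ≤ R) (q : Phase d) :
    ∃ C, ∀ t, |t| ≤ R → ∀ q' ∈ Metric.ball q 1, DerivBound N (growth (peetreOrder m + 1) C)
      (fun w => fderiv ℝ a (q' + dilate t w) ∘L shearDir w) := by
  obtain ⟨C, hC⟩ := ha.fderiv.exists_derivBound_comp (E := Phase d) N hR q
  obtain ⟨C', hC'⟩ := isAmplitude_shearDir (d := d) N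
  exact ⟨_, fun t ht q' hq' => DerivBound.growth_bilin
    (ContinuousLinearMap.compL ℝ (ℝ × Phase d) (Phase d) ℂ)
    (hC (dilate t) (norm_dilate_le hR ht) q' hq') hC'⟩

lemma hasFDerivAt_osc_comp_dilate (ha : IsUnifSymbol m a) (s : ℝ) (q : Phase d) :
    HasFDerivAt (fun r : ℝ × Phase d => osc (fun w => a (r.2 + dilate r.1 w)))
      (osc (fun w => fderiv ℝ a (q + dilate s w) ∘L shearDir w)) (s, q) := by
  have hR : 1 ≤ |s| + 1 := by linarith [abs_nonneg s]
  obtain ⟨C, hC⟩ := ha.exists_derivBound_comp (E := Phase d) (oscOrder d (peetreOrder m)) hR q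
  obtain ⟨C', hC'⟩ :=
    exists_derivBound_fderiv_comp_shearDir ha (oscOrder d (peetreOrder m + 1)) hR q
  have hopen : IsOpen ({t : ℝ | |t| < |s| + 1} ×ˢ Metric.ball q 1) :=
    (isOpen_lt continuous_abs continuous_const).prod Metric.isOpen_ball
  have hF (r : ℝ × Phase d) (w : Phase d) : HasFDerivAt (fun r : ℝ × Phase d =>
      a (r.2 + dilate r.1 w)) (fderiv ℝ a (r.2 + dilate r.1 w) ∘L shearDir w) r :=
    (ha.differentiable _).hasFDerivAt.comp r (hasFDerivAt_add_dilate w r)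
  have hosc := hasFDerivAt_osc (θ := (s, q)) hopen ⟨lt_add_one |s|, Metric.mem_ball_self one_pos⟩
    (fun r hr => hC _ (norm_dilate_le hR (le_of_lt hr.1)) _ hr.2)
    (fun r hr => hC' _ (le_of_lt hr.1) _ hr.2) fun r _ w => hF r w
  exact hosc

lemma osc_fderiv_comp_shearDir_apply (ha : IsUnifSymbol m a) (s : ℝ) (q : Phase d)
    (r : ℝ × Phase d) :
    osc (fun w => fderiv ℝ a (q + dilate s w) ∘L shearDir w) r =
      osc (fun w => fderiv ℝ a (q + dilate s w) r.2) +
        (r.1 : ℂ) • osc (fun w => mixedOp a (q + dilate s w)) := by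
  have hop : IsAmplitude (peetreOrder m + 1)
      (fun w => fderiv ℝ a (q + dilate s w) ∘L shearDir w) :=
    (ha.fderiv.isAmplitude_comp q (dilate s)).bilin
      (ContinuousLinearMap.compL ℝ (ℝ × Phase d) (Phase d) ℂ) isAmplitude_shearDir
  have happly (w : Phase d) : (fderiv ℝ a (q + dilate s w) ∘L shearDir w) r =
      fderiv ℝ a (q + dilate s w) r.2 + (r.1 : ℂ) • fderiv ℝ a (q + dilate s w) (w.1, 0) := by
    rw [ContinuousLinearMap.comp_apply, shearDir_apply, map_add, map_smul, Complex.coe_smul]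
  have hfst := isAmplitude_fderiv_fst ha s q
  rw [← evalCLM_apply r, ← osc_clm _ hop]
  simp only [evalCLM_apply, happly]
  rw [osc_add (((ha.fderiv_apply r.2).isAmplitude_comp q _).mono (by omega)) (hfst.const_smul _),
    osc_smul _ hfst, osc_fderiv_fst ha]

lemma hasFDerivAt_shear_prod (ha : IsUnifSymbol m a) (s : ℝ) (q : Phase d) :
    HasFDerivAt (fun r : ℝ × Phase d => shear r.1 a r.2)
      (fderiv ℝ (shear s a) q ∘L ContinuousLinearMap.snd ℝ ℝ (Phase d) +
        (ContinuousLinearMap.fst ℝ ℝ (Phase d)).smulRight (shear s (mixedOp a) q)) (s, q) := by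
  refine ((hasFDerivAt_osc_comp_dilate ha s q).const_smul
    (((2 * Real.pi : ℂ) ^ d)⁻¹)).congr_fderiv (ContinuousLinearMap.ext fun r => ?_)
  rw [smul_apply, osc_fderiv_comp_shearDir_apply ha, smul_add, smul_comm, Complex.coe_smul,
    add_apply, ContinuousLinearMap.comp_apply, ContinuousLinearMap.smulRight_apply,
    fderiv_shear_apply ha]
  rfl

lemma hasDerivAt_shear (ha : IsUnifSymbol m a) (s : ℝ) (q : Phase d) :
    HasDerivAt (fun s => shear s a q) (shear s (mixedOp a) q) s := by
  have h := (hasFDerivAt_shear_prod ha s q).comp_hasDerivAt s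
    ((hasDerivAt_id s).prodMk (hasDerivAt_const s q))
  exact h.congr_deriv (by simp)

/-- The remainder of order `k` in the Taylor expansion of `s ↦ shear s a` at `0`. -/
def shearRem (k : ℕ) (s : ℝ) (a : Phase d → ℂ) (q : Phase d) : ℂ :=
  shear s a q - ∑ j ∈ Finset.range k, (s ^ j / (j.factorial : ℝ) : ℝ) • (mixedOp^[j] a) q

lemma hasDerivAt_shearRem (ha : IsUnifSymbol m a) (k : ℕ) (s : ℝ) (q : Phase d) :
    HasDerivAt (fun s => shearRem (k + 1) s a q) (shearRem k s (mixedOp a) q) s := by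
  have hpow (j : ℕ) : HasDerivAt (fun s : ℝ => s ^ j / (j.factorial : ℝ))
      (j * s ^ (j - 1) / (j.factorial : ℝ)) s := (hasDerivAt_pow j s).div_const _
  refine (hasDerivAt_shear ha s q).sub
    ((HasDerivAt.fun_sum fun j _ => (hpow j).smul_const _).congr_deriv ?_)
  rw [Finset.sum_range_succ']
  simp only [Nat.cast_zero, zero_mul, zero_div, zero_smul, add_zero, Nat.add_sub_cancel]
  refine Finset.sum_congr rfl fun j _ => ?_
  rw [Function.iterate_succ_apply, Nat.factorial_succ, Nat.cast_mul,
    mul_div_mul_left _ _ (Nat.cast_ne_zero.mpr j.succ_ne_zero)]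

lemma shearRem_succ_zero (ha : IsUnifSymbol m a) (k : ℕ) (q : Phase d) :
    shearRem (k + 1) 0 a q = 0 := by
  rw [shearRem, Finset.sum_range_succ', shear_zero ha]
  simp

end Flow
lemma exists_norm_shearRem_le {d : ℕ} {R : ℝ} (hR : 0 ≤ R) (k : ℕ) {m : ℝ} {a : Phase d → ℂ}
    (h : ∀ j ≤ k, IsUnifSymbol (m - j) (mixedOp^[j] a)) :
    ∃ C, ∀ s, |s| ≤ R → ∀ p, ‖shearRem k s a p‖ ≤ symbolWeight (m - k) C p := by
  have ha : IsUnifSymbol m a := by simpa using h 0 k.zero_le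
  induction k generalizing m a with
  | zero =>
    obtain ⟨C, hC⟩ := ha (oscOrder d (peetreOrder m))
    refine ⟨shearConst d m (max 1 R) * C, fun s hs p => ?_⟩
    simpa [shearRem] using norm_shear_le hC (le_max_left 1 R) (hs.trans (le_max_right 1 R)) p
  | succ k ih =>
    have hm (j : ℕ) : m - (j + 1 : ℕ) = m - 1 - j := by push_cast; ring
    obtain ⟨C, hC⟩ := ih (m := m - 1) (a := mixedOp a)
      (fun j hj => hm j ▸ h (j + 1) (by omega)) (by simpa using h 1 (by omega))
    refine ⟨C * R, fun s hs p => ?_⟩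
    have hmean := (convex_Icc (-R) R).norm_image_sub_le_of_norm_hasDerivWithin_le
      (f := fun s => shearRem (k + 1) s a p) (f' := fun s => shearRem k s (mixedOp a) p)
      (fun t _ => (hasDerivAt_shearRem ha k t p).hasDerivWithinAt)
      (fun t ht => hC t (abs_le.mpr ht) p) (x := 0) (y := s) ⟨by linarith, hR⟩ (abs_le.mp hs)
    rw [shearRem_succ_zero ha, sub_zero, sub_zero, Real.norm_eq_abs] at hmean
    have hC0 := (norm_nonneg _).trans (hC s hs p)
    calc ‖shearRem (k + 1) s a p‖ ≤ symbolWeight (m - 1 - k) C p * |s| := hmean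
      _ ≤ symbolWeight (m - 1 - k) C p * R := by gcongr
      _ = symbolWeight (m - (k + 1 : ℕ)) (C * R) p := by
        rw [hm, symbolWeight, symbolWeight, mul_right_comm]

/-! ### Change of quantization -/

section Quantization

variable {d p p' : ℕ} {m C C' R : ℝ} {a : Phase d → ℂ}

lemma hasDerivAt_osc {V : Type*} [NormedAddCommGroup V] [NormedSpace ℂ V] [CompleteSpace V]
    {F F' : ℝ → Phase d → V} {s : Set ℝ} {θ : ℝ} (hs : IsOpen s) (hθ : θ ∈ s)
    (hF : ∀ t ∈ s, DerivBound (oscOrder d p) (growth p C) (F t))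
    (hF' : ∀ t ∈ s, DerivBound (oscOrder d p') (growth p' C') (F' t)) (hF'θ : IsAmplitude p' (F' θ))
    (hd : ∀ t ∈ s, ∀ w, HasDerivAt (fun t => F t w) (F' t w) t) :
    HasDerivAt (fun t => osc (F t)) (osc (F' θ)) θ := by
  let Λ : V →L[ℝ] ℝ →L[ℝ] V :=
    ContinuousLinearMap.smulRightL ℝ ℝ V (ContinuousLinearMap.id ℝ ℝ)
  have hΛ (t : ℝ) (ht : t ∈ s) : DerivBound (oscOrder d p') (growth p' (‖Λ‖ * C'))
      (fun w => Λ (F' t w)) :=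
    ((hF' t ht).clm Λ).mono fun w => (mul_assoc ‖Λ‖ C' _).ge
  have h := hasFDerivAt_osc hs hθ hF hΛ fun t ht w => (hd t ht w).hasFDerivAt
  refine h.hasDerivAt.congr_deriv ?_
  rw [← evalCLM_apply, ← osc_clm _ (hF'θ.clm Λ)]
  congr 1 with w
  exact one_smul ℝ (F' θ w)

/-- The amplitude `a (x + t z, ζ) v (x + z)`. -/
def quantAmp (x : Conf d) (v : 𝓢(Conf d, ℂ)) (t : ℝ) (a : Phase d → ℂ) (w : Phase d) : ℂ :=
  a (((x, 0) : Phase d) + dilate t w) * v (x + w.1)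

lemma isAmplitude_schwartz_comp_fst (v : 𝓢(Conf d, ℂ)) (x : Conf d) :
    IsAmplitude 0 (fun w : Phase d => v (x + w.1)) := fun N => by
  obtain ⟨C, hC⟩ := isAmplitude_schwartz v N
  have h := hC.comp_affine x (ContinuousLinearMap.fst ℝ (Conf d) (Conf d)) le_rfl
    (ContinuousLinearMap.norm_fst_le ..)
  exact ⟨C, h.mono fun w => by simp only [growth, pow_zero, one_pow, one_mul, le_refl]⟩

lemma IsUnifSymbol.quantAmp (ha : IsUnifSymbol m a) (x : Conf d) (v : 𝓢(Conf d, ℂ)) (t : ℝ) :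
    IsAmplitude (peetreOrder m) (quantAmp x v t a) :=
  (ha.isAmplitude_comp _ (dilate t)).smul (isAmplitude_schwartz_comp_fst v x)

lemma fderiv_quantAmp_dirXi (ha : Differentiable ℝ a) (x : Conf d) (v : 𝓢(Conf d, ℂ)) (t : ℝ)
    (j : Fin d) (w : Phase d) :
    fderiv ℝ (quantAmp x v t a) w (dirXi j) = quantAmp x v t (partialXi j a) w := by
  have hv : HasFDerivAt (fun w : Phase d => v (x + w.1)) _ w :=
    (v.hasFDerivAt (x + w.1)).comp w (hasFDerivAt_fst.const_add x)
  have ha' : DifferentiableAt ℝ (fun w => a (((x, 0) : Phase d) + dilate t w)) w := by fun_prop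
  have h : HasFDerivAt (quantAmp x v t a) _ w := ha'.hasFDerivAt.mul hv
  rw [h.fderiv, add_apply, smul_apply, smul_apply, fderiv_comp_dilate_dirXi ha]
  simp [quantAmp, dirXi, mul_comm]

lemma partialX_shear (ha : IsUnifSymbol m a) (s : ℝ) (j : Fin d) :
    partialX j (shear s a) = shear s (partialX j a) :=
  funext fun p => fderiv_shear_apply ha s _ p

lemma partialXi_shear (ha : IsUnifSymbol m a) (s : ℝ) (j : Fin d) :
    partialXi j (shear s a) = shear s (partialXi j a) :=
  funext fun p => fderiv_shear_apply ha s _ p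

lemma shear_mixedOp (ha : IsUnifSymbol m a) (s : ℝ) (q : Phase d) :
    shear s (mixedOp a) q = ∑ j, -Complex.I * shear s (partialXi j (partialX j a)) q := by
  have hXXi (j : Fin d) := ((ha.partialX j).partialXi j).isAmplitude_comp q (dilate s)
  simp only [shear, mixedOp, ← smul_eq_mul (-Complex.I)]
  rw [osc_sum _ fun j _ => (hXXi j).const_smul _, Finset.smul_sum]
  exact Finset.sum_congr rfl fun j _ => by rw [osc_smul _ (hXXi j), smul_comm]

/-- The derivative in `s` of `quantAmp x v (τ - s) (shear s a)`. -/
def quantAmpDeriv (x : Conf d) (v : 𝓢(Conf d, ℂ)) (τ : ℝ) (a : Phase d → ℂ) (s : ℝ)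
    (w : Phase d) : ℂ :=
  quantAmp x v (τ - s) (shear s (mixedOp a)) w +
    (-1 : ℂ) • ∑ j, ((w.1 j : ℝ) : ℂ) * quantAmp x v (τ - s) (shear s (partialX j a)) w

lemma hasDerivAt_quantAmp_shear (ha : IsUnifSymbol m a) (x : Conf d) (v : 𝓢(Conf d, ℂ))
    (τ s : ℝ) (w : Phase d) :
    HasDerivAt (fun s => quantAmp x v (τ - s) (shear s a) w) (quantAmpDeriv x v τ a s w) s := by
  have hpath : HasDerivAt (fun s : ℝ => ((x, 0) : Phase d) + dilate (τ - s) w)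
      (-(w.1, 0) : Phase d) s := by
    have hdilate (s : ℝ) : ((x, 0) : Phase d) + dilate (τ - s) w =
        ((x, w.2) : Phase d) + (τ - s) • ((w.1, 0) : Phase d) := by
      simp [dilate_apply]
    simp only [hdilate]
    exact ((((hasDerivAt_id s).const_sub τ).smul_const _).const_add _).congr_deriv (by simp)
  have hshear := (hasFDerivAt_shear_prod ha s
    (((x, 0) : Phase d) + dilate (τ - s) w)).comp_hasDerivAt s ((hasDerivAt_id s).prodMk hpath)
  refine (hshear.mul_const (v (x + w.1))).congr_deriv ?_
  simp only [add_apply, ContinuousLinearMap.comp_apply, ContinuousLinearMap.smulRight_apply,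
    ContinuousLinearMap.coe_snd', ContinuousLinearMap.coe_fst', one_smul, map_neg,
    fderiv_fst_eq_sum, partialX_shear ha]
  simp only [quantAmpDeriv, quantAmp, add_mul, neg_mul, Finset.sum_mul, mul_assoc, smul_eq_mul]
  ring

lemma isAmplitude_quantAmpDeriv (ha : IsUnifSymbol m a) (x : Conf d) (v : 𝓢(Conf d, ℂ))
    (τ s : ℝ) : IsAmplitude (1 + peetreOrder m) (quantAmpDeriv x v τ a s) :=
  (((ha.mixedOp.shear s).quantAmp x v _).mono (by omega)).add <|
    (IsAmplitude.sum _ fun j _ =>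
      isAmplitude_coord_mul (((ha.partialX j).shear s).quantAmp x v _) j).const_smul (-1)

/-- Integration by parts turns the factors `z_j` of the second term of the derivative into
`D_{ζ_j}`, which reproduces the first term. -/
lemma osc_quantAmpDeriv (ha : IsUnifSymbol m a) (x : Conf d) (v : 𝓢(Conf d, ℂ)) (τ s : ℝ) :
    osc (quantAmpDeriv x v τ a s) = 0 := by
  have hX (j : Fin d) := ((ha.partialX j).shear s).quantAmp x v (τ - s)
  have hXXi (j : Fin d) := ((((ha.partialX j).partialXi j).shear s).quantAmp x v
    (τ - s)).const_smul (-Complex.I)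
  have hsum := IsAmplitude.sum Finset.univ fun j _ => isAmplitude_coord_mul (hX j) j
  have hparts : osc (quantAmp x v (τ - s) (shear s (mixedOp a))) =
      osc fun w => ∑ j, ((w.1 j : ℝ) : ℂ) * quantAmp x v (τ - s) (shear s (partialX j a)) w := by
    have hfirst : quantAmp x v (τ - s) (shear s (mixedOp a)) = fun w => ∑ j, -Complex.I •
        quantAmp x v (τ - s) (shear s (partialXi j (partialX j a))) w := by
      ext w
      simp only [quantAmp, shear_mixedOp ha, Finset.sum_mul, mul_assoc, smul_eq_mul]
    rw [hfirst, osc_sum _ fun j _ => hXXi j, osc_sum _ fun j _ => isAmplitude_coord_mul (hX j) j]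
    refine Finset.sum_congr rfl fun j _ => ?_
    rw [osc_coord_mul (hX j) j]
    simp only [fderiv_quantAmp_dirXi ((ha.partialX j).shear s).differentiable,
      partialXi_shear (ha.partialX j), smul_eq_mul]
  have hfirst := ((ha.mixedOp.shear s).quantAmp x v (τ - s)).mono
    (q := 1 + peetreOrder m) (by omega)
  unfold quantAmpDeriv
  rw [osc_add hfirst (hsum.const_smul (-1)), osc_smul _ hsum, hparts, neg_one_smul,
    add_neg_cancel]

lemma exists_derivBound_quantAmp_shear (ha : IsUnifSymbol m a) (x : Conf d) (v : 𝓢(Conf d, ℂ))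
    (N : ℕ) (hR : 1 ≤ R) : ∃ C, ∀ s t : ℝ, |s| ≤ R → |t| ≤ R →
      DerivBound N (growth (peetreOrder m) C) (quantAmp x v t (shear s a)) := by
  obtain ⟨C, hC⟩ := ha (oscOrder d (peetreOrder m) + N)
  obtain ⟨C', hC'⟩ := isAmplitude_schwartz_comp_fst v x N
  exact ⟨_, fun s t hs ht => DerivBound.growth_bilin (ContinuousLinearMap.mul ℝ ℂ)
    ((hC.shear ha hR hs).comp_symbol (x, 0) hR (norm_dilate_le hR ht)) hC'⟩

lemma exists_derivBound_quantAmpDeriv (ha : IsUnifSymbol m a) (x : Conf d) (v : 𝓢(Conf d, ℂ))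
    (τ : ℝ) (N : ℕ) (hR : 1 ≤ R) : ∃ C, ∀ s : ℝ, |s| ≤ R → |τ - s| ≤ R →
      DerivBound N (growth (1 + peetreOrder m) C) (quantAmpDeriv x v τ a s) := by
  let coord (j : Fin d) : Phase d →L[ℝ] ℂ :=
    Complex.ofRealCLM ∘L EuclideanSpace.proj j ∘L ContinuousLinearMap.fst ℝ (Conf d) (Conf d)
  obtain ⟨C, hC⟩ := exists_derivBound_quantAmp_shear ha.mixedOp x v N hR
  choose C₁ hC₁ using fun j => exists_derivBound_quantAmp_shear (ha.partialX j) x v N hR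
  choose C₂ hC₂ using fun j => isAmplitude_clm (coord j) N
  exact ⟨_, fun s hs hτ => ((hC s (τ - s) hs hτ).growth_mono (Nat.le_add_left _ 1)).growth_add <|
    (DerivBound.growth_sum Finset.univ fun j _ =>
      (hC₂ j).growth_bilin (ContinuousLinearMap.mul ℝ ℂ) (hC₁ j s (τ - s) hs hτ)).growth_clm
        ((-1 : ℂ) • ContinuousLinearMap.id ℝ ℂ)⟩

lemma hasDerivAt_osc_quantAmp_shear (ha : IsUnifSymbol m a) (x : Conf d) (v : 𝓢(Conf d, ℂ))
    (τ s : ℝ) : HasDerivAt (fun s => osc (quantAmp x v (τ - s) (shear s a))) 0 s := by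
  have hR : 1 ≤ |τ| + (|s| + 1) := by linarith [abs_nonneg s, abs_nonneg τ]
  obtain ⟨C, hC⟩ := exists_derivBound_quantAmp_shear ha x v (oscOrder d (peetreOrder m)) hR
  obtain ⟨C', hC'⟩ :=
    exists_derivBound_quantAmpDeriv ha x v τ (oscOrder d (1 + peetreOrder m)) hR
  have hτ {t : ℝ} (ht : |t| < |s| + 1) : |τ - t| ≤ |τ| + (|s| + 1) :=
    (abs_sub τ t).trans (by gcongr)
  have ht' {t : ℝ} (ht : |t| < |s| + 1) : |t| ≤ |τ| + (|s| + 1) := by linarith [abs_nonneg τ]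
  rw [← osc_quantAmpDeriv ha x v τ s]
  exact hasDerivAt_osc (isOpen_lt continuous_abs continuous_const) (lt_add_one |s|)
    (fun t ht => hC t (τ - t) (ht' ht) (hτ ht)) (fun t ht => hC' t (ht' ht) (hτ ht))
    (isAmplitude_quantAmpDeriv ha x v τ s) fun t _ => hasDerivAt_quantAmp_shear ha x v τ t

lemma osc_quantAmp_shear (ha : IsUnifSymbol m a) (x : Conf d) (v : 𝓢(Conf d, ℂ)) (τ c : ℝ) :
    osc (quantAmp x v (τ - c) (shear c a)) = osc (quantAmp x v τ a) := by
  have hderiv := hasDerivAt_osc_quantAmp_shear ha x v τ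
  have h := is_const_of_deriv_eq_zero (fun s => (hderiv s).differentiableAt)
    (fun s => (hderiv s).deriv) c 0
  simpa only [sub_zero, shear_zero ha] using h

end Quantization

/-! ### Left quantization on the Schwartz space -/

section SeminormBound

variable {E X ι : Type*} [AddCommGroup E] [Module ℝ E] [TopologicalSpace E]
  {g : X → ℝ} {Φ Ψ : E → X → ℝ}

/-- `Φ u x` is bounded by a continuous seminorm of `u` times the weight `g x`. -/
def SeminormBound (g : X → ℝ) (Φ : E → X → ℝ) : Prop :=
  ∃ q : Seminorm ℝ E, Continuous q ∧ ∀ u x, Φ u x ≤ q u * g x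

lemma exists_seminorm_eq_const_mul {q : Seminorm ℝ E} (hq : Continuous q) {c : ℝ}
    (hc : 0 ≤ c) : ∃ q' : Seminorm ℝ E, Continuous q' ∧ ∀ u, q' u = c * q u :=
  ⟨c.toNNReal • q, hq.const_smul c.toNNReal, fun u => by
    rw [smul_apply, NNReal.smul_def, Real.coe_toNNReal c hc, smul_eq_mul]⟩

namespace SeminormBound

lemma mono (h : SeminormBound g Φ) (hle : ∀ u x, Ψ u x ≤ Φ u x) : SeminormBound g Ψ :=
  let ⟨q, hq, hb⟩ := h
  ⟨q, hq, fun u x => (hle u x).trans (hb u x)⟩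

lemma add (h : SeminormBound g Φ) (h' : SeminormBound g Ψ) :
    SeminormBound g (fun u x => Φ u x + Ψ u x) := by
  obtain ⟨q, hq, hb⟩ := h
  obtain ⟨r, hr, hc⟩ := h'
  refine ⟨q + r, hq.add hr, fun u x => ?_⟩
  rw [add_apply, add_mul]
  exact add_le_add (hb u x) (hc u x)

lemma const_mul (h : SeminormBound g Φ) {c : ℝ} (hc : 0 ≤ c) :
    SeminormBound g (fun u x => c * Φ u x) := by
  obtain ⟨q, hq, hb⟩ := h
  obtain ⟨q', hq', hcq⟩ := exists_seminorm_eq_const_mul hq hc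
  refine ⟨q', hq', fun u x => ?_⟩
  rw [hcq, mul_assoc]
  exact mul_le_mul_of_nonneg_left (hb u x) hc

lemma sum (s : Finset ι) {Φ : ι → E → X → ℝ} (h : ∀ i ∈ s, SeminormBound g (Φ i)) :
    SeminormBound g (fun u x => ∑ i ∈ s, Φ i u x) := by
  classical
  induction s using Finset.induction_on with
  | empty => exact ⟨0, continuous_const, fun u x => by simp⟩
  | insert i s hi ih =>
    simp only [Finset.sum_insert hi]
    exact (h i (s.mem_insert_self i)).add (ih fun j hj => h j (Finset.mem_insert_of_mem hj))

lemma comp (h : SeminormBound g Φ) (T : E →L[ℝ] E) : SeminormBound g (fun u x => Φ (T u) x) :=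
  let ⟨q, hq, hb⟩ := h
  ⟨q.comp T.toLinearMap, hq.comp T.continuous, fun u x => hb (T u) x⟩

end SeminormBound

lemma exists_seminorm_derivBound {E V : Type*} [NormedAddCommGroup E] [NormedSpace ℝ E]
    [NormedAddCommGroup V] [NormedSpace ℝ V] (P N : ℕ) :
    ∃ q : Seminorm ℝ 𝓢(E, V), Continuous q ∧
      ∀ u : 𝓢(E, V), DerivBound N (fun y => q u * ((1 + ‖y‖) ^ P)⁻¹) u := by
  obtain ⟨q, hq, h⟩ := exists_seminorm_eq_const_mul
    ((schwartz_withSeminorms ℝ E V).finset_sups.continuous_seminorm (Finset.Iic (P, N)))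
    (pow_nonneg zero_le_two P)
  refine ⟨q, hq, fun u => ?_⟩
  rw [h]
  exact derivBound_schwartz P N u

end SeminormBound

lemma exists_derivBound_of_hasTemperateGrowth {E V : Type*} [NormedAddCommGroup E]
    [NormedSpace ℝ E] [NormedAddCommGroup V] [NormedSpace ℝ V] {f : E → V}
    (hf : f.HasTemperateGrowth) (N : ℕ) : ∃ P C, DerivBound N (growth P C) f :=
  let ⟨P, C, _, h⟩ := hf.norm_iteratedFDeriv_le_uniform N
  ⟨P, C, hf.1, h⟩

lemma hasTemperateGrowth_fderiv {E V : Type*} [NormedAddCommGroup E]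
    [NormedSpace ℝ E] [NormedAddCommGroup V] [NormedSpace ℝ V] {f : E → V}
    (hf : f.HasTemperateGrowth) : (fderiv ℝ f).HasTemperateGrowth := by
  refine ⟨hf.1.fderiv_right (by simp), fun n => ?_⟩
  simpa only [norm_iteratedFDeriv_fderiv] using hf.2 (n + 1)

lemma hasTemperateGrowth_fderiv_apply {E V : Type*} [NormedAddCommGroup E]
    [NormedSpace ℝ E] [NormedAddCommGroup V] [NormedSpace ℝ V] {f : E → V}
    (hf : f.HasTemperateGrowth) (v : E) :
    (fun x => fderiv ℝ f x v).HasTemperateGrowth :=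
  (ContinuousLinearMap.apply ℝ V v).hasTemperateGrowth.comp (hasTemperateGrowth_fderiv hf)

section LeftQuantization

open scoped LineDeriv

variable {d N P : ℕ} {m C C' : ℝ} {k b : Phase d → ℂ}

/-- The amplitude `(x, z, ζ) ↦ k(x, z) b(x, ζ) u(x + z)` of the left quantization of `b` with
kernel factor `k`, applied to `u`. -/
def leftAmp (k b : Phase d → ℂ) (u : 𝓢(Conf d, ℂ)) (p : Conf d × Phase d) : ℂ :=
  k (p.1, p.2.1) * (b (p.1, p.2.2) * u (p.1 + p.2.1))

/-- The left quantization of `b` with kernel factor `k`, applied to `u`. -/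
def leftOp (k b : Phase d → ℂ) (u : 𝓢(Conf d, ℂ)) (x : Conf d) : ℂ :=
  osc fun w => leftAmp k b u (x, w)

lemma one_add_norm_le_mul {E F : Type*} [SeminormedAddCommGroup E] [SeminormedAddCommGroup F]
    (p : E × F) : 1 + ‖p‖ ≤ (1 + ‖p.1‖) * (1 + ‖p.2‖) := by
  have hle : ‖p‖ ≤ ‖p.1‖ + ‖p.2‖ := max_le
    (le_add_of_nonneg_right (norm_nonneg _)) (le_add_of_nonneg_left (norm_nonneg _))
  linarith [mul_nonneg (norm_nonneg p.1) (norm_nonneg p.2)]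

lemma one_add_norm_pair_le (x z : Conf d) :
    1 + ‖((x, z) : Phase d)‖ ≤ (1 + ‖x‖) * (1 + ‖x + z‖) := by
  have hz : ‖z‖ ≤ ‖x + z‖ + ‖x‖ := by simpa using norm_sub_le (x + z) x
  have hxz := mul_nonneg (norm_nonneg x) (norm_nonneg (x + z))
  have hle : ‖((x, z) : Phase d)‖ ≤ ‖x + z‖ + ‖x‖ :=
    max_le (le_add_of_nonneg_left (norm_nonneg _)) hz
  linarith

lemma exists_seminorm_derivBound_leftAmp (hk : DerivBound N (growth P C) k)
    (hb : DerivBound N (symbolWeight m C') b) :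
    ∃ q : Seminorm ℝ 𝓢(Conf d, ℂ), Continuous q ∧ ∀ u, DerivBound N
      (fun p => growth (peetreOrder m) (q u * (1 + ‖p.1‖) ^ (P + peetreOrder m)) p.2)
      (leftAmp k b u) := by
  let fx := ContinuousLinearMap.fst ℝ (Conf d) (Phase d)
  let fz := ContinuousLinearMap.fst ℝ (Conf d) (Conf d) ∘L ContinuousLinearMap.snd ℝ (Conf d) _
  let fζ := ContinuousLinearMap.snd ℝ (Conf d) (Conf d) ∘L ContinuousLinearMap.snd ℝ (Conf d) _
  let M := ContinuousLinearMap.mul ℝ ℂ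
  have hz (p : Conf d × Phase d) : ‖p.2.1‖ ≤ ‖p‖ := (norm_fst_le p.2).trans (norm_snd_le p)
  have hζ (p : Conf d × Phase d) : ‖p.2.2‖ ≤ ‖p‖ := (norm_snd_le p.2).trans (norm_snd_le p)
  have hxz : ‖fx.prod fz‖ ≤ 1 := ContinuousLinearMap.opNorm_le_bound _ zero_le_one fun p =>
    (max_le (norm_fst_le p) (hz p)).trans_eq (one_mul _).symm
  have hxζ : ‖fx.prod fζ‖ ≤ 1 := ContinuousLinearMap.opNorm_le_bound _ zero_le_one fun p =>
    (max_le (norm_fst_le p) (hζ p)).trans_eq (one_mul _).symm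
  have hadd : ‖fx + fz‖ ≤ 2 := ContinuousLinearMap.opNorm_le_bound _ zero_le_two fun p =>
    (norm_add_le_of_le (norm_fst_le p) (hz p)).trans_eq (two_mul _).symm
  obtain ⟨q, hq, hu⟩ := exists_seminorm_derivBound (E := Conf d) (V := ℂ) P N
  have hC := hk.const_nonneg
  have hC' := hb.nonneg 0
  obtain ⟨q', hq', hqq⟩ := exists_seminorm_eq_const_mul hq (show
    0 ≤ ‖M‖ * (2 ^ N * (C * (‖M‖ * (2 ^ N * (symbolWeight m C' 0 * 2 ^ N))))) by positivity)
  refine ⟨q', hq', fun u => ?_⟩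
  have hprod := (hk.comp_affine 0 _ le_rfl hxz).bilin M
    ((hb.comp_symbol 0 le_rfl hxζ).bilin M ((hu u).comp_affine 0 _ one_le_two hadd))
  simp only [zero_add, one_pow, one_mul] at hprod
  refine hprod.mono fun p => ?_
  have hfz : (fx + fz) p = p.1 + p.2.1 := rfl
  have hne : (1 + ‖p.1 + p.2.1‖) ^ P ≠ 0 := by positivity
  rw [hfz]
  calc _ ≤ ‖M‖ * (2 ^ N * (C * ((1 + ‖p.1‖) * (1 + ‖p.1 + p.2.1‖)) ^ P *
        (‖M‖ * (2 ^ N * (symbolWeight m C' 0 * ((1 + ‖p.1‖) * (1 + ‖p.2‖)) ^ peetreOrder m *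
          (2 ^ N * (q u * ((1 + ‖p.1 + p.2.1‖) ^ P)⁻¹))))))) := by
        unfold growth
        gcongr
        · exact one_add_norm_pair_le p.1 p.2.1
        · exact one_add_norm_le_mul p
    _ = _ := by
        rw [growth, hqq, mul_pow, mul_pow, pow_add]
        field_simp

lemma DerivBound.growth_slice {V : Type*} [NormedAddCommGroup V] [NormedSpace ℝ V] {Q : ℕ}
    {K : Conf d → ℝ} {G : Conf d × Phase d → V}
    (h : DerivBound N (fun p => growth Q (K p.1) p.2) G) (x : Conf d) :
    DerivBound N (growth Q (K x)) (fun w => G (x, w)) := by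
  simpa using h.comp_affine (x, 0) (ContinuousLinearMap.inr ℝ (Conf d) (Phase d)) le_rfl
    (ContinuousLinearMap.norm_inr_le_one ℝ (Conf d) (Phase d))

lemma exists_derivBound_leftAmp (hk : k.HasTemperateGrowth) (hb : IsUnifSymbol m b)
    (u : 𝓢(Conf d, ℂ)) (N : ℕ) : ∃ Q K, 0 ≤ K ∧ DerivBound N
      (fun p => growth (peetreOrder m) (K * (1 + ‖p.1‖) ^ Q) p.2) (leftAmp k b u) := by
  obtain ⟨P, C, hC⟩ := exists_derivBound_of_hasTemperateGrowth hk N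
  obtain ⟨C', hC'⟩ := hb N
  obtain ⟨q, -, h⟩ := exists_seminorm_derivBound_leftAmp hC hC'
  exact ⟨_, q u, apply_nonneg q u, h u⟩

lemma isAmplitude_leftAmp (hk : k.HasTemperateGrowth) (hb : IsUnifSymbol m b)
    (u : 𝓢(Conf d, ℂ)) (x : Conf d) :
    IsAmplitude (peetreOrder m) (fun w => leftAmp k b u (x, w)) := fun N =>
  let ⟨Q, K, _, h⟩ := exists_derivBound_leftAmp hk hb u N
  ⟨_, h.growth_slice (K := fun x => K * (1 + ‖x‖) ^ Q) x⟩

lemma isAmplitude_fderiv_leftAmp (hk : k.HasTemperateGrowth) (hb : IsUnifSymbol m b)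
    (u : 𝓢(Conf d, ℂ)) (x : Conf d) :
    IsAmplitude (peetreOrder m) (fun w => fderiv ℝ (leftAmp k b u) (x, w)) := fun N =>
  let ⟨Q, K, _, h⟩ := exists_derivBound_leftAmp hk hb u (N + 1)
  ⟨_, h.fderiv.growth_slice (K := fun x => K * (1 + ‖x‖) ^ Q) x⟩

lemma contDiff_leftAmp (hk : k.HasTemperateGrowth) (hb : IsUnifSymbol m b)
    (u : 𝓢(Conf d, ℂ)) : ContDiff ℝ ∞ (leftAmp k b u) :=
  let ⟨_, _, _, h⟩ := exists_derivBound_leftAmp hk hb u 0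
  h.1

lemma seminormBound_leftOp (hk : DerivBound (oscOrder d (peetreOrder m)) (growth P C) k)
    (hb : IsUnifSymbol m b) : SeminormBound (fun x : Conf d => (1 + ‖x‖) ^ (P + peetreOrder m))
      (fun u x => ‖leftOp k b u x‖) := by
  obtain ⟨C', hC'⟩ := hb (oscOrder d (peetreOrder m))
  obtain ⟨q, hq, h⟩ := exists_seminorm_derivBound_leftAmp hk hC'
  refine (SeminormBound.const_mul ⟨q, hq, fun u x => le_rfl⟩
    (abs_nonneg (oscConst d (peetreOrder m)))).mono fun u x => ?_
  refine (norm_osc_le ((h u).growth_slice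
    (K := fun x => q u * (1 + ‖x‖) ^ (P + peetreOrder m)) x)).trans ?_
  gcongr
  exact le_abs_self _

lemma hasFDerivAt_leftAmp_left (hk : k.HasTemperateGrowth) (hb : IsUnifSymbol m b)
    (u : 𝓢(Conf d, ℂ)) (y : Conf d) (w : Phase d) :
    HasFDerivAt (fun y => leftAmp k b u (y, w)) (fderiv ℝ (leftAmp k b u) (y, w) ∘L
      ContinuousLinearMap.inl ℝ (Conf d) (Phase d)) y :=
  HasFDerivAt.comp (g := leftAmp k b u) (f := fun y => (y, w)) y
    ((contDiff_leftAmp hk hb u).differentiable (by simp) (y, w)).hasFDerivAt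
    (hasFDerivAt_prodMk_left y w)

lemma DerivBound.growth_precomp {E E' V : Type*} [NormedAddCommGroup E] [NormedSpace ℝ E]
    [NormedAddCommGroup E'] [NormedSpace ℝ E'] [NormedAddCommGroup V] [NormedSpace ℝ V]
    {F : Phase d → E →L[ℝ] V} (h : DerivBound N (growth P C) F) (L : E' →L[ℝ] E) :
    DerivBound N (growth P (‖(ContinuousLinearMap.compL ℝ E' E V).flip L‖ * C))
      (fun w => F w ∘L L) :=
  h.growth_clm ((ContinuousLinearMap.compL ℝ E' E V).flip L)

lemma hasFDerivAt_leftOp (hk : k.HasTemperateGrowth) (hb : IsUnifSymbol m b)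
    (u : 𝓢(Conf d, ℂ)) (x : Conf d) :
    HasFDerivAt (leftOp k b u) (osc fun w => fderiv ℝ (leftAmp k b u) (x, w) ∘L
      ContinuousLinearMap.inl ℝ (Conf d) (Phase d)) x := by
  obtain ⟨Q, K, hK, h⟩ :=
    exists_derivBound_leftAmp hk hb u (oscOrder d (peetreOrder m) + 1)
  have hle {y : Conf d} (hy : y ∈ Metric.ball x 1) (w : Phase d) :
      growth (peetreOrder m) (K * (1 + ‖y‖) ^ Q) w ≤
        growth (peetreOrder m) (K * (2 + ‖x‖) ^ Q) w := by
    unfold growth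
    gcongr ?_ * (?_) ^ Q * _
    linarith [norm_lt_of_mem_ball hy]
  have hF (y) (hy : y ∈ Metric.ball x 1) := ((h.mono_order (Nat.le_succ _)).growth_slice
    (K := fun x => K * (1 + ‖x‖) ^ Q) y).mono (hle hy)
  have hF' (y) (hy : y ∈ Metric.ball x 1) := ((h.fderiv.growth_slice
    (K := fun x => K * (1 + ‖x‖) ^ Q) y).mono (hle hy)).growth_precomp
    (ContinuousLinearMap.inl ℝ (Conf d) (Phase d))
  have hosc := hasFDerivAt_osc Metric.isOpen_ball (Metric.mem_ball_self one_pos) hF hF'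
    fun y _ w => hasFDerivAt_leftAmp_left hk hb u y w
  exact hosc

lemma fderiv_leftAmp (hk : Differentiable ℝ k) (hb : Differentiable ℝ b) (u : 𝓢(Conf d, ℂ))
    (v : Conf d) (p : Conf d × Phase d) : fderiv ℝ (leftAmp k b u) p (v, 0) =
      leftAmp (fun q => fderiv ℝ k q (v, 0)) b u p +
        (leftAmp k (fun q => fderiv ℝ b q (v, 0)) u p + leftAmp k b (∂_{v} u) p) := by
  have hk' : HasFDerivAt (fun p : Conf d × Phase d => k (p.1, p.2.1)) _ p :=
    (hk _).hasFDerivAt.comp p (hasFDerivAt_fst.prodMk (hasFDerivAt_fst.comp p hasFDerivAt_snd))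
  have hb' : HasFDerivAt (fun p : Conf d × Phase d => b (p.1, p.2.2)) _ p :=
    (hb _).hasFDerivAt.comp p (hasFDerivAt_fst.prodMk (hasFDerivAt_snd.comp p hasFDerivAt_snd))
  have hu' : HasFDerivAt (fun p : Conf d × Phase d => u (p.1 + p.2.1)) _ p :=
    (u.hasFDerivAt _).comp p (hasFDerivAt_fst.add (hasFDerivAt_fst.comp p hasFDerivAt_snd))
  have h : HasFDerivAt (leftAmp k b u) _ p := hk'.mul (hb'.mul hu')
  rw [h.fderiv]
  simp only [ContinuousLinearMap.comp_add, smul_add, add_apply, smul_apply,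
    ContinuousLinearMap.comp_apply, ContinuousLinearMap.coe_fst', ContinuousLinearMap.coe_snd',
    ContinuousLinearMap.prod_apply, smul_eq_mul, map_zero, mul_zero, add_zero, leftAmp,
    SchwartzMap.lineDerivOp_apply_eq_fderiv]
  ring

lemma fderiv_leftAmp_dirXi (hk : Differentiable ℝ k) (hb : Differentiable ℝ b)
    (u : 𝓢(Conf d, ℂ)) (j : Fin d) (x : Conf d) (w : Phase d) :
    fderiv ℝ (fun w => leftAmp k b u (x, w)) w (dirXi j) = leftAmp k (partialXi j b) u (x, w) := by
  have hk' : HasFDerivAt (fun w : Phase d => k (x, w.1)) _ w :=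
    (hk _).hasFDerivAt.comp w ((hasFDerivAt_const x w).prodMk hasFDerivAt_fst)
  have hb' : HasFDerivAt (fun w : Phase d => b (x, w.2)) _ w :=
    (hb _).hasFDerivAt.comp w ((hasFDerivAt_const x w).prodMk hasFDerivAt_snd)
  have hu' : HasFDerivAt (fun w : Phase d => u (x + w.1)) _ w :=
    (u.hasFDerivAt _).comp w (hasFDerivAt_fst.const_add x)
  have h : HasFDerivAt (fun w => leftAmp k b u (x, w)) _ w := hk'.mul (hb'.mul hu')
  rw [h.fderiv]
  have h0 : fderiv ℝ k (x, w.1) ((0 : Conf d), (0 : Conf d)) = 0 := map_zero _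
  simp [leftAmp, partialXi, dirXi, h0, mul_comm]

lemma fderiv_leftOp (hk : k.HasTemperateGrowth) (hb : IsUnifSymbol m b) (u : 𝓢(Conf d, ℂ))
    (v x : Conf d) : fderiv ℝ (leftOp k b u) x v =
      leftOp (fun q => fderiv ℝ k q (v, 0)) b u x +
        (leftOp k (fun q => fderiv ℝ b q (v, 0)) u x + leftOp k b (∂_{v} u) x) := by
  have hamp := isAmplitude_fderiv_leftAmp hk hb u x
  have hkv := isAmplitude_leftAmp (hasTemperateGrowth_fderiv_apply hk (v, 0)) hb u x
  have hbv := isAmplitude_leftAmp hk (hb.fderiv_apply (v, 0)) u x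
  have huv := isAmplitude_leftAmp hk hb (∂_{v} u) x
  let restr : ((Conf d × Phase d) →L[ℝ] ℂ) →L[ℝ] (Conf d →L[ℝ] ℂ) :=
    (ContinuousLinearMap.compL ℝ (Conf d) (Conf d × Phase d) ℂ).flip
      (ContinuousLinearMap.inl ℝ (Conf d) (Phase d))
  have happly := osc_clm (evalCLM ℂ v) (hamp.clm restr)
  rw [(hasFDerivAt_leftOp hk hb u x).fderiv]
  refine happly.symm.trans ?_
  have hderiv (w : Phase d) := fderiv_leftAmp (hk.1.differentiable (by simp)) hb.differentiable u v
    (x, w)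
  exact (congrArg osc (funext hderiv)).trans
    ((osc_add hkv (hbv.add huv)).trans (congrArg _ (osc_add hbv huv)))

lemma contDiff_leftOp (hk : k.HasTemperateGrowth) (hb : IsUnifSymbol m b) (u : 𝓢(Conf d, ℂ)) :
    ContDiff ℝ ∞ (leftOp k b u) := by
  refine contDiff_infty.2 fun n => ?_
  induction n generalizing k b u with
  | zero =>
    exact contDiff_zero.2 (continuous_iff_continuousAt.2 fun x =>
      (hasFDerivAt_leftOp hk hb u x).continuousAt)
  | succ n ih =>
    push_cast
    refine contDiff_succ_iff_fderiv_apply.2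
      ⟨fun x => (hasFDerivAt_leftOp hk hb u x).differentiableAt, by simp, fun v => ?_⟩
    simp only [fderiv_leftOp hk hb u v]
    exact (ih (hasTemperateGrowth_fderiv_apply hk (v, 0)) hb u).add
      ((ih hk (hb.fderiv_apply (v, 0)) u).add (ih hk hb _))

lemma coord_mul_leftOp (hk : k.HasTemperateGrowth) (hb : IsUnifSymbol m b) (u : 𝓢(Conf d, ℂ))
    (x : Conf d) (j : Fin d) : (x j : ℂ) * leftOp k b u x =
      leftOp k b (SchwartzMap.smulLeftCLM ℂ (fun y : Conf d => y j) u) x +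
        Complex.I * leftOp k (partialXi j b) u x := by
  have hamp := isAmplitude_leftAmp hk hb u x
  have hxi := osc_coord_mul hamp j
  simp only [fderiv_leftAmp_dirXi (hk.1.differentiable (by simp)) hb.differentiable] at hxi
  have hsplit (w : Phase d) :
      (x j : ℂ) • leftAmp k b u (x, w) + (w.1 j : ℂ) * leftAmp k b u (x, w) =
        leftAmp k b (SchwartzMap.smulLeftCLM ℂ (fun y : Conf d => y j) u) (x, w) := by
    have hj : (fun y : Conf d => y j).HasTemperateGrowth :=
      (EuclideanSpace.proj (𝕜 := ℝ) j : Conf d →L[ℝ] ℝ).hasTemperateGrowth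
    simp only [leftAmp, SchwartzMap.smulLeftCLM_apply_apply hj, PiLp.add_apply, Complex.real_smul,
      smul_eq_mul]
    push_cast
    ring
  have hadd := osc_add ((hamp.const_smul (x j : ℂ)).mono (Nat.le_add_left _ 1))
    (isAmplitude_coord_mul hamp j)
  simp only [hsplit] at hadd
  simp only [← smul_eq_mul (-Complex.I)] at hxi
  rw [hxi, osc_smul _ hamp, osc_smul _ (isAmplitude_leftAmp hk (hb.partialXi j) u x)] at hadd
  simp only [leftOp, smul_eq_mul] at hadd ⊢
  rw [hadd]
  ring

lemma norm_le_sum_abs (x : Conf d) : ‖x‖ ≤ ∑ j, |x j| := by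
  conv_lhs => rw [← (EuclideanSpace.basisFun (Fin d) ℝ).sum_repr x]
  exact norm_sum_le_of_le _ fun j _ => by simp [norm_smul]

lemma seminormBound_pow_mul_leftOp (hk : DerivBound (oscOrder d (peetreOrder m)) (growth P C) k)
    (hk' : k.HasTemperateGrowth) (hb : IsUnifSymbol m b) (n : ℕ) :
    SeminormBound (fun x : Conf d => (1 + ‖x‖) ^ (P + peetreOrder m))
      (fun u x => ‖x‖ ^ n * ‖leftOp k b u x‖) := by
  induction n generalizing b with
  | zero => simpa only [pow_zero, one_mul] using seminormBound_leftOp hk hb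
  | succ n ih =>
    refine (SeminormBound.sum Finset.univ fun j _ => ((ih hb).comp
      (SchwartzMap.smulLeftCLM ℂ (fun y : Conf d => y j))).add (ih (hb.partialXi j))).mono
      fun u x => ?_
    calc ‖x‖ ^ (n + 1) * ‖leftOp k b u x‖ = ‖x‖ ^ n * (‖x‖ * ‖leftOp k b u x‖) := by ring
      _ ≤ ‖x‖ ^ n * ((∑ j, |x j|) * ‖leftOp k b u x‖) := by
        gcongr
        exact norm_le_sum_abs x
      _ = ∑ j, ‖x‖ ^ n * ‖(x j : ℂ) * leftOp k b u x‖ := by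
        simp [Finset.sum_mul, Finset.mul_sum]
      _ ≤ _ := by
        refine Finset.sum_le_sum fun j _ => ?_
        rw [coord_mul_leftOp hk' hb u x j, ← mul_add]
        gcongr
        refine (norm_add_le _ _).trans_eq ?_
        simp

lemma seminormBound_one_leftOp (hk : k.HasTemperateGrowth) (hb : IsUnifSymbol m b) (n : ℕ) :
    SeminormBound (fun _ => 1) (fun u x => ‖x‖ ^ n * ‖leftOp k b u x‖) := by
  obtain ⟨P, C, hC⟩ := exists_derivBound_of_hasTemperateGrowth hk (oscOrder d (peetreOrder m))
  let r := P + peetreOrder m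
  obtain ⟨q, hq, h⟩ := ((seminormBound_pow_mul_leftOp hC hk hb n).add
    (seminormBound_pow_mul_leftOp hC hk hb (n + r))).const_mul (pow_nonneg zero_le_two r)
  refine ⟨q, hq, fun u x => ?_⟩
  refine le_of_mul_le_mul_right ?_ (show 0 < (1 + ‖x‖) ^ r by positivity)
  calc ‖x‖ ^ n * ‖leftOp k b u x‖ * (1 + ‖x‖) ^ r
      ≤ ‖x‖ ^ n * ‖leftOp k b u x‖ * (2 ^ r * (1 + ‖x‖ ^ r)) := by
        gcongr
        exact one_add_pow_le (norm_nonneg x) r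
    _ = 2 ^ r * (‖x‖ ^ n * ‖leftOp k b u x‖ + ‖x‖ ^ (n + r) * ‖leftOp k b u x‖) := by ring
    _ ≤ q u * 1 * (1 + ‖x‖) ^ r := by rw [mul_one]; exact h u x

lemma norm_iteratedFDeriv_succ_le_sum {E V ι : Type*} [NormedAddCommGroup E] [NormedSpace ℝ E]
    [NormedAddCommGroup V] [NormedSpace ℝ V] [FiniteDimensional ℝ E] [Fintype ι]
    (e : Module.Basis ι ℝ E) {n : ℕ} {f : E → V} (hf : ContDiff ℝ (n + 1) f) (x : E) :
    ‖iteratedFDeriv ℝ (n + 1) f x‖ ≤ ∑ i, ‖LinearMap.toContinuousLinearMap (e.coord i)‖ *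
      ‖iteratedFDeriv ℝ n (fun y => fderiv ℝ f y (e i)) x‖ := by
  let form (i : ι) : V →L[ℝ] E →L[ℝ] V := ContinuousLinearMap.smulRightL ℝ E V
    (LinearMap.toContinuousLinearMap (e.coord i))
  have hi (i : ι) : ContDiff ℝ n (fun y => fderiv ℝ f y (e i)) :=
    (contDiff_succ_iff_fderiv_apply.1 hf).2.2 (e i)
  have hsum : fderiv ℝ f = fun y => ∑ i, form i (fderiv ℝ f y (e i)) := by
    funext y
    ext v
    conv_lhs => rw [← e.sum_repr v, map_sum]
    simp [form]
  rw [← norm_iteratedFDeriv_fderiv]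
  have hderiv : iteratedFDeriv ℝ n (fderiv ℝ f) x =
      ∑ i, iteratedFDeriv ℝ n (fun y => form i (fderiv ℝ f y (e i))) x :=
    (congrArg (iteratedFDeriv ℝ n · x) hsum).trans
      (iteratedFDeriv_fun_sum_apply fun i _ => ((form i).contDiff.comp (hi i)).contDiffAt)
  rw [hderiv]
  refine norm_sum_le_of_le _ fun i _ => ?_
  refine ((form i).norm_iteratedFDeriv_comp_left (hi i).contDiffAt le_rfl).trans ?_
  gcongr
  exact ContinuousLinearMap.opNorm_le_bound _ (norm_nonneg _) fun c =>
    (ContinuousLinearMap.norm_smulRight_apply _ c).le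

lemma seminormBound_iteratedFDeriv_leftOp (N : ℕ) (hk : k.HasTemperateGrowth)
    (hb : IsUnifSymbol m b) (n : ℕ) :
    SeminormBound (fun _ => 1) (fun u x => ‖x‖ ^ n * ‖iteratedFDeriv ℝ N (leftOp k b u) x‖) := by
  induction N generalizing k b with
  | zero => simpa only [norm_iteratedFDeriv_zero] using seminormBound_one_leftOp hk hb n
  | succ N ih =>
    let e := (EuclideanSpace.basisFun (Fin d) ℝ).toBasis
    let c (j : Fin d) : ℝ := ‖LinearMap.toContinuousLinearMap (e.coord j)‖
    have hj (j : Fin d) := ((ih (hasTemperateGrowth_fderiv_apply hk (e j, 0)) hb).add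
      ((ih hk (hb.fderiv_apply (e j, 0))).add ((ih hk hb).comp
        (LineDeriv.lineDerivOpCLM ℝ 𝓢(Conf d, ℂ) (e j))))).const_mul (c := c j) (norm_nonneg _)
    refine (SeminormBound.sum Finset.univ fun j _ => hj j).mono fun u x => ?_
    have hsmooth {k b : Phase d → ℂ} (hk : k.HasTemperateGrowth) (hb : IsUnifSymbol m b)
        (u : 𝓢(Conf d, ℂ)) : ContDiffAt ℝ N (leftOp k b u) x :=
      (contDiff_infty.1 (contDiff_leftOp hk hb u) N).contDiffAt
    have hle := norm_iteratedFDeriv_succ_le_sum e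
      (contDiff_infty.1 (contDiff_leftOp hk hb u) (N + 1)) x
    refine (mul_le_mul_of_nonneg_left hle (by positivity)).trans ?_
    rw [Finset.mul_sum]
    refine Finset.sum_le_sum fun j _ => ?_
    rw [mul_left_comm, ← mul_add, ← mul_add]
    simp only [fderiv_leftOp hk hb u]
    refine mul_le_mul_of_nonneg_left (mul_le_mul_of_nonneg_left ?_ (by positivity)) (norm_nonneg _)
    have h1 := hsmooth (hasTemperateGrowth_fderiv_apply hk (e j, 0)) hb u
    have h2 := hsmooth hk (hb.fderiv_apply (e j, 0)) u
    have h3 := hsmooth hk hb (∂_{e j} u)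
    refine (congrArg norm (iteratedFDeriv_add_apply h1 (h2.add h3))).trans_le ?_
    refine norm_add_le_of_le le_rfl ?_
    exact (congrArg norm (iteratedFDeriv_add_apply h2 h3)).trans_le (norm_add_le _ _)

/-- The left quantization of `b` with kernel factor `k`, as a continuous operator on the Schwartz
space. -/
def leftOpCLM (hk : k.HasTemperateGrowth) (hb : IsUnifSymbol m b) :
    𝓢(Conf d, ℂ) →L[ℂ] 𝓢(Conf d, ℂ) :=
  SchwartzMap.mkCLM (σ := RingHom.id ℂ) (leftOp k b)
    (fun u v x => by
      rw [leftOp, leftOp, leftOp,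
        ← osc_add (isAmplitude_leftAmp hk hb u x) (isAmplitude_leftAmp hk hb v x)]
      simp only [leftAmp, add_apply, mul_add])
    (fun c u x => by
      rw [leftOp, leftOp, RingHom.id_apply, ← osc_smul c (isAmplitude_leftAmp hk hb u x)]
      simp only [leftAmp, smul_apply, smul_eq_mul, mul_left_comm c])
    (contDiff_leftOp hk hb)
    (fun n => by
      obtain ⟨q, hq, h⟩ := seminormBound_iteratedFDeriv_leftOp n.2 hk hb n.1
      obtain ⟨s, C, -, hs⟩ := Seminorm.bound_of_continuous
        (schwartz_withSeminorms ℝ (Conf d) ℂ) q hq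
      refine ⟨s, C, C.2, fun u x => (h u x).trans ?_⟩
      rw [mul_one]
      refine (hs u).trans_eq ?_
      change (C : ℝ) * _ = _
      congr 1
      rw [Seminorm.finset_sup_apply, Seminorm.finset_sup_apply]
      rfl)

lemma leftOpCLM_apply (hk : k.HasTemperateGrowth) (hb : IsUnifSymbol m b) (u : 𝓢(Conf d, ℂ))
    (x : Conf d) : leftOpCLM hk hb u x = osc fun w => leftAmp k b u (x, w) := rfl

end LeftQuantization

/-! ### The magnetic phase factor -/

section ParametricIntegral

universe u

variable {Q V : Type u} [NormedAddCommGroup Q] [NormedSpace ℝ Q] [NormedAddCommGroup V]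
  [NormedSpace ℝ V] {F : ℝ × Q → V}

/-- The derivative of `F : ℝ × Q → V` in the second variable. -/
def fderivSnd (F : ℝ × Q → V) (p : ℝ × Q) : Q →L[ℝ] V :=
  fderiv ℝ F p ∘L ContinuousLinearMap.inr ℝ ℝ Q

lemma hasTemperateGrowth_fderivSnd (hF : F.HasTemperateGrowth) :
    (fderivSnd F).HasTemperateGrowth :=
  ((ContinuousLinearMap.compL ℝ Q (ℝ × Q) V).flip
    (ContinuousLinearMap.inr ℝ ℝ Q)).hasTemperateGrowth.comp (hasTemperateGrowth_fderiv hF)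

lemma exists_norm_le_of_mem_unitInterval (hF : F.HasTemperateGrowth) :
    ∃ P C, 0 ≤ C ∧ ∀ s ∈ Set.uIoc (0 : ℝ) 1, ∀ q, ‖F (s, q)‖ ≤ growth P C q := by
  obtain ⟨P, C, h⟩ := exists_derivBound_of_hasTemperateGrowth hF 0
  have hC := h.const_nonneg
  refine ⟨P, C * 2 ^ P, by positivity, fun s hs q => (h.norm_le _).trans ?_⟩
  rw [Set.uIoc_of_le zero_le_one] at hs
  have hs1 : ‖s‖ ≤ 1 := by rw [Real.norm_of_nonneg hs.1.le]; exact hs.2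
  unfold growth
  rw [mul_assoc, ← mul_pow]
  gcongr
  refine (one_add_norm_le_mul (s, q)).trans ?_
  gcongr
  linarith

lemma hasFDerivAt_integral_unitInterval (hF : F.HasTemperateGrowth) (q : Q) :
    HasFDerivAt (fun q => ∫ s in (0 : ℝ)..1, F (s, q))
      (∫ s in (0 : ℝ)..1, fderivSnd F (s, q)) q := by
  have hF' := hasTemperateGrowth_fderivSnd hF
  obtain ⟨P, C, hC, h⟩ := exists_norm_le_of_mem_unitInterval hF'
  have hcont (y : Q) : Continuous fun s : ℝ => F (s, y) := hF.1.continuous.comp (by fun_prop)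
  have hcont' : Continuous fun s : ℝ => fderivSnd F (s, q) :=
    hF'.1.continuous.comp (by fun_prop)
  refine intervalIntegral.hasFDerivAt_integral_of_dominated_of_fderiv_le
    (s := Metric.ball q 1) (bound := fun _ => C * (2 + ‖q‖) ^ P)
    (F := fun y s => F (s, y)) (F' := fun y s => fderivSnd F (s, y))
    (Metric.ball_mem_nhds q one_pos)
    (Eventually.of_forall fun y => (hcont y).aestronglyMeasurable)
    ((hcont q).intervalIntegrable _ _) hcont'.aestronglyMeasurable
    (Eventually.of_forall fun s hs y hy => (h s hs y).trans ?_) (by simp)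
    (Eventually.of_forall fun s _ y _ => ?_)
  · unfold growth
    gcongr C * ?_ ^ P
    linarith [norm_lt_of_mem_ball hy]
  · exact HasFDerivAt.comp (g := F) (f := fun y => (s, y)) y
      (hF.1.differentiable (by simp) (s, y)).hasFDerivAt (hasFDerivAt_prodMk_right s y)

lemma contDiff_integral_unitInterval (n : ℕ) (hF : F.HasTemperateGrowth) :
    ContDiff ℝ n (fun q => ∫ s in (0 : ℝ)..1, F (s, q)) ∧ ∃ P C, ∀ q,
      ‖iteratedFDeriv ℝ n (fun q => ∫ s in (0 : ℝ)..1, F (s, q)) q‖ ≤ growth P C q := by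
  induction n generalizing V with
  | zero =>
    refine ⟨contDiff_zero.2 (continuous_iff_continuousAt.2 fun q =>
      (hasFDerivAt_integral_unitInterval hF q).continuousAt), ?_⟩
    obtain ⟨P, C, -, h⟩ := exists_norm_le_of_mem_unitInterval hF
    refine ⟨P, C, fun q => ?_⟩
    rw [norm_iteratedFDeriv_zero]
    simpa using intervalIntegral.norm_integral_le_of_norm_le_const fun s hs => h s hs q
  | succ n ih =>
    have hderiv : fderiv ℝ (fun q => ∫ s in (0 : ℝ)..1, F (s, q)) =
        fun q => ∫ s in (0 : ℝ)..1, fderivSnd F (s, q) :=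
      funext fun q => (hasFDerivAt_integral_unitInterval hF q).fderiv
    obtain ⟨hsmooth, P, C, hbound⟩ := ih (hasTemperateGrowth_fderivSnd hF)
    refine ⟨?_, P, C, fun q => ?_⟩
    · push_cast
      refine contDiff_succ_iff_fderiv.2
        ⟨fun q => (hasFDerivAt_integral_unitInterval hF q).differentiableAt, by simp, ?_⟩
      rwa [hderiv]
    · rw [← norm_iteratedFDeriv_fderiv, hderiv]
      exact hbound q

lemma hasTemperateGrowth_integral_unitInterval (hF : F.HasTemperateGrowth) :
    (fun q => ∫ s in (0 : ℝ)..1, F (s, q)).HasTemperateGrowth :=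
  ⟨contDiff_infty.2 fun n => (contDiff_integral_unitInterval n hF).1,
    fun n => (contDiff_integral_unitInterval n hF).2⟩

end ParametricIntegral

section MagneticPhase

variable {d : ℕ} {A : Conf d → Conf d}

lemma hasTemperateGrowth_cexp_neg_I_mul :
    (fun t : ℝ => Complex.exp (-Complex.I * t)).HasTemperateGrowth := by
  have hd (t : ℝ) : HasDerivAt (fun t : ℝ => Complex.exp (-Complex.I * t))
      (-Complex.I * Complex.exp (-Complex.I * t)) t := by
    simpa [mul_comm] using
      ((Complex.ofRealCLM.hasDerivAt (x := t)).const_mul (-Complex.I)).cexp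
  have hi (n : ℕ) : iteratedDeriv n (fun t : ℝ => Complex.exp (-Complex.I * t)) =
      fun t : ℝ => (-Complex.I) ^ n * Complex.exp (-Complex.I * t) := by
    induction n with
    | zero => simp
    | succ n ih =>
      rw [iteratedDeriv_succ, ih]
      funext t
      rw [((hd t).const_mul _).deriv, pow_succ, mul_assoc]
  refine ⟨(contDiff_const.mul Complex.ofRealCLM.contDiff).cexp, fun n => ⟨0, 1, fun t => ?_⟩⟩
  rw [norm_iteratedFDeriv_eq_norm_iteratedDeriv, hi, norm_mul, norm_pow, norm_neg,
    Complex.norm_I, Complex.norm_exp]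
  simp

lemma hasTemperateGrowth_gammaA_add (hA : A.HasTemperateGrowth) :
    (fun p : Phase d => gammaA A p.1 (p.1 + p.2)).HasTemperateGrowth := by
  have hline : (fun r : ℝ × Phase d => r.2.1 + r.1 • r.2.2).HasTemperateGrowth :=
    (ContinuousLinearMap.fst ℝ (Conf d) (Conf d) ∘L
      ContinuousLinearMap.snd ℝ ℝ (Phase d)).hasTemperateGrowth.add
    ((ContinuousLinearMap.fst ℝ ℝ (Phase d)).hasTemperateGrowth.smul
      (ContinuousLinearMap.snd ℝ (Conf d) (Conf d) ∘L
        ContinuousLinearMap.snd ℝ ℝ (Phase d)).hasTemperateGrowth)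
  have hsegment (p : Phase d) : gammaA A p.1 (p.1 + p.2) =
      ∫ s in (0 : ℝ)..1, A (p.1 + s • p.2) := by
    unfold gammaA
    congr! 3 with s
    module
  simpa only [hsegment, Function.comp_apply] using
    hasTemperateGrowth_integral_unitInterval (hA.comp hline)

lemma hasTemperateGrowth_omegaA_add (hA : A.HasTemperateGrowth) :
    (fun p : Phase d => omegaA A p.1 (p.1 + p.2)).HasTemperateGrowth := by
  have hcirc (p : Phase d) : circulation A p.1 (p.1 + p.2) =
      inner ℝ p.2 (gammaA A p.1 (p.1 + p.2)) := by
    rw [circulation, sub_add_cancel_left, inner_neg_left, neg_neg]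
  refine hasTemperateGrowth_cexp_neg_I_mul.comp
    (f := fun p : Phase d => circulation A p.1 (p.1 + p.2)) ?_
  simp only [hcirc]
  exact (innerSL ℝ).bilinear_hasTemperateGrowth (𝕜 := ℝ)
    (ContinuousLinearMap.snd ℝ (Conf d) (Conf d)).hasTemperateGrowth
    (hasTemperateGrowth_gammaA_add hA)

lemma hasTemperateGrowth_omegaA_right (hA : A.HasTemperateGrowth) (x : Conf d) :
    (omegaA A x).HasTemperateGrowth := by
  have hshift : (fun y : Conf d => ((x, y - x) : Phase d)).HasTemperateGrowth := by
    have h := (Function.HasTemperateGrowth.const ((x, -x) : Phase d)).add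
      (ContinuousLinearMap.inr ℝ (Conf d) (Conf d)).hasTemperateGrowth
    convert h using 2 with y
    simp [sub_eq_neg_add]
  simpa [Function.comp_def] using (hasTemperateGrowth_omegaA_add hA).comp hshift

end MagneticPhase

/-! ### Monomials in commuting operators -/

section Monomials

variable {M : Type*} [Monoid M] {d : ℕ}

/-- The monomial `g_1^{α_1} ⋯ g_d^{α_d}`, with the factors in this order. -/
def monomialOp (g : Fin d → M) (α : Fin d → ℕ) : M :=
  ((List.finRange d).map fun j => g j ^ α j).prod

lemma list_prod_map_mul_of_commute {ι : Type*} {f g : ι → M} (h : ∀ i j, Commute (f i) (g j))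
    (l : List ι) : (l.map fun i => f i * g i).prod = (l.map f).prod * (l.map g).prod := by
  induction l with
  | nil => simp
  | cons a l ih =>
    have hcomm : Commute (l.map f).prod (g a) := Commute.list_prod_left _ _ <| by
      simpa using fun i _ => h i a
    simp only [List.map_cons, List.prod_cons, ih, mul_assoc]
    rw [← mul_assoc (l.map f).prod, hcomm.eq, mul_assoc]

lemma monomialOp_zero (g : Fin d → M) : monomialOp g 0 = 1 := by
  simp [monomialOp]

lemma monomialOp_single (g : Fin d → M) (i : Fin d) : monomialOp g (Pi.single i 1) = g i := by
  rw [monomialOp, List.prod_map_eq_pow_single i _ fun j hj _ => by simp [hj],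
    List.count_eq_one_of_mem (List.nodup_finRange d) (List.mem_finRange i)]
  simp

lemma monomialOp_add {g : Fin d → M} (hg : ∀ i j, Commute (g i) (g j)) (α β : Fin d → ℕ) :
    monomialOp g (α + β) = monomialOp g α * monomialOp g β := by
  simpa only [monomialOp, Pi.add_apply, pow_add] using
    list_prod_map_mul_of_commute (fun i j => (hg i j).pow_pow (α i) (β j)) (List.finRange d)

lemma monomialOp_mul {g h : Fin d → M} (hgh : ∀ i j, Commute (g i) (h j)) (α : Fin d → ℕ) :
    monomialOp (fun j => g j * h j) α = monomialOp g α * monomialOp h α := by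
  simpa only [monomialOp, (hgh _ _).mul_pow] using
    list_prod_map_mul_of_commute (fun i j => (hgh i j).pow_pow (α i) (α j)) (List.finRange d)

lemma commute_monomialOp {g : Fin d → M} {x : M} (hx : ∀ i, Commute (g i) x) (α : Fin d → ℕ) :
    Commute (monomialOp g α) x :=
  Commute.list_prod_left _ _ <| by simpa using fun i => (hx i).pow_left (α i)

lemma sum_pow_eq_sum_monomialOp {R : Type*} [Semiring R] {g : Fin d → R}
    (hg : ∀ i j, Commute (g i) (g j)) (n : ℕ) :
    (∑ j, g j) ^ n = ∑ α ∈ Finset.piAntidiag (Finset.univ : Finset (Fin d)) n,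
      (Nat.multinomial Finset.univ α : R) * monomialOp g α := by
  rw [Finset.sum_pow_eq_sum_piAntidiag_of_commute _ _ fun i _ j _ _ => hg i j]
  refine Finset.sum_congr rfl fun α _ => congrArg _ ?_
  rw [monomialOp, ← Finset.noncommProd_toFinset (List.finRange d) (fun i => g i ^ α i)
    (fun i _ j _ _ => (hg i j).pow_pow _ _) (List.nodup_finRange d)]
  congr 1
  exact (List.toFinset_finRange d).symm

lemma monomialOp_apply_rel {R V : Type*} [Semiring R] [AddCommMonoid V] [Module R V]
    {g : Fin d → Module.End R V} {r : V → V → Prop} (hr : ∀ j v w, r v w → r (g j v) (g j w))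
    (α : Fin d → ℕ) {v w : V} (h : r v w) : r (monomialOp g α v) (monomialOp g α w) := by
  have hpow (n : ℕ) (j : Fin d) {v w : V} (h : r v w) : r ((g j ^ n) v) ((g j ^ n) w) := by
    induction n with
    | zero => exact h
    | succ n ih =>
      simp only [pow_succ', Module.End.mul_apply]
      exact hr j _ _ ih
  unfold monomialOp
  induction List.finRange d with
  | nil => exact h
  | cons a l ih => exact hpow (α a) a ih

end Monomials

/-! ### Smooth functions on phase space -/

section Smooth

variable {d : ℕ}

/-- The space of smooth functions on phase space. -/
def Smooth (d : ℕ) : Submodule ℂ (Phase d → ℂ) where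
  carrier := {f | ContDiff ℝ ∞ f}
  add_mem' {f g} (hf : ContDiff ℝ ∞ f) (hg : ContDiff ℝ ∞ g) :=
    show ContDiff ℝ ∞ (f + g) from hf.add hg
  zero_mem' := show ContDiff ℝ ∞ (fun _ => 0) from contDiff_const
  smul_mem' c f (hf : ContDiff ℝ ∞ f) :=
    show ContDiff ℝ ∞ (fun p => c • f p) from hf.const_smul c

lemma contDiff_coe (F : Smooth d) : ContDiff ℝ ∞ (F : Phase d → ℂ) := F.2

lemma differentiableAt_coe (F : Smooth d) (p : Phase d) :
    DifferentiableAt ℝ (F : Phase d → ℂ) p := (contDiff_coe F).differentiable (by simp) p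

/-- The derivative in the direction `v` as an operator on smooth functions. -/
def dirDeriv (v : Phase d) : Module.End ℂ (Smooth d) where
  toFun F := ⟨fun p => fderiv ℝ (F : Phase d → ℂ) p v,
    ((contDiff_coe F).fderiv_right (m := ∞) (by simp)).clm_apply contDiff_const⟩
  map_add' F G := by
    ext p
    change fderiv ℝ ((F : Phase d → ℂ) + (G : Phase d → ℂ)) p v = _
    rw [fderiv_add (differentiableAt_coe F p) (differentiableAt_coe G p)]
    rfl
  map_smul' c F := by
    ext p
    change fderiv ℝ (c • (F : Phase d → ℂ)) p v = _
    rw [fderiv_const_smul (differentiableAt_coe F p)]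
    rfl

lemma dirDeriv_dirDeriv_apply (v w : Phase d) (F : Smooth d) (p : Phase d) :
    (dirDeriv v (dirDeriv w F) : Phase d → ℂ) p =
      fderiv ℝ (fderiv ℝ (F : Phase d → ℂ)) p v w := by
  have h : DifferentiableAt ℝ (fderiv ℝ (F : Phase d → ℂ)) p :=
    ((contDiff_coe F).fderiv_right (m := ∞) (by simp)).differentiable (by simp) p
  change fderiv ℝ (fun p => fderiv ℝ (F : Phase d → ℂ) p w) p v = _
  rw [fderiv_clm_apply h (differentiableAt_const w)]
  simp

lemma commute_dirDeriv (v w : Phase d) : Commute (dirDeriv v) (dirDeriv w) := by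
  refine LinearMap.ext fun F => Subtype.ext (funext fun p => ?_)
  simp only [Module.End.mul_apply, dirDeriv_dirDeriv_apply]
  refine (contDiff_coe F).contDiffAt.isSymmSndFDerivAt ?_ v w
  rw [minSmoothness_of_isRCLikeNormedField]
  exact WithTop.coe_le_coe.2 (le_top (a := (2 : ℕ∞)))

/-- The operator `∂_{x_j}` on smooth functions. -/
abbrev opX (j : Fin d) : Module.End ℂ (Smooth d) := dirDeriv (dirX j)

/-- The operator `∂_{ξ_j}` on smooth functions. -/
abbrev opXi (j : Fin d) : Module.End ℂ (Smooth d) := dirDeriv (dirXi j)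

/-- The operator `-i ∑_j ∂_{x_j} ∂_{ξ_j}` on smooth functions. -/
def opMixed (d : ℕ) : Module.End ℂ (Smooth d) := ∑ j, (-Complex.I) • (opX j * opXi j)

lemma coe_opMixed (F : Smooth d) : (opMixed d F : Phase d → ℂ) = mixedOp (F : Phase d → ℂ) := by
  have h : opMixed d F = ∑ j, (-Complex.I) • opXi j (opX j F) := by
    rw [opMixed, LinearMap.sum_apply]
    refine Finset.sum_congr rfl fun j _ => ?_
    rw [commute_dirDeriv]
    rfl
  funext p
  rw [h, AddSubmonoidClass.coe_finsetSum, Finset.sum_apply]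
  rfl

lemma coe_opMixed_pow (n : ℕ) (F : Smooth d) :
    ((opMixed d ^ n) F : Phase d → ℂ) = mixedOp^[n] (F : Phase d → ℂ) := by
  induction n with
  | zero => rfl
  | succ n ih => rw [pow_succ', Module.End.mul_apply, coe_opMixed, ih, Function.iterate_succ_apply']

lemma commute_opMixed (v : Phase d) : Commute (dirDeriv v) (opMixed d) :=
  Commute.sum_right _ _ _ fun _ _ =>
    ((commute_dirDeriv v _).mul_right (commute_dirDeriv v _)).smul_right _

lemma multiPow_coe {P : Fin d → (Phase d → ℂ) → Phase d → ℂ} {g : Fin d → Module.End ℂ (Smooth d)}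
    (h : ∀ j (F : Smooth d), P j F = g j F) (α : Fin d → ℕ) (F : Smooth d) :
    multiPow P α (F : Phase d → ℂ) = monomialOp g α F := by
  have hpow (n : ℕ) (j : Fin d) (F : Smooth d) : (P j)^[n] F = (g j ^ n) F := by
    induction n with
    | zero => rfl
    | succ n ih => rw [pow_succ', Function.iterate_succ_apply', ih, h, Module.End.mul_apply]
  unfold multiPow monomialOp
  induction List.finRange d with
  | nil => rfl
  | cons a l ih =>
    rw [List.foldr_cons, ih, hpow, List.map_cons, List.prod_cons, Module.End.mul_apply]

/-- The operator `∂_x^α ∂_ξ^β` on smooth functions. -/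
def opMulti (α β : Fin d → ℕ) : Module.End ℂ (Smooth d) := monomialOp opX α * monomialOp opXi β

lemma multiPow_partialX_partialXi_coe (α β : Fin d → ℕ) (F : Smooth d) :
    multiPow partialX α (multiPow partialXi β (F : Phase d → ℂ)) = opMulti α β F := by
  rw [multiPow_coe (g := opXi) fun _ _ => rfl, multiPow_coe (g := opX) fun _ _ => rfl]
  rfl

lemma commute_opMulti (α β : Fin d → ℕ) {x : Module.End ℂ (Smooth d)}
    (h : ∀ v, Commute (dirDeriv v) x) : Commute (opMulti α β) x :=
  (commute_monomialOp (fun _ => h _) α).mul_left (commute_monomialOp (fun _ => h _) β)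

lemma opMulti_zero : opMulti (0 : Fin d → ℕ) 0 = 1 := by
  simp [opMulti, monomialOp_zero]

lemma opMulti_single_zero (j : Fin d) : opMulti (Pi.single j 1) 0 = opX j := by
  rw [opMulti, monomialOp_single, monomialOp_zero, mul_one]

lemma opMulti_zero_single (j : Fin d) : opMulti 0 (Pi.single j 1) = opXi j := by
  rw [opMulti, monomialOp_single, monomialOp_zero, one_mul]

lemma opMulti_mul_opMulti (α β α' β' : Fin d → ℕ) :
    opMulti α β * opMulti α' β' = opMulti (α + α') (β + β') := by
  have hcomm : Commute (monomialOp (opXi (d := d)) β) (monomialOp opX α') :=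
    commute_monomialOp (fun _ => (commute_monomialOp (fun _ => commute_dirDeriv _ _) α').symm) β
  simp only [opMulti, monomialOp_add fun _ _ => commute_dirDeriv _ _, mul_assoc]
  rw [← mul_assoc (monomialOp opXi β), hcomm.eq, mul_assoc]

end Smooth

/-! ### Symbol classes -/

section SymbolBound

variable {d : ℕ} {m : ℝ} {F G : Smooth d}

/-- The estimates that define the symbol class `S^m`, for a smooth function. -/
def SymbolBound (m : ℝ) (F : Smooth d) : Prop :=
  ∀ α β : Fin d → ℕ, ∃ C : ℝ, ∀ p : Phase d,
    ‖(opMulti α β F : Phase d → ℂ) p‖ ≤ C * bracket p.2 ^ (m - len β)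

lemma symbolBound_iff : SymbolBound m F ↔ IsSymbol m (F : Phase d → ℂ) := by
  have hbracket (C t r : ℝ) (ξ : Conf d) :
      bracket ξ ^ (r - m) * t ≤ C ↔ t ≤ C * bracket ξ ^ (m - r) := by
    rw [← neg_sub, Real.rpow_neg (bracket_pos ξ).le, inv_mul_le_iff₀ (bracket_rpow_pos _ ξ),
      mul_comm]
  simp only [IsSymbol, contDiff_coe F, true_and, multiPow_partialX_partialXi_coe, hbracket]
  simp only [SymbolBound, Prod.forall]

lemma SymbolBound.mono {m' : ℝ} (h : SymbolBound m F) (hm : m ≤ m') : SymbolBound m' F :=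
  fun α β => by
    obtain ⟨C, hC⟩ := h α β
    refine ⟨|C|, fun p => (hC p).trans ?_⟩
    have hpos := bracket_rpow_pos (m - len β) p.2
    gcongr
    · exact le_abs_self C
    · exact one_le_bracket _

lemma SymbolBound.add (hF : SymbolBound m F) (hG : SymbolBound m G) : SymbolBound m (F + G) :=
  fun α β => by
    obtain ⟨C, hC⟩ := hF α β
    obtain ⟨C', hC'⟩ := hG α β
    refine ⟨C + C', fun p => ?_⟩
    rw [map_add, add_mul]
    exact (norm_add_le _ _).trans (add_le_add (hC p) (hC' p))

lemma SymbolBound.smul (hF : SymbolBound m F) (c : ℂ) : SymbolBound m (c • F) := fun α β => by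
  obtain ⟨C, hC⟩ := hF α β
  refine ⟨‖c‖ * C, fun p => ?_⟩
  rw [map_smul, mul_assoc]
  exact (norm_smul_le _ _).trans (mul_le_mul_of_nonneg_left (hC p) (norm_nonneg c))

lemma SymbolBound.sum {ι : Type*} (s : Finset ι) {F : ι → Smooth d}
    (h : ∀ i ∈ s, SymbolBound m (F i)) : SymbolBound m (∑ i ∈ s, F i) :=
  Finset.sum_induction F (SymbolBound m) (fun _ _ => .add) (fun _ _ => ⟨0, by simp⟩) h

lemma SymbolBound.opMulti (hF : SymbolBound m F) (α β : Fin d → ℕ) :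
    SymbolBound (m - len β) (opMulti α β F) := fun α' β' => by
  obtain ⟨C, hC⟩ := hF (α' + α) (β' + β)
  refine ⟨C, fun p => ?_⟩
  have hlen : len (β' + β) = len β' + len β := Finset.sum_add_distrib
  rw [← Module.End.mul_apply, opMulti_mul_opMulti, sub_sub, add_comm (len β : ℝ), ← Nat.cast_add,
    ← hlen]
  exact hC p

lemma SymbolBound.opX (hF : SymbolBound m F) (j : Fin d) : SymbolBound m (opX j F) := by
  simpa [opMulti_single_zero, len] using hF.opMulti (Pi.single j 1) 0

lemma SymbolBound.opXi (hF : SymbolBound m F) (j : Fin d) : SymbolBound (m - 1) (opXi j F) := by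
  simpa [opMulti_zero_single, len] using hF.opMulti 0 (Pi.single j 1)

lemma SymbolBound.opMixed (hF : SymbolBound m F) : SymbolBound (m - 1) (opMixed d F) := by
  rw [MagneticPsiDO.opMixed, LinearMap.sum_apply]
  exact .sum _ fun j _ => ((hF.opXi j).opX j).smul _

lemma SymbolBound.opMixed_pow (hF : SymbolBound m F) (n : ℕ) :
    SymbolBound (m - n) ((MagneticPsiDO.opMixed d ^ n) F) := by
  induction n with
  | zero => simpa using hF
  | succ n ih =>
    rw [pow_succ', Module.End.mul_apply, Nat.cast_succ, ← sub_sub]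
    exact ih.opMixed

end SymbolBound

/-! ### The shear of a symbol and its expansion -/

section SmoothShear

variable {d : ℕ} {m : ℝ} {F : Smooth d}

lemma exists_norm_iteratedFDeriv_le (n : ℕ) (hF : SymbolBound m F) :
    ∃ C : ℝ, ∀ p, ‖iteratedFDeriv ℝ n (F : Phase d → ℂ) p‖ ≤ C * bracket p.2 ^ m := by
  induction n generalizing F with
  | zero =>
    obtain ⟨C, hC⟩ := hF 0 0
    refine ⟨C, fun p => ?_⟩
    rw [norm_iteratedFDeriv_zero]
    simpa [opMulti_zero, len] using hC p
  | succ n ih =>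
    let e := (EuclideanSpace.basisFun (Fin d) ℝ).toBasis.prod
      (EuclideanSpace.basisFun (Fin d) ℝ).toBasis
    have he (i : Fin d ⊕ Fin d) : SymbolBound m (dirDeriv (e i) F) := by
      rcases i with j | j
      · simpa [e, opX, dirX] using hF.opX j
      · simpa [e, opXi, dirXi] using (hF.opXi j).mono (sub_le_self m zero_le_one)
    choose C hC using fun i => ih (he i)
    refine ⟨∑ i, ‖LinearMap.toContinuousLinearMap (e.coord i)‖ * C i, fun p => ?_⟩
    refine (norm_iteratedFDeriv_succ_le_sum e
      ((contDiff_coe F).of_le (mod_cast le_top)) p).trans ?_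
    rw [Finset.sum_mul]
    refine Finset.sum_le_sum fun i _ => ?_
    rw [mul_assoc]
    exact mul_le_mul_of_nonneg_left (hC i p) (norm_nonneg _)

lemma SymbolBound.isUnifSymbol (hF : SymbolBound m F) : IsUnifSymbol m (F : Phase d → ℂ) := by
  intro N
  choose C hC using fun n => exists_norm_iteratedFDeriv_le n hF
  refine ⟨∑ n ∈ Finset.range (N + 1), |C n|, contDiff_coe F, fun n hn p => (hC n p).trans ?_⟩
  refine mul_le_mul_of_nonneg_right ((le_abs_self _).trans ?_) (bracket_rpow_pos m p.2).le
  exact Finset.single_le_sum (f := fun n => |C n|) (fun i _ => abs_nonneg _)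
    (Finset.mem_range.2 (Nat.lt_succ_of_le hn))

/-- The shear of a symbol, which quantizes it with another base point, as a smooth function. -/
def smoothShear (s : ℝ) (hF : SymbolBound m F) : Smooth d :=
  ⟨shear s (F : Phase d → ℂ), contDiff_shear hF.isUnifSymbol s⟩

lemma opMulti_smoothShear (s : ℝ) (hF : SymbolBound m F) (α β : Fin d → ℕ) :
    (opMulti α β (smoothShear s hF) : Phase d → ℂ) = shear s (opMulti α β F : Phase d → ℂ) := by
  let IsShear (F G : Smooth d) : Prop :=
    (∃ m, SymbolBound m F) ∧ (G : Phase d → ℂ) = shear s (F : Phase d → ℂ)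
  have hX (j : Fin d) (F G : Smooth d) : IsShear F G → IsShear (opX j F) (opX j G) := by
    rintro ⟨⟨m, hF⟩, hG⟩
    refine ⟨⟨_, hF.opX j⟩, ?_⟩
    change partialX j (G : Phase d → ℂ) = _
    rw [hG]
    exact partialX_shear hF.isUnifSymbol s j
  have hXi (j : Fin d) (F G : Smooth d) : IsShear F G → IsShear (opXi j F) (opXi j G) := by
    rintro ⟨⟨m, hF⟩, hG⟩
    refine ⟨⟨_, hF.opXi j⟩, ?_⟩
    change partialXi j (G : Phase d → ℂ) = _
    rw [hG]
    exact partialXi_shear hF.isUnifSymbol s j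
  have hβ := monomialOp_apply_rel (r := IsShear) hXi β (v := F) (w := smoothShear s hF)
    ⟨⟨m, hF⟩, rfl⟩
  exact (monomialOp_apply_rel (r := IsShear) hX α hβ).2

/-- The Taylor polynomial `∑_{j < k} (s^j / j!) (-i ∑_l ∂_{x_l} ∂_{ξ_l})^j F` of the shear in the
parameter `s`. -/
def taylorPart (k : ℕ) (s : ℝ) (F : Smooth d) : Smooth d :=
  ∑ j ∈ Finset.range k, ((s ^ j / j.factorial : ℝ) : ℂ) • (opMixed d ^ j) F

lemma coe_sub_taylorPart {k : ℕ} {s : ℝ} {G : Smooth d}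
    (hG : (G : Phase d → ℂ) = shear s (F : Phase d → ℂ)) :
    ((G - taylorPart k s F : Smooth d) : Phase d → ℂ) = shearRem k s (F : Phase d → ℂ) := by
  funext p
  have hpart : (taylorPart k s F : Phase d → ℂ) p = ∑ j ∈ Finset.range k,
      (s ^ j / j.factorial : ℝ) • (mixedOp^[j] (F : Phase d → ℂ)) p := by
    rw [taylorPart, AddSubmonoidClass.coe_finsetSum, Finset.sum_apply]
    refine Finset.sum_congr rfl fun j _ => ?_
    rw [← coe_opMixed_pow, Complex.real_smul]
    rfl
  rw [shearRem, ← hpart, ← hG]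
  rfl

lemma opMulti_taylorPart (k : ℕ) (s : ℝ) (F : Smooth d) (α β : Fin d → ℕ) :
    opMulti α β (taylorPart k s F) = taylorPart k s (opMulti α β F) := by
  simp only [taylorPart, map_sum, map_smul, ← Module.End.mul_apply,
    ((commute_opMulti α β commute_opMixed).pow_right _).eq]

lemma symbolBound_smoothShear_sub_taylorPart (k : ℕ) (s : ℝ) (hF : SymbolBound m F) :
    SymbolBound (m - k) (smoothShear s hF - taylorPart k s F) := by
  intro α β
  obtain ⟨C, hC⟩ := exists_norm_shearRem_le (m := m - len β) (abs_nonneg s) k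
    (a := (opMulti α β F : Phase d → ℂ)) fun j _ => by
      rw [← coe_opMixed_pow]
      exact ((hF.opMulti α β).opMixed_pow j).isUnifSymbol
  refine ⟨C, fun p => ?_⟩
  rw [map_sub, opMulti_taylorPart, coe_sub_taylorPart (opMulti_smoothShear s hF α β),
    sub_right_comm]
  exact hC s le_rfl p

lemma SymbolBound.smoothShear (s : ℝ) (hF : SymbolBound m F) :
    SymbolBound m (smoothShear s hF) := by
  simpa [taylorPart] using symbolBound_smoothShear_sub_taylorPart 0 s hF

end SmoothShear

section SeriesTerm

variable {d : ℕ} {m : ℝ} {F : Smooth d}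

lemma opMixed_pow_eq_sum (n : ℕ) :
    opMixed d ^ n = ∑ α ∈ Finset.piAntidiag (Finset.univ : Finset (Fin d)) n,
      (Nat.multinomial Finset.univ α : Module.End ℂ (Smooth d)) *
        (monomialOp (fun j => (-Complex.I) • opX j) α * monomialOp opXi α) := by
  have hcomm (v : Phase d) (j : Fin d) :
      Commute (dirDeriv v) ((-Complex.I) • opX j * opXi j) :=
    ((commute_dirDeriv v _).smul_right _).mul_right (commute_dirDeriv v _)
  simp only [opMixed, ← smul_mul_assoc]
  rw [sum_pow_eq_sum_monomialOp fun i j => ((hcomm _ j).smul_left _).mul_left (hcomm _ j)]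
  simp only [monomialOp_mul fun _ _ => (commute_dirDeriv _ _).smul_left _]

lemma one_div_multiFactorial (α : Fin d → ℕ) :
    1 / (multiFactorial α : ℂ) = Nat.multinomial Finset.univ α / ((len α).factorial : ℂ) := by
  have hspec : (multiFactorial α : ℂ) * Nat.multinomial Finset.univ α = (len α).factorial :=
    mod_cast Nat.multinomial_spec Finset.univ α
  have hfactorial : (multiFactorial α : ℂ) ≠ 0 := by
    simp [multiFactorial, Finset.prod_ne_zero_iff, Nat.factorial_ne_zero]
  rw [div_eq_div_iff hfactorial (Nat.cast_ne_zero.2 (Nat.factorial_ne_zero _)), one_mul, ← hspec,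
    mul_comm]

lemma seriesTerm_coe (c : ℝ) (F : Smooth d) (n : ℕ) :
    seriesTerm c (F : Phase d → ℂ) n =
      ((((c ^ n / n.factorial : ℝ) : ℂ) • (opMixed d ^ n) F : Smooth d) : Phase d → ℂ) := by
  have hmonomial (α : Fin d → ℕ) : multiPow dX α (multiPow partialXi α (F : Phase d → ℂ)) =
      (monomialOp (fun j => (-Complex.I) • opX j) α * monomialOp opXi α) F := by
    rw [multiPow_coe (g := opXi) fun _ _ => rfl,
      multiPow_coe (g := fun j => (-Complex.I) • opX j) fun _ _ => rfl]
    rfl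
  funext p
  simp only [seriesTerm, hmonomial]
  rw [opMixed_pow_eq_sum, LinearMap.sum_apply, Finset.smul_sum, AddSubmonoidClass.coe_finsetSum,
    Finset.sum_apply]
  refine Finset.sum_congr rfl fun α hα => ?_
  obtain rfl : len α = n := (Finset.mem_piAntidiag.1 hα).1
  generalize monomialOp (fun j => (-Complex.I) • opX j) α * monomialOp opXi α = P
  rw [one_div_multiFactorial, Module.End.mul_apply, Module.End.natCast_apply,
    ← Nat.cast_smul_eq_nsmul ℂ]
  simp only [Submodule.coe_smul, Pi.smul_apply, smul_eq_mul]
  push_cast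
  ring

lemma isAsymptoticSum_shear (s : ℝ) (hF : SymbolBound m F) :
    IsAsymptoticSum (fun j => m - j) (seriesTerm s (F : Phase d → ℂ))
      (shear s (F : Phase d → ℂ)) := by
  refine ⟨fun i j hij => sub_le_sub_left (Nat.cast_le.2 hij) m,
    tendsto_atBot_add_const_left _ m
      (tendsto_neg_atTop_atBot.comp tendsto_natCast_atTop_atTop), fun j => ?_, ?_, fun k _ => ?_⟩
  · rw [seriesTerm_coe]
    exact symbolBound_iff.1 ((hF.opMixed_pow j).smul _)
  · beta_reduce
    rw [Nat.cast_zero, sub_zero]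
    exact symbolBound_iff.1 (hF.smoothShear s)
  · convert symbolBound_iff.1 (symbolBound_smoothShear_sub_taylorPart k s hF) using 1
    funext p
    simp only [seriesTerm_coe, taylorPart, smoothShear, Submodule.coe_sub, Pi.sub_apply,
      AddSubmonoidClass.coe_finsetSum, Finset.sum_apply]

end SeriesTerm

/-! ### Magnetic quantizations -/

section MagneticQuantization

variable {d q : ℕ} {m : ℝ} {A : Conf d → Conf d} {a : Phase d → ℂ}

/-- `T` is the magnetic `τ`-quantization of `a`, with amplitude `a ((1 - τ) x + τ y, η)`: the left
quantization for `τ = 0` and the Weyl quantization for `τ = 1 / 2`. -/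
def IsMagneticTau (A : Conf d → Conf d) (τ : ℝ) (a : Phase d → ℂ)
    (T : 𝓢(Conf d, ℂ) →L[ℂ] 𝓢(Conf d, ℂ)) : Prop :=
  HasAmplitude A (fun x y η => a ((1 - τ) • x + τ • y, η)) T

lemma isMagneticTau_zero {T : 𝓢(Conf d, ℂ) →L[ℂ] 𝓢(Conf d, ℂ)} :
    IsMagneticTau A 0 a T ↔ IsMagneticLeft A a T := by
  simp [IsMagneticTau, IsMagneticLeft]

lemma isMagneticTau_one_half {T : 𝓢(Conf d, ℂ) →L[ℂ] 𝓢(Conf d, ℂ)} :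
    IsMagneticTau A (1 / 2) a T ↔ IsMagneticWeyl A a T := by
  have hmid (x y : Conf d) : (1 - 1 / 2 : ℝ) • x + (1 / 2 : ℝ) • y = (1 / 2 : ℝ) • (x + y) := by
    module
  simp only [IsMagneticTau, IsMagneticWeyl, hmid]

lemma hasOscIntegral_of_isAmplitude {F : Phase d → ℂ} (hF : IsAmplitude q F) (w₁ : Phase d)
    {f : Phase d → ℂ} (hf : ∀ w, f (w + w₁) = phase w * F w) : HasOscIntegral f (osc F) := by
  have hshift (χ : 𝓢(Phase d, ℂ)) (ε : ℝ) : (fun w => χ (ε • (w + w₁)) • (phase w • F w)) =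
      fun w => (fun p => χ (ε • p) * f p) (w + w₁) := by
    simp only [hf, smul_eq_mul]
  refine fun χ hχ => ⟨fun ε hε => ?_, ?_⟩
  · have h := integrable_cutoff_smul_phase_smul hF χ hε w₁
    rw [hshift] at h
    simpa using h.comp_sub_right w₁
  · have h := tendsto_integral_cutoff_smul hF χ w₁
    rw [hχ, one_smul] at h
    refine h.congr fun ε => ?_
    rw [hshift, integral_add_right_eq_self (fun p => χ (ε • p) * f p)]

/-- `y ↦ ω^A(x, y) u(y)` as a Schwartz function. It is zero by convention unless `ω^A(x, ·)` has
temperate growth. -/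
def magneticTwist (A : Conf d → Conf d) (x : Conf d) (u : 𝓢(Conf d, ℂ)) : 𝓢(Conf d, ℂ) :=
  SchwartzMap.smulLeftCLM ℂ (omegaA A x) u

lemma magneticTwist_apply (hA : A.HasTemperateGrowth) (x : Conf d) (u : 𝓢(Conf d, ℂ))
    (y : Conf d) : magneticTwist A x u y = omegaA A x y * u y :=
  SchwartzMap.smulLeftCLM_apply_apply (hasTemperateGrowth_omegaA_right hA x) u y

/-- The value at `x` of the magnetic `τ`-quantization of `a` applied to `u`, as an oscillating
integral over `w = (y - x, η)`. -/
def tauValue (A : Conf d → Conf d) (τ : ℝ) (a : Phase d → ℂ) (u : 𝓢(Conf d, ℂ)) (x : Conf d) : ℂ :=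
  ((((2 * Real.pi) ^ d)⁻¹ : ℝ) : ℂ) • osc (quantAmp x (magneticTwist A x u) τ a)

lemma tauValue_shear (ha : IsUnifSymbol m a) (τ c : ℝ) :
    tauValue A (τ - c) (shear c a) = tauValue A τ a := by
  funext u x
  rw [tauValue, osc_quantAmp_shear ha, tauValue]

lemma isMagneticTau_of_eq_tauValue (hA : A.HasTemperateGrowth) (ha : IsUnifSymbol m a) {τ : ℝ}
    {T : 𝓢(Conf d, ℂ) →L[ℂ] 𝓢(Conf d, ℂ)} (hT : ∀ u x, T u x = tauValue A τ a u x) :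
    IsMagneticTau A τ a T := by
  intro u x
  have hamp := ha.quantAmp x (magneticTwist A x u) τ
  rw [hT, tauValue, ← osc_smul _ hamp]
  refine hasOscIntegral_of_isAmplitude (hamp.const_smul _) (x, 0) fun w => ?_
  have hbase : ((1 - τ) • x + τ • (x + w.1), w.2) = (x, 0) + dilate τ w := by
    ext1 <;> simp only [dilate_apply, Prod.fst_add, Prod.snd_add] <;> module
  simp only [quantAmp, magneticTwist_apply hA, phase, Prod.fst_add, Prod.snd_add, add_zero,
    add_comm w.1 x, hbase, sub_add_cancel_left, inner_neg_left, smul_eq_mul]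
  push_cast
  ring_nf

lemma exists_eq_tauValue_zero (hA : A.HasTemperateGrowth) (ha : IsUnifSymbol m a) :
    ∃ T : 𝓢(Conf d, ℂ) →L[ℂ] 𝓢(Conf d, ℂ), ∀ u x, T u x = tauValue A 0 a u x := by
  have hk : (fun p : Phase d => ((((2 * Real.pi) ^ d)⁻¹ : ℝ) : ℂ) *
      omegaA A p.1 (p.1 + p.2)).HasTemperateGrowth :=
    (Function.HasTemperateGrowth.const _).mul (hasTemperateGrowth_omegaA_add hA)
  refine ⟨leftOpCLM hk ha, fun u x => ?_⟩
  rw [leftOpCLM_apply, tauValue, ← osc_smul _ (ha.quantAmp x (magneticTwist A x u) 0)]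
  congr 1
  funext w
  have hbase : ((x, 0) + dilate 0 w : Phase d) = (x, w.2) := by simp [dilate_apply]
  simp only [leftAmp, quantAmp, magneticTwist_apply hA, smul_eq_mul, hbase]
  ring

lemma exists_eq_tauValue (hA : A.HasTemperateGrowth) {F : Smooth d} (hF : SymbolBound m F)
    (τ : ℝ) : ∃ T : 𝓢(Conf d, ℂ) →L[ℂ] 𝓢(Conf d, ℂ), ∀ u x, T u x = tauValue A τ F u x := by
  have h := exists_eq_tauValue_zero hA (hF.smoothShear τ).isUnifSymbol
  rwa [← sub_self τ, smoothShear, tauValue_shear hF.isUnifSymbol] at h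

end MagneticQuantization

end MagneticPsiDO

end

theorem proposition1p14_general {d : ℕ} {A : MagneticPsiDO.Conf d → MagneticPsiDO.Conf d}
    (hA : A.HasTemperateGrowth) {m : ℝ} (τ τ' : ℝ) {a : MagneticPsiDO.Phase d → ℂ}
    (ha : MagneticPsiDO.IsSymbol m a) :
    ∃ b : MagneticPsiDO.Phase d → ℂ, MagneticPsiDO.IsSymbol m b ∧
      (∃ T : 𝓢(MagneticPsiDO.Conf d, ℂ) →L[ℂ] 𝓢(MagneticPsiDO.Conf d, ℂ),
        MagneticPsiDO.IsMagneticTau A τ a T ∧ MagneticPsiDO.IsMagneticTau A τ' b T) ∧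
      MagneticPsiDO.IsAsymptoticSum (fun j => m - j)
        (MagneticPsiDO.seriesTerm (τ - τ') a) b := by
  have hF : MagneticPsiDO.SymbolBound m ⟨a, ha.1⟩ := MagneticPsiDO.symbolBound_iff.2 ha
  have hb := hF.smoothShear (τ - τ')
  obtain ⟨T, hT⟩ := MagneticPsiDO.exists_eq_tauValue hA hF τ
  refine ⟨MagneticPsiDO.shear (τ - τ') a, MagneticPsiDO.symbolBound_iff.1 hb,
    ⟨T, MagneticPsiDO.isMagneticTau_of_eq_tauValue hA hF.isUnifSymbol hT,
      MagneticPsiDO.isMagneticTau_of_eq_tauValue hA hb.isUnifSymbol fun u x => ?_⟩,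
    MagneticPsiDO.isAsymptoticSum_shear (τ - τ') hF⟩
  rw [hT, ← MagneticPsiDO.tauValue_shear hF.isUnifSymbol τ (τ - τ'), sub_sub_cancel]
  rfl

theorem proposition1p14 (d : ℕ)
    (B : Fin d → Fin d → MagneticPsiDO.Conf d → ℝ) (hB : MagneticPsiDO.IsMagneticField B)
    (A : MagneticPsiDO.Conf d → MagneticPsiDO.Conf d)
    (hA : MagneticPsiDO.IsVectorPotential A B) (m : ℝ) :
    (∀ a : MagneticPsiDO.Phase d → ℂ, MagneticPsiDO.IsSymbol m a →
      ∃ b : MagneticPsiDO.Phase d → ℂ, MagneticPsiDO.IsSymbol m b ∧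
        (∃ T : 𝓢(MagneticPsiDO.Conf d, ℂ) →L[ℂ] 𝓢(MagneticPsiDO.Conf d, ℂ),
          MagneticPsiDO.IsMagneticWeyl A a T ∧ MagneticPsiDO.IsMagneticLeft A b T) ∧
        MagneticPsiDO.IsAsymptoticSum (fun j => m - j)
          (MagneticPsiDO.seriesTerm (1 / 2) a) b) ∧
    (∀ b : MagneticPsiDO.Phase d → ℂ, MagneticPsiDO.IsSymbol m b →
      ∃ a : MagneticPsiDO.Phase d → ℂ, MagneticPsiDO.IsSymbol m a ∧
        (∃ T : 𝓢(MagneticPsiDO.Conf d, ℂ) →L[ℂ] 𝓢(MagneticPsiDO.Conf d, ℂ),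
          MagneticPsiDO.IsMagneticLeft A b T ∧ MagneticPsiDO.IsMagneticWeyl A a T) ∧
        MagneticPsiDO.IsAsymptoticSum (fun j => m - j)
          (MagneticPsiDO.seriesTerm (-(1 / 2)) b) a) := by
  simp only [← MagneticPsiDO.isMagneticTau_zero, ← MagneticPsiDO.isMagneticTau_one_half]
  exact ⟨fun a ha => by simpa using proposition1p14_general hA.temperate (1 / 2) 0 ha,
    fun b hb => by simpa using proposition1p14_general hA.temperate 0 (1 / 2) hb⟩
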